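/- Let $d\ge 3$ and $N>1$ be integers, write $\langle r\rangle=(1+r^2)^{1/2}$, and let $\mu:\mathbb{R}^d\to\mathbb{R}$ be smooth and such that for all $m\in\mathbb{N}$, $M>0$ there is $C_{m,M}$ with $|\nabla_v^m\mu(v)|\le C_{m,M}\langle v\rangle^{-M}$ for all $v\in\mathbb{R}^d$. Let $E:[0,\infty)\times\mathbb{R}^d\to\mathbb{R}^d$ be a vector field whose $x$-derivatives of order at most $N$ exist and are continuous in $(t,x)$. Let $(X_{s,t}(x,v),V_{s,t}(x,v))$, $0\le s\le t$, be its characteristics, $$\frac{d}{ds}X_{s,t}=V_{s,t},\qquad \frac{d}{ds}V_{s,t}=E(s,X_{s,t}),\qquad X_{t,t}(x,v)=x,\quad V_{t,t}(x,v)=v,$$ and define $Y_{s,t},W_{s,t}$ by $X_{s,t}(x,v)=x-(t-s)v+Y_{s,t}(x-tv,v)$ and $V_{s,t}(x,v)=v+W_{s,t}(x-tv,v)$. Put $$\mathcal R(t,x)=\int_0^t\!\int_{\mathbb{R}^d}E(s,x-(t-s)v)\cdot\nabla_v\mu(v)\,dv\,ds-\int_0^t\!\int_{\mathbb{R}^d}E(s,X_{s,t}(x,v))\cdot\nabla_v\mu(V_{s,t}(x,v))\,dv\,ds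 .$$ For every $A>0$ there are $\varepsilon_0>0$ and $C>0$, depending only on $d,N,\mu,A$, such that the following holds for every $\varepsilon\in(0,\varepsilon_0]$ and every such $E$. Assume that for all $0\le k\le N$ $$\langle t\rangle^{d+k}\|\nabla_x^kE(t)\|_{L^\infty}\le A\varepsilon\log(2+t),\qquad \langle t\rangle^{k}\|\nabla_x^kE(t)\|_{L^1}\le A\varepsilon\log(2+t)\qquad(t\ge 0),$$ $$\|\nabla_v^kY_{s,t}\|_{L^\infty}\le A\varepsilon\frac{\log(2+s)}{(1+s)^{d-2}},\qquad \|\nabla_v^kW_{s,t}\|_{L^\infty}\le A\varepsilon\frac{\log(2+s)}{(1+s)^{d-1}}\qquad(0\le s\le t).$$ Then for every $t\ge 0$ the function $\mathcal R(t,\cdot)$ is of class $C^N$, and $$\max_{0\le k\le N}\Big(\langle t\rangle^k\|\nabla_x^k\mathcal R(t)\|_{L^1}+\langle t\rangle^{d+k}\|\nabla_x^k\mathcal R(t)\|_{L^\infty}\Big)\le C\varepsilon^2 .$$ -/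

import Mathlib

open MeasureTheory Set
open scoped ENNReal ContDiff

noncomputable section

/-- The space `ℝ^d` with its Euclidean norm and Lebesgue measure. -/
abbrev Rd (d : ℕ) : Type := EuclideanSpace ℝ (Fin d)

/-- The Japanese bracket `⟨r⟩ = (1 + r ^ 2) ^ (1 / 2)`. -/
def japanese (r : ℝ) : ℝ := Real.sqrt (1 + r ^ 2)

/-- Every derivative of `μ` decays faster than any power of `⟨v⟩`: for all `m` and all `M > 0` there
is a constant with `|∇^m μ (v)| ≤ C ⟨v⟩ ^ (-M)` for every `v`. -/
def RapidDecay {d : ℕ} (μ : Rd d → ℝ) : Prop :=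
  ∀ (m : ℕ) (M : ℝ), 0 < M → ∃ C : ℝ, ∀ v : Rd d,
    ‖iteratedFDeriv ℝ m μ v‖ ≤ C * japanese ‖v‖ ^ (-M)

/-- `E (t, x)`, `t ≥ 0`, is a classical time-dependent vector field of class `C^N` in `x`: all
`x`-derivatives of order at most `N` exist and are continuous in `(t, x)`. -/
def IsClassicalField {d : ℕ} (N : ℕ) (E : ℝ → Rd d → Rd d) : Prop :=
  (∀ t : ℝ, 0 ≤ t → ContDiff ℝ N (E t)) ∧
  ∀ k : ℕ, k ≤ N →
    ContinuousOn (fun p : ℝ × Rd d => iteratedFDeriv ℝ k (E p.1) p.2) (Ici 0 ×ˢ univ)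

/-- `X s t x v` and `V s t x v` (`0 ≤ s ≤ t`) are the characteristics of `E`:
`d/ds X = V`, `d/ds V = E (s, X)`, with `X = x` and `V = v` at time `s = t`. -/
def IsCharacteristics {d : ℕ} (E : ℝ → Rd d → Rd d)
    (X V : ℝ → ℝ → Rd d → Rd d → Rd d) : Prop :=
  ∀ (t : ℝ), 0 ≤ t → ∀ x v : Rd d,
    X t t x v = x ∧ V t t x v = v ∧
    ∀ s ∈ Icc (0 : ℝ) t,
      HasDerivWithinAt (fun σ : ℝ => X σ t x v) (V s t x v) (Icc 0 t) s ∧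
      HasDerivWithinAt (fun σ : ℝ => V σ t x v) (E s (X s t x v)) (Icc 0 t) s

/-- The position perturbation `Y`, defined by `X s t x v = x - (t - s) v + Y s t (x - t v) v`. -/
def posPert {d : ℕ} (X : ℝ → ℝ → Rd d → Rd d → Rd d) (s t : ℝ) (y v : Rd d) : Rd d :=
  X s t (y + t • v) v - (y + s • v)

/-- The velocity perturbation `W`, defined by `V s t x v = v + W s t (x - t v) v`. -/
def velPert {d : ℕ} (V : ℝ → ℝ → Rd d → Rd d → Rd d) (s t : ℝ) (y v : Rd d) : Rd d :=
  V s t (y + t • v) v - v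

/-- Decay of the field, for `0 ≤ k ≤ N` and `t ≥ 0`:
`⟨t⟩ ^ (d + k) ‖∇^k E (t)‖_{L^∞} ≤ A ε log (2 + t)` and
`⟨t⟩ ^ k ‖∇^k E (t)‖_{L^1} ≤ A ε log (2 + t)`.
The derivatives are continuous, so the `L^∞` bound is written pointwise. -/
def FieldDecay {d : ℕ} (N : ℕ) (A ε : ℝ) (E : ℝ → Rd d → Rd d) : Prop :=
  ∀ k : ℕ, k ≤ N → ∀ t : ℝ, 0 ≤ t →
    (∀ x : Rd d, japanese t ^ (d + k) * ‖iteratedFDeriv ℝ k (E t) x‖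
      ≤ A * ε * Real.log (2 + t)) ∧
    ENNReal.ofReal (japanese t ^ k) * eLpNorm (iteratedFDeriv ℝ k (E t)) 1 volume
      ≤ ENNReal.ofReal (A * ε * Real.log (2 + t))

/-- Decay of order `(1 + s) ^ (-p)` of the `v`-derivatives of a family `Z s t y v`:
`‖∇_v^k Z s t‖_{L^∞} ≤ A ε log (2 + s) / (1 + s) ^ p` for `0 ≤ k ≤ N` and `0 ≤ s ≤ t`. -/
def PertDecay {d : ℕ} (N : ℕ) (A ε : ℝ) (p : ℕ) (Z : ℝ → ℝ → Rd d → Rd d → Rd d) : Prop :=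
  ∀ k : ℕ, k ≤ N → ∀ s t : ℝ, 0 ≤ s → s ≤ t → ∀ y v : Rd d,
    ‖iteratedFDeriv ℝ k (fun u : Rd d => Z s t y u) v‖
      ≤ A * ε * Real.log (2 + s) / (1 + s) ^ p

/-- The linear reaction term `∫_0^t ∫ E (s, x - (t - s) v) · ∇μ (v) dv ds`. -/
def reactionL {d : ℕ} (E : ℝ → Rd d → Rd d) (μ : Rd d → ℝ) (t : ℝ) (x : Rd d) : ℝ :=
  ∫ s in (0 : ℝ)..t, ∫ v : Rd d, inner ℝ (E s (x - (t - s) • v)) (gradient μ v)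

/-- The nonlinear reaction term `∫_0^t ∫ E (s, X s t x v) · ∇μ (V s t x v) dv ds`. -/
def reactionNL {d : ℕ} (E : ℝ → Rd d → Rd d) (μ : Rd d → ℝ)
    (X V : ℝ → ℝ → Rd d → Rd d → Rd d) (t : ℝ) (x : Rd d) : ℝ :=
  ∫ s in (0 : ℝ)..t, ∫ v : Rd d, inner ℝ (E s (X s t x v)) (gradient μ (V s t x v))

/-- The reaction term `R = R_L - R_NL`. -/
def reaction {d : ℕ} (E : ℝ → Rd d → Rd d) (μ : Rd d → ℝ)
    (X V : ℝ → ℝ → Rd d → Rd d → Rd d) (t : ℝ) (x : Rd d) : ℝ :=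
  reactionL E μ t x - reactionNL E μ X V t x

end

/-! The linear and nonlinear reaction terms differ only through the bending of the trajectories. The
bending has size `ε` and the field is itself of size `ε`, which gives the factor `ε²`. Three devices
turn this into decay without losing a derivative of `E`.

Slanted derivatives. The velocity is integrated over all of `ℝ^d`, so it may be shifted freely:
moving `x` by `T h`, with `T = max 1 t`, can be accompanied by moving `v` by `h`. Hence `T ^ k ∇^k`
of a reaction term is the integral of derivatives in the directions `(T h, h)`
(`contDiff_shifted_integral`). In such a direction the free position at time `s` moves by at most
`(1 + s)‖h‖`, so each derivative falling on `E` costs one factor `1 + s`, which the decay of `∇^k E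
(s)` pays for.

Flow regularity. After division by `1 + σ`, the position curve solves `ξ = free + 𝒦 ξ` in
`C([0,t])`, where `𝒦` is a Volterra operator composed with superposition by the rescaled field. All
derivatives of `𝒦` of order `1, …, N` are at most `1/2`. Consequently the slanted derivatives of
position and velocity deviate from the free ones by `O(ε (1 + σ) ^ (-7/4))`, uniformly in `t`
(`exists_flow_curves`).

Straightening. Comparing `E` at two different points would require a derivative of order `N + 1`.
Instead, for fixed `s < t` and `x`, the linear integral is rewritten by the substitution `w =
meanVel X s t x v`, the velocity of the straight line with the same endpoints. Both integrands then
evaluate `E` at the same point, and the errors lie in the Jacobian, in the argument of `∇μ` and in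
the derivatives of the trajectories. Each is `O(ε (1 + s) ^ (-7/4))`, which yields
`exists_reaction_bound`.

There remains a free-transport integral of the field against an integrable velocity weight. Tonelli
gives its `L^1` bound. For `L^∞` the factor `T ^ (-d)` comes from the pointwise decay of `E` if `s`
is comparable to `T`, and from dispersion, through the `L^1` norm of `E`, otherwise. The logarithm
costs a quarter power, and `(1 + s) ^ (-3/2)` is integrable. -/

noncomputable section

set_option maxSynthPendingDepth 3
set_option linter.unusedSectionVars false

/-! ### Higher derivatives of the difference of two compositions. -/

section ComparisonOfCompositions

/-- Induction through `D(g∘f₁ - g∘f₂) = (Dg∘f₁ - Dg∘f₂) Df₁ + (Dg∘f₂)(Df₁ - Df₂)`: the induction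
hypothesis for `Dg` treats the first product, the Faà di Bruno bound the second. The codomain `G` is
quantified after `K` because it changes at each step. No derivative of `g` beyond order `n` enters,
which matters when the two base points coincide. -/
theorem exists_norm_iteratedFDeriv_comp_sub_comp_le (H F : Type) [NormedAddCommGroup H]
    [NormedSpace ℝ H] [NormedAddCommGroup F] [NormedSpace ℝ F] (D : ℝ) (hD : 1 ≤ D) (n : ℕ) :
    ∃ K : ℝ, 0 ≤ K ∧ ∀ (G : Type) [NormedAddCommGroup G] [NormedSpace ℝ G] (g : F → G)
      (f₁ f₂ : H → F) (x : H) (C δ : ℝ), 0 ≤ C → 0 ≤ δ →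
      ContDiff ℝ n g → ContDiff ℝ n f₁ → ContDiff ℝ n f₂ →
      (∀ i ≤ n, ‖iteratedFDeriv ℝ i g (f₁ x)‖ ≤ C) →
      (∀ i ≤ n, ‖iteratedFDeriv ℝ i g (f₂ x)‖ ≤ C) →
      (∀ i ≤ n, ‖iteratedFDeriv ℝ i g (f₁ x) - iteratedFDeriv ℝ i g (f₂ x)‖ ≤ C * δ) →
      (∀ i, 1 ≤ i → i ≤ n → ‖iteratedFDeriv ℝ i f₁ x‖ ≤ D) →
      (∀ i, 1 ≤ i → i ≤ n → ‖iteratedFDeriv ℝ i f₂ x‖ ≤ D) →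
      (∀ i, 1 ≤ i → i ≤ n → ‖iteratedFDeriv ℝ i (f₁ - f₂) x‖ ≤ δ) →
      ‖iteratedFDeriv ℝ n (g ∘ f₁ - g ∘ f₂) x‖ ≤ K * (C * δ) := by
  induction n using Nat.strong_induction_on with
  | _ n ih =>
  rcases n with _ | n
  · refine ⟨1, zero_le_one, ?_⟩
    intro G _ _ g f₁ f₂ x C δ hC hδ hg h1 h2 _ _ hsub _ _ _
    have := hsub 0 le_rfl
    rw [norm_iteratedFDeriv_zero]
    have e : ‖iteratedFDeriv ℝ 0 g (f₁ x) - iteratedFDeriv ℝ 0 g (f₂ x)‖ = ‖g (f₁ x) - g (f₂ x)‖ := by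
      rw [iteratedFDeriv_zero_eq_comp]
      simp only [Function.comp]
      rw [← map_sub, LinearIsometryEquiv.norm_map]
    rw [e] at this
    simpa using this
  · choose! K hK0 hK using ih
    refine ⟨∑ i ∈ Finset.range (n + 1), ((n.choose i : ℝ) * K i * D
        + (n.choose i : ℝ) * ((i.factorial : ℝ) * D ^ i)), ?_, ?_⟩
    · refine Finset.sum_nonneg fun i hi => ?_
      have := hK0 i (by simpa using hi)
      positivity
    intro G _ _ g f₁ f₂ x C δ hC hδ hg h1 h2 hg1 hg2 hsub hf1 hf2 hf12
    have hdg : ContDiff ℝ n (fderiv ℝ g) := hg.fderiv_right (by norm_cast)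
    have hd1 : ContDiff ℝ n (fderiv ℝ f₁) := h1.fderiv_right (by norm_cast)
    have hd2 : ContDiff ℝ n (fderiv ℝ f₂) := h2.fderiv_right (by norm_cast)
    have h1n : ContDiff ℝ n f₁ := h1.of_le (by norm_cast; omega)
    have h2n : ContDiff ℝ n f₂ := h2.of_le (by norm_cast; omega)
    have dg : Differentiable ℝ g := hg.differentiable (by simp)
    have d1 : Differentiable ℝ f₁ := h1.differentiable (by simp)
    have d2 : Differentiable ℝ f₂ := h2.differentiable (by simp)
    set L := ContinuousLinearMap.compL ℝ H F G
    have hL : ‖L‖ ≤ 1 := ContinuousLinearMap.norm_compL_le ℝ H F G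
    set a₁ := fderiv ℝ g ∘ f₁
    set a₂ := fderiv ℝ g ∘ f₂
    have ha1 : ContDiff ℝ n a₁ := hdg.comp h1n
    have ha2 : ContDiff ℝ n a₂ := hdg.comp h2n
    have key : fderiv ℝ (g ∘ f₁ - g ∘ f₂) =
        (fun y => L ((a₁ - a₂) y) (fderiv ℝ f₁ y)) +
          (fun y => L (a₂ y) ((fderiv ℝ f₁ - fderiv ℝ f₂) y)) := by
      ext1 y
      rw [fderiv_sub ((dg _).comp y (d1 y)) ((dg _).comp y (d2 y)),
        fderiv_comp y (dg _) (d1 y), fderiv_comp y (dg _) (d2 y)]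
      ext z
      simp [L, a₁, a₂]
    rw [← norm_iteratedFDeriv_fderiv, key]
    have c1 : ContDiff ℝ n (fun y => L ((a₁ - a₂) y) (fderiv ℝ f₁ y)) :=
      L.isBoundedBilinearMap.contDiff.comp₂ (ha1.sub ha2) hd1
    have c2 : ContDiff ℝ n (fun y => L (a₂ y) ((fderiv ℝ f₁ - fderiv ℝ f₂) y)) :=
      L.isBoundedBilinearMap.contDiff.comp₂ ha2 (hd1.sub hd2)
    rw [iteratedFDeriv_add c1 c2]
    refine (norm_add_le _ _).trans ?_
    rw [Finset.sum_add_distrib, add_mul]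
    refine add_le_add ?_ ?_
    · refine (L.norm_iteratedFDeriv_le_of_bilinear_of_le_one (ha1.sub ha2) hd1 x le_rfl hL).trans ?_
      rw [Finset.sum_mul]
      refine Finset.sum_le_sum fun i hi => ?_
      have hi' : i ≤ n := by simpa [Nat.lt_succ_iff] using hi
      have e1 : ‖iteratedFDeriv ℝ i (a₁ - a₂) x‖ ≤ K i * (C * δ) := by
        refine hK i (by omega) _ (fderiv ℝ g) f₁ f₂ x C δ hC hδ (hdg.of_le (by exact_mod_cast hi'))
          (h1n.of_le (by exact_mod_cast hi')) (h2n.of_le (by exact_mod_cast hi')) ?_ ?_ ?_ ?_ ?_ ?_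
        · intro j hj; rw [norm_iteratedFDeriv_fderiv]; exact hg1 _ (by omega)
        · intro j hj; rw [norm_iteratedFDeriv_fderiv]; exact hg2 _ (by omega)
        · intro j hj
          have := hsub (j + 1) (by omega)
          simp only [iteratedFDeriv_succ_eq_comp_right, Function.comp] at this
          rwa [← map_sub, LinearIsometryEquiv.norm_map] at this
        · intro j hj hj'; exact hf1 j hj (by omega)
        · intro j hj hj'; exact hf2 j hj (by omega)
        · intro j hj hj'; exact hf12 j hj (by omega)
      have e2 : ‖iteratedFDeriv ℝ (n - i) (fderiv ℝ f₁) x‖ ≤ D := by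
        rw [norm_iteratedFDeriv_fderiv]; exact hf1 _ (by omega) (by omega)
      have := hK0 i (by omega)
      calc _ ≤ (n.choose i : ℝ) * (K i * (C * δ)) * D := by gcongr; exact e1
        _ = _ := by ring
    · refine (L.norm_iteratedFDeriv_le_of_bilinear_of_le_one ha2 (hd1.sub hd2) x le_rfl hL).trans ?_
      rw [Finset.sum_mul]
      refine Finset.sum_le_sum fun i hi => ?_
      have hi' : i ≤ n := by simpa [Nat.lt_succ_iff] using hi
      have e1 : ‖iteratedFDeriv ℝ i a₂ x‖ ≤ i.factorial * C * D ^ i := by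
        refine norm_iteratedFDeriv_comp_le hdg h2n (by exact_mod_cast hi') x ?_ ?_
        · intro j hj; rw [norm_iteratedFDeriv_fderiv]; exact hg2 _ (by omega)
        · intro j hj hj'
          exact (hf2 j hj (by omega)).trans (le_self_pow₀ hD (by omega))
      have e2 : ‖iteratedFDeriv ℝ (n - i) (fderiv ℝ f₁ - fderiv ℝ f₂) x‖ ≤ δ := by
        have : fderiv ℝ f₁ - fderiv ℝ f₂ = fderiv ℝ (f₁ - f₂) := by
          ext1 y; rw [fderiv_sub (d1 y) (d2 y)]; rfl
        rw [this, norm_iteratedFDeriv_fderiv]; exact hf12 _ (by omega) (by omega)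
      calc _ ≤ (n.choose i : ℝ) * (i.factorial * C * D ^ i) * δ := by gcongr; exact e2
        _ = _ := by ring

end ComparisonOfCompositions

/-! ### Repeated differentiation under the integral sign. -/

section ParametricIntegral

/-- Dominated differentiation is applied to each derivative in turn, viewed as a map into
multilinear maps; currying is a linear isometry and so commutes with the integral. A dominating
function is needed only on a unit ball around each point. -/
theorem hasFTaylorSeriesUpTo_integral {α H G : Type*} [MeasurableSpace α] {ν : Measure α}
    [NormedAddCommGroup H] [NormedSpace ℝ H] [NormedAddCommGroup G] [NormedSpace ℝ G]
    {N : ℕ} {f : α → H → G}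
    (hf : ∀ᵐ a ∂ν, ContDiff ℝ N (f a))
    (hmeas : ∀ k ≤ N, ∀ h, AEStronglyMeasurable (fun a => iteratedFDeriv ℝ k (f a) h) ν)
    (hb : ∀ k ≤ N, ∀ h₀, ∃ b : α → ℝ, Integrable b ν ∧
      ∀ᵐ a ∂ν, ∀ h ∈ Metric.ball h₀ 1, ‖iteratedFDeriv ℝ k (f a) h‖ ≤ b a) :
    HasFTaylorSeriesUpTo N (fun h => ∫ a, f a h ∂ν)
      (fun h k => ∫ a, iteratedFDeriv ℝ k (f a) h ∂ν) := by
  refine ⟨?_, ?_, ?_⟩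
  · intro h
    change (continuousMultilinearCurryFin0 ℝ H G) _ = _
    rw [← LinearIsometryEquiv.coe_toContinuousLinearEquiv, ← ContinuousLinearEquiv.integral_comp_comm]
    rfl
  · intro m hm h
    have hm' : m < N := by exact_mod_cast hm
    obtain ⟨b, hbi, hb'⟩ := hb (m + 1) hm' h
    obtain ⟨b0, hbi0, hb0⟩ := hb m hm'.le h
    have hint : Integrable (fun a => iteratedFDeriv ℝ m (f a) h) ν :=
      hbi0.mono' (hmeas m hm'.le h) (hb0.mono fun a ha => ha h (Metric.mem_ball_self one_pos))
    let e := (continuousMultilinearCurryLeftEquiv ℝ (fun _ : Fin (m + 1) => H) G)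
    have key := hasFDerivAt_integral_of_dominated_of_fderiv_le (μ := ν) (𝕜 := ℝ)
      (F := fun h a => iteratedFDeriv ℝ m (f a) h)
      (F' := fun h a => e (iteratedFDeriv ℝ (m + 1) (f a) h)) (x₀ := h) (bound := b)
      (Metric.ball_mem_nhds h one_pos)
      (Filter.Eventually.of_forall fun h' => hmeas m hm'.le h') hint
      ?_ ?_ hbi ?_
    · have : (∫ a, iteratedFDeriv ℝ (m + 1) (f a) h ∂ν).curryLeft
          = ∫ a, e (iteratedFDeriv ℝ (m + 1) (f a) h) ∂ν := by
        have := ContinuousLinearEquiv.integral_comp_comm (μ := ν) e.toContinuousLinearEquiv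
          (fun a => iteratedFDeriv ℝ (m + 1) (f a) h)
        exact this.symm
      simp only [Nat.succ_eq_add_one]
      rw [this]
      exact key
    · exact e.continuous.comp_aestronglyMeasurable (hmeas (m + 1) hm' h)
    · filter_upwards [hb'] with a ha h' hh'
      rw [LinearIsometryEquiv.norm_map]
      exact ha h' hh'
    · filter_upwards [hf] with a ha h' hh'
      exact (ha.ftaylorSeries.fderiv m (by exact_mod_cast hm') h')
  · intro m hm
    have hm' : m ≤ N := by exact_mod_cast hm
    rw [continuous_iff_continuousAt]
    intro h
    obtain ⟨b, hbi, hb'⟩ := hb m hm' h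
    refine continuousAt_of_dominated (bound := b)
      (Filter.Eventually.of_forall fun h' => hmeas m hm' h') ?_ hbi ?_
    · filter_upwards [Metric.ball_mem_nhds h one_pos] with h' hh'
      filter_upwards [hb'] with a ha
      exact ha h' hh'
    · filter_upwards [hf] with a ha
      exact (ha.continuous_iteratedFDeriv (by exact_mod_cast hm')).continuousAt

end ParametricIntegral

/-! ### The Jacobian determinant near the identity. -/

section Determinant

theorem contDiff_continuousLinearMap_det {E : Type*} [NormedAddCommGroup E] [NormedSpace ℝ E]
    [FiniteDimensional ℝ E] {n : WithTop ℕ∞} : ContDiff ℝ n (fun A : E →L[ℝ] E => A.det) := by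
  let b := Module.finBasis ℝ E
  have : (fun A : E →L[ℝ] E => A.det) =
      fun A => ∑ σ : Equiv.Perm (Fin (Module.finrank ℝ E)), (Equiv.Perm.sign σ : ℝ) *
        ∏ i, (b.coord (σ i)) (A (b i)) := by
    ext A
    rw [ContinuousLinearMap.det, ← LinearMap.det_toMatrix b, Matrix.det_apply']
    simp [LinearMap.toMatrix_apply]
  rw [this]
  refine ContDiff.sum fun σ _ => contDiff_const.mul (contDiff_prod fun i _ => ?_)
  have : (fun A : E →L[ℝ] E => (b.coord (σ i)) (A (b i))) =
      ((b.coord (σ i)).toContinuousLinearMap.comp (ContinuousLinearMap.apply ℝ E (b i))) := by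
    ext A; rfl
  rw [this]
  exact ContinuousLinearMap.contDiff _

/-- The determinant is a polynomial in the entries, so its derivative is bounded on the compact unit
ball around the identity, and the mean value inequality applies. -/
theorem exists_abs_abs_det_sub_one_le (E : Type*) [NormedAddCommGroup E] [NormedSpace ℝ E]
    [FiniteDimensional ℝ E] : ∃ K : ℝ, 0 ≤ K ∧ ∀ A : E →L[ℝ] E,
      ‖A - ContinuousLinearMap.id ℝ E‖ ≤ 1 → |(|A.det| - 1)| ≤ K * ‖A - ContinuousLinearMap.id ℝ E‖ := by
  have hc : ContDiff ℝ 1 (fun A : E →L[ℝ] E => A.det) := contDiff_continuousLinearMap_det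
  set S := Metric.closedBall (ContinuousLinearMap.id ℝ E) 1
  have hS : IsCompact S := by
    have : ProperSpace (E →L[ℝ] E) := FiniteDimensional.proper ℝ _
    exact isCompact_closedBall _ _
  obtain ⟨K, hK⟩ := hS.exists_bound_of_continuousOn (hc.continuous_fderiv (by simp)).continuousOn
  have hidS : ContinuousLinearMap.id ℝ E ∈ S := Metric.mem_closedBall_self zero_le_one
  refine ⟨K, (norm_nonneg _).trans (hK _ hidS), fun A hA => ?_⟩
  have hAS : A ∈ S := by rwa [Metric.mem_closedBall, dist_eq_norm]
  have := (convex_closedBall (ContinuousLinearMap.id ℝ E) 1).norm_image_sub_le_of_norm_fderiv_le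
    (f := fun A : E →L[ℝ] E => A.det) (fun x _ => hc.differentiable (by simp) x) hK hidS hAS
  have h1 : (ContinuousLinearMap.id ℝ E).det = 1 := by
    simp [ContinuousLinearMap.det]
  simp only [h1] at this
  refine le_trans ?_ this
  rw [Real.norm_eq_abs]
  simpa using abs_abs_sub_abs_le_abs_sub A.det 1

end Determinant

/-! ### Superposition operators on spaces of continuous curves. -/

section Nemytskii

variable {K : Type} [TopologicalSpace K] [CompactSpace K]

/-- A continuous bilinear map acting pointwise on continuous functions on a compact space. -/
def pointwiseBilinear {E₁ E₂ E₃ : Type} [NormedAddCommGroup E₁] [NormedSpace ℝ E₁]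
    [NormedAddCommGroup E₂] [NormedSpace ℝ E₂] [NormedAddCommGroup E₃] [NormedSpace ℝ E₃]
    (B : E₁ →L[ℝ] E₂ →L[ℝ] E₃) : C(K, E₁) →L[ℝ] C(K, E₂) →L[ℝ] C(K, E₃) :=
  LinearMap.mkContinuous₂
    (LinearMap.mk₂ ℝ (fun (a : C(K, E₁)) (b : C(K, E₂)) =>
      (⟨fun τ => B (a τ) (b τ), by fun_prop⟩ : C(K, E₃)))
      (fun _ _ _ => by ext; simp) (fun _ _ _ => by ext; simp)
      (fun _ _ _ => by ext; simp) (fun _ _ _ => by ext; simp)) ‖B‖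
    (fun a b => by
      refine (ContinuousMap.norm_le _ (by positivity)).2 fun τ => ?_
      refine (B.le_opNorm₂ _ _).trans ?_
      gcongr
      · exact a.norm_coe_le_norm τ
      · exact b.norm_coe_le_norm τ)

@[simp] theorem pointwiseBilinear_apply {E₁ E₂ E₃ : Type} [NormedAddCommGroup E₁]
    [NormedSpace ℝ E₁] [NormedAddCommGroup E₂] [NormedSpace ℝ E₂] [NormedAddCommGroup E₃]
    [NormedSpace ℝ E₃] (B : E₁ →L[ℝ] E₂ →L[ℝ] E₃) (a : C(K, E₁)) (b : C(K, E₂)) (τ : K) :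
    pointwiseBilinear B a b τ = B (a τ) (b τ) := rfl

theorem norm_pointwiseBilinear_le {E₁ E₂ E₃ : Type} [NormedAddCommGroup E₁]
    [NormedSpace ℝ E₁] [NormedAddCommGroup E₂] [NormedSpace ℝ E₂] [NormedAddCommGroup E₃]
    [NormedSpace ℝ E₃] (B : E₁ →L[ℝ] E₂ →L[ℝ] E₃) :
    ‖(pointwiseBilinear B : C(K, E₁) →L[ℝ] C(K, E₂) →L[ℝ] C(K, E₃))‖ ≤ ‖B‖ :=
  LinearMap.mkContinuous₂_norm_le _ (norm_nonneg _) _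

variable {F : Type} [NormedAddCommGroup F] [NormedSpace ℝ F]

/-- The superposition operator `γ ↦ (τ ↦ f (τ, γ τ))`. -/
def nemytskii {G : Type} [TopologicalSpace G] (f : C(K × F, G)) (γ : C(K, F)) : C(K, G) :=
  ⟨fun τ => f (τ, γ τ), by fun_prop⟩

@[simp] theorem nemytskii_apply {G : Type} [TopologicalSpace G] (f : C(K × F, G)) (γ : C(K, F))
    (τ : K) : nemytskii f γ τ = f (τ, γ τ) := rfl

theorem continuous_nemytskii [LocallyCompactSpace K] {G : Type} [TopologicalSpace G]
    (f : C(K × F, G)) : Continuous (nemytskii f) := by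
  refine ContinuousMap.continuous_of_continuous_uncurry _ ?_
  simp only [Function.uncurry_def, nemytskii_apply]
  fun_prop

/-- The point is uniformity in `τ`: a single radius around the curve must control the oscillation of
`f'` for all `τ`. Continuity of `nemytskii f'` in the sup norm supplies it, and the mean value
inequality is then applied for each `τ`. -/
theorem hasFDerivAt_nemytskii [LocallyCompactSpace K] {G : Type} [NormedAddCommGroup G]
    [NormedSpace ℝ G] (f : C(K × F, G)) (f' : C(K × F, F →L[ℝ] G))
    (hf : ∀ τ z, HasFDerivAt (fun z => f (τ, z)) (f' (τ, z)) z) (γ : C(K, F)) :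
    HasFDerivAt (nemytskii f)
      (pointwiseBilinear (ContinuousLinearMap.id ℝ (F →L[ℝ] G)) (nemytskii f' γ)) γ := by
  rw [hasFDerivAt_iff_isLittleO, Asymptotics.isLittleO_iff]
  intro c hc
  have hcont := (continuous_nemytskii f').continuousAt (x := γ)
  rw [Metric.continuousAt_iff] at hcont
  obtain ⟨r, hr, hcl⟩ := hcont c hc
  filter_upwards [Metric.ball_mem_nhds γ hr] with γ' hγ'
  refine (ContinuousMap.norm_le _ (by positivity)).2 fun τ => ?_
  simp only [ContinuousMap.sub_apply, nemytskii_apply, pointwiseBilinear_apply,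
    ContinuousLinearMap.coe_id', id_eq]
  have hb : ∀ z ∈ Metric.ball (γ τ) r, ‖f' (τ, z) - f' (τ, γ τ)‖ ≤ c := by
    intro z hz
    rw [mem_ball_iff_norm] at hz
    -- Translating the whole curve by the constant `z - γ τ` gives a curve within `r` of `γ` that
    -- passes through `z` at `τ`.
    have h1 : dist (γ + ContinuousMap.const K (z - γ τ)) γ < r := by
      rw [dist_eq_norm, add_sub_cancel_left]
      exact (ContinuousMap.norm_le _ (norm_nonneg _)).2 (fun _ => le_rfl) |>.trans_lt hz
    have h2 := hcl h1
    rw [dist_eq_norm] at h2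
    have h3 := ((nemytskii f' (γ + ContinuousMap.const K (z - γ τ)) - nemytskii f' γ).norm_coe_le_norm
      τ).trans h2.le
    simpa using h3
  have hγτ : γ' τ ∈ Metric.ball (γ τ) r := by
    rw [mem_ball_iff_norm] at hγ' ⊢
    exact ((γ' - γ).norm_coe_le_norm τ).trans_lt hγ'
  have hmv := (convex_ball (γ τ) r).norm_image_sub_le_of_norm_hasFDerivWithin_le'
    (f := fun z => f (τ, z)) (f' := fun z => f' (τ, z)) (φ := f' (τ, γ τ))
    (fun z _ => (hf τ z).hasFDerivWithinAt) hb (Metric.mem_ball_self hr) hγτ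
  refine hmv.trans ?_
  gcongr
  exact (γ' - γ).norm_coe_le_norm τ

/-- `f (τ, ·)` is of class `C^n`, with derivatives jointly continuous in the parameter. -/
def JointlyContDiff {G : Type} [NormedAddCommGroup G] [NormedSpace ℝ G] (n : ℕ)
    (f : C(K × F, G)) : Prop :=
  (∀ τ, ContDiff ℝ n fun z => f (τ, z)) ∧
    ∀ k ≤ n, Continuous fun p : K × F => iteratedFDeriv ℝ k (fun z => f (p.1, z)) p.2

theorem JointlyContDiff.exists_fderiv {G : Type} [NormedAddCommGroup G] [NormedSpace ℝ G] {n : ℕ}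
    {f : C(K × F, G)} (hf : JointlyContDiff (n + 1) f) :
    ∃ f' : C(K × F, F →L[ℝ] G), (∀ τ, (fun z => f' (τ, z)) = fderiv ℝ (fun z => f (τ, z))) ∧
      JointlyContDiff n f' := by
  have key : ∀ k ≤ n, Continuous fun p : K × F =>
      iteratedFDeriv ℝ k (fderiv ℝ fun z => f (p.1, z)) p.2 := by
    intro k hk
    have h := hf.2 (k + 1) (by omega)
    simp only [iteratedFDeriv_succ_eq_comp_right, Function.comp] at h
    exact (continuousMultilinearCurryRightEquiv' ℝ k F G).symm.comp_continuous_iff.1 h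
  have h0 : Continuous fun p : K × F => fderiv ℝ (fun z => f (p.1, z)) p.2 := by
    have := (continuousMultilinearCurryFin0 ℝ F (F →L[ℝ] G)).continuous.comp (key 0 (Nat.zero_le _))
    simpa [iteratedFDeriv_zero_eq_comp, Function.comp_def] using this
  exact ⟨⟨_, h0⟩, fun τ => rfl, fun τ => (hf.1 τ).fderiv_right (by norm_cast), key⟩

/-- The derivative is a fixed continuous linear map composed with the superposition operator of
`f'`, so the induction stays within the same class of operators. -/
theorem contDiff_nemytskii [LocallyCompactSpace K] (n : ℕ) {G : Type} [NormedAddCommGroup G]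
    [NormedSpace ℝ G] (f : C(K × F, G)) (hf : JointlyContDiff n f) :
    ContDiff ℝ n (nemytskii f) := by
  induction n generalizing G with
  | zero => exact contDiff_zero.2 (continuous_nemytskii f)
  | succ n ih =>
    obtain ⟨f', hf', hj⟩ := hf.exists_fderiv
    have hd := hasFDerivAt_nemytskii f f' (fun τ z => by
      have := congrFun (hf' τ) z
      rw [this]
      exact ((hf.1 τ).differentiable (by simp) z).hasFDerivAt)
    rw [Nat.cast_succ, contDiff_succ_iff_hasFDerivAt]
    refine ⟨_, (ContinuousLinearMap.contDiff _).comp (ih f' hj), hd⟩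

theorem norm_iteratedFDeriv_nemytskii_le [LocallyCompactSpace K] (n : ℕ) {G : Type}
    [NormedAddCommGroup G] [NormedSpace ℝ G] (f : C(K × F, G)) (hf : JointlyContDiff n f) {M : ℝ}
    (hM : 0 ≤ M) (hb : ∀ τ z, ‖iteratedFDeriv ℝ n (fun z => f (τ, z)) z‖ ≤ M) (γ : C(K, F)) :
    ‖iteratedFDeriv ℝ n (nemytskii f) γ‖ ≤ M := by
  induction n generalizing G with
  | zero =>
    rw [norm_iteratedFDeriv_zero]
    exact (ContinuousMap.norm_le _ hM).2 fun τ => by simpa using hb τ (γ τ)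
  | succ n ih =>
    obtain ⟨f', hf', hj⟩ := hf.exists_fderiv
    have hd := hasFDerivAt_nemytskii f f' (fun τ z => by
      have := congrFun (hf' τ) z
      rw [this]
      exact ((hf.1 τ).differentiable (by simp) z).hasFDerivAt)
    have e : fderiv ℝ (nemytskii f) =
        (pointwiseBilinear (K := K) (ContinuousLinearMap.id ℝ (F →L[ℝ] G))) ∘ nemytskii f' :=
      funext fun γ => (hd γ).fderiv
    rw [← norm_iteratedFDeriv_fderiv, e]
    refine (ContinuousLinearMap.norm_iteratedFDeriv_comp_left _
      (contDiff_nemytskii n f' hj).contDiffAt le_rfl).trans ?_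
    have h1 : ‖(pointwiseBilinear (K := K) (ContinuousLinearMap.id ℝ (F →L[ℝ] G)))‖ ≤ 1 :=
      (norm_pointwiseBilinear_le _).trans ContinuousLinearMap.norm_id_le
    refine (mul_le_of_le_one_left (norm_nonneg _) h1).trans (ih f' hj fun τ z => ?_)
    rw [hf', norm_iteratedFDeriv_fderiv]
    exact hb τ z

/-- Transposition of a linear map into a space of continuous functions. -/
def flipEval {P : Type} [NormedAddCommGroup P] [NormedSpace ℝ P] [FiniteDimensional ℝ P] :
    (P →L[ℝ] C(K, F)) →L[ℝ] C(K, P →L[ℝ] F) :=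
  LinearMap.mkContinuous
    { toFun := fun L => ⟨fun s => (ContinuousMap.evalCLM ℝ s).comp L, by
        rw [continuous_clm_apply]
        intro y
        exact (L y).continuous⟩
      map_add' := fun _ _ => by ext; simp
      map_smul' := fun _ _ => by ext; simp } 1
    (fun L => by
      refine (ContinuousMap.norm_le _ (by positivity)).2 fun s => ?_
      refine ContinuousLinearMap.opNorm_le_bound _ (by positivity) fun y => ?_
      rw [one_mul]
      exact ((L y).norm_coe_le_norm s).trans (L.le_opNorm y))

theorem flipEval_apply {P : Type} [NormedAddCommGroup P] [NormedSpace ℝ P] [FiniteDimensional ℝ P]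
    (L : P →L[ℝ] C(K, F)) (s : K) : flipEval L s = (ContinuousMap.evalCLM ℝ s).comp L := rfl

/-- `flipEval` turns the derivative of a curve-valued map into a map valued in curves of linear
maps, so the induction repeats with `F` replaced by `P →L[ℝ] F`. The joint continuity obtained
provides measurability of the integrands later. -/
theorem continuous_iteratedFDeriv_eval [LocallyCompactSpace K] {P : Type} [NormedAddCommGroup P]
    [NormedSpace ℝ P] [FiniteDimensional ℝ P] {F : Type} [NormedAddCommGroup F] [NormedSpace ℝ F]
    (n : ℕ) (f : P → C(K, F)) (hf : ContDiff ℝ n f) :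
    Continuous fun z : K × P => iteratedFDeriv ℝ n (fun p => f p z.1) z.2 := by
  induction n generalizing F with
  | zero =>
    simp only [iteratedFDeriv_zero_eq_comp, Function.comp]
    refine (continuousMultilinearCurryFin0 ℝ P F).symm.continuous.comp ?_
    have := hf.continuous
    fun_prop
  | succ n ih =>
    have h1 := ih (fun p => flipEval (fderiv ℝ f p))
      ((ContinuousLinearMap.contDiff _).comp (hf.fderiv_right (by norm_cast)))
    have e : ∀ s : K, (fun p => flipEval (fderiv ℝ f p) s) = fderiv ℝ (fun p => f p s) := by
      intro s
      ext1 p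
      rw [flipEval_apply]
      exact (((ContinuousMap.evalCLM ℝ s).hasFDerivAt).comp p
        (hf.differentiable (by simp) p).hasFDerivAt).fderiv.symm
    simp only [e] at h1
    simp only [iteratedFDeriv_succ_eq_comp_right, Function.comp]
    exact (continuousMultilinearCurryRightEquiv' ℝ n P F).symm.continuous.comp h1

end Nemytskii

/-! ### Smooth dependence and derivative bounds for fixed points of a contraction. -/

section FixedPoint

variable {B : Type} [NormedAddCommGroup B] [NormedSpace ℝ B]
variable {H : Type} [NormedAddCommGroup H] [NormedSpace ℝ H]

theorem norm_sub_le_two_mul_of_norm_fderiv_le {𝒦 : B → B} (hK : Differentiable ℝ 𝒦)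
    (hb : ∀ γ, ‖fderiv ℝ 𝒦 γ‖ ≤ 1 / 2) (γ γ' : B) :
    ‖γ - γ'‖ ≤ 2 * ‖(γ - 𝒦 γ) - (γ' - 𝒦 γ')‖ := by
  have h1 := convex_univ.norm_image_sub_le_of_norm_fderiv_le (f := 𝒦) (fun x _ => hK x)
    (fun x _ => hb x) (mem_univ γ') (mem_univ γ)
  have h2 : ‖γ - γ'‖ ≤ ‖(γ - 𝒦 γ) - (γ' - 𝒦 γ')‖ + ‖𝒦 γ - 𝒦 γ'‖ := by
    refine le_trans (le_of_eq ?_) (norm_add_le _ _)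
    congr 1
    abel
  linarith

theorem continuous_of_fixedPoint {𝒦 : B → B} (hK : Differentiable ℝ 𝒦)
    (hb : ∀ γ, ‖fderiv ℝ 𝒦 γ‖ ≤ 1 / 2) {u ξ : H → B} (hu : Continuous u)
    (hξ : ∀ p, ξ p = u p + 𝒦 (ξ p)) : Continuous ξ := by
  have hG : ∀ p, ξ p - 𝒦 (ξ p) = u p := fun p => sub_eq_of_eq_add (hξ p)
  rw [Metric.continuous_iff] at hu ⊢
  intro p ε hε
  obtain ⟨δ, hδ, h⟩ := hu p (ε / 2) (by positivity)
  refine ⟨δ, hδ, fun q hq => ?_⟩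
  have h1 := norm_sub_le_two_mul_of_norm_fderiv_le hK hb (ξ q) (ξ p)
  rw [hG, hG] at h1
  have h2 := h q hq
  rw [dist_eq_norm] at h2 ⊢
  linarith

/-- The inverse function theorem for `id - 𝒦`, whose derivative is invertible by a Neumann series.
Continuity of the given solution `ξ` is established beforehand, since it is what identifies `ξ`
locally with the inverse branch applied to `u`. -/
theorem contDiff_of_fixedPoint [CompleteSpace B] {n : ℕ} (hn : n ≠ 0) {𝒦 : B → B}
    (hK : ContDiff ℝ n 𝒦) (hb : ∀ γ, ‖fderiv ℝ 𝒦 γ‖ ≤ 1 / 2) {u ξ : H → B} (hu : ContDiff ℝ n u)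
    (hξ : ∀ p, ξ p = u p + 𝒦 (ξ p)) : ContDiff ℝ n ξ := by
  have hn' : (n : WithTop ℕ∞) ≠ 0 := by exact_mod_cast hn
  have hKd : Differentiable ℝ 𝒦 := hK.differentiable hn'
  have hG : ∀ p, ξ p - 𝒦 (ξ p) = u p := fun p => sub_eq_of_eq_add (hξ p)
  have hcont := continuous_of_fixedPoint hKd hb hu.continuous hξ
  rw [contDiff_iff_contDiffAt]
  intro p
  let G : B → B := fun γ => γ - 𝒦 γ
  have hGc : ContDiffAt ℝ n G (ξ p) := (contDiff_id.sub hK).contDiffAt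
  let U : (B →L[ℝ] B)ˣ := Units.oneSub (fderiv ℝ 𝒦 (ξ p)) ((hb _).trans_lt (by norm_num))
  let e : B ≃L[ℝ] B := ContinuousLinearEquiv.unitsEquiv ℝ B U
  have he : HasFDerivAt G (e : B →L[ℝ] B) (ξ p) := by
    have : (e : B →L[ℝ] B) = ContinuousLinearMap.id ℝ B - fderiv ℝ 𝒦 (ξ p) := by
      ext z
      simp [e, U]
    rw [this]
    exact (hasFDerivAt_id _).sub (hKd _).hasFDerivAt
  have hinv := hGc.to_localInverse he hn'
  have hleft := (hGc.hasStrictFDerivAt' he hn').eventually_left_inverse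
  have hev : ξ =ᶠ[nhds p] (hGc.localInverse he hn') ∘ u := by
    filter_upwards [hcont.continuousAt.eventually hleft] with q hq
    have : G (ξ q) = u q := hG q
    rw [← hq, Function.comp, this]
    simp only [ContDiffAt.localInverse]
  have hGp : G (ξ p) = u p := hG p
  rw [hGp] at hinv
  exact (hinv.comp p hu.contDiffAt).congr_of_eventuallyEq hev

/-- From `Dξ = L + D𝒦(ξ) Dξ`: after `n` further derivatives the only term with the top derivative of
`ξ` on the right has coefficient at most `1/2` and is absorbed on the left, while all others involve
lower orders. The bound depends on `n` alone, hence later not on the time `t`. -/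
theorem exists_norm_iteratedFDeriv_fixedPoint_le (n : ℕ) :
    ∃ D : ℝ, 1 ≤ D ∧ ∀ (H B : Type) [NormedAddCommGroup H] [NormedSpace ℝ H]
      [NormedAddCommGroup B] [NormedSpace ℝ B] (𝒦 : B → B) (c : B) (L : H →L[ℝ] B) (ξ : H → B),
      ContDiff ℝ n 𝒦 → ContDiff ℝ n ξ → ‖L‖ ≤ 1 →
      (∀ j, 1 ≤ j → j ≤ n → ∀ γ, ‖iteratedFDeriv ℝ j 𝒦 γ‖ ≤ 1 / 2) →
      (∀ h, ξ h = c + L h + 𝒦 (ξ h)) →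
      ∀ j, 1 ≤ j → j ≤ n → ∀ h, ‖iteratedFDeriv ℝ j ξ h‖ ≤ D := by
  induction n with
  | zero => exact ⟨1, le_rfl, by intros; omega⟩
  | succ n ih =>
    obtain ⟨D, hD, hDb⟩ := ih
    set S := ∑ i ∈ Finset.range n, (n.choose (i + 1) : ℝ) *
      (((i + 1).factorial : ℝ) * (1 / 2) * D ^ (i + 1)) * D with hS
    refine ⟨max D (2 * (1 + S)), hD.trans (le_max_left _ _), ?_⟩
    intro H B _ _ _ _ 𝒦 c L ξ hK hξc hL hKb hξ j hj hjn h
    have hK' : ContDiff ℝ n 𝒦 := hK.of_le (by norm_cast; omega)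
    have hξ' : ContDiff ℝ n ξ := hξc.of_le (by norm_cast; omega)
    have hlow := hDb H B 𝒦 c L ξ hK' hξ' hL (fun j hj hj' => hKb j hj (by omega)) hξ
    rcases Nat.lt_or_ge n j with hlt | hge
    swap
    · exact (hlow j hj hge h).trans (le_max_left _ _)
    obtain rfl : j = n + 1 := by omega
    refine le_trans ?_ (le_max_right _ _)
    have hKd : Differentiable ℝ 𝒦 := hK.differentiable (by simp)
    have hξd : Differentiable ℝ ξ := hξc.differentiable (by simp)
    have hdK : ContDiff ℝ n (fderiv ℝ 𝒦) := hK.fderiv_right (by norm_cast)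
    have hdξ : ContDiff ℝ n (fderiv ℝ ξ) := hξc.fderiv_right (by norm_cast)
    let M := ContinuousLinearMap.compL ℝ H B B
    have hM : ‖M‖ ≤ 1 := ContinuousLinearMap.norm_compL_le ℝ H B B
    set a := fderiv ℝ 𝒦 ∘ ξ
    have ha : ContDiff ℝ n a := hdK.comp hξ'
    have key : fderiv ℝ ξ = (fun _ => L) + fun y => M (a y) (fderiv ℝ ξ y) := by
      ext1 y
      have h1 : HasFDerivAt ξ (L + (fderiv ℝ 𝒦 (ξ y)).comp (fderiv ℝ ξ y)) y := by
        have h2 : HasFDerivAt (fun h => c + L h + 𝒦 (ξ h))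
            (L + (fderiv ℝ 𝒦 (ξ y)).comp (fderiv ℝ ξ y)) y :=
          (L.hasFDerivAt.const_add c).add ((hKd _).hasFDerivAt.comp y (hξd y).hasFDerivAt)
        rwa [← funext hξ] at h2
      rw [h1.fderiv]
      rfl
    have hMc : ContDiff ℝ n (fun y => M (a y) (fderiv ℝ ξ y)) :=
      M.isBoundedBilinearMap.contDiff.comp₂ ha hdξ
    have h1 : ‖iteratedFDeriv ℝ n (fun _ : H => L) h‖ ≤ 1 := by
      rcases n with _ | n
      · simpa using hL
      · rw [iteratedFDeriv_const_of_ne (by omega)]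
        simp
    have h2 : ‖iteratedFDeriv ℝ n (fun y => M (a y) (fderiv ℝ ξ y)) h‖ ≤
        S + 1 / 2 * ‖iteratedFDeriv ℝ (n + 1) ξ h‖ := by
      refine (M.norm_iteratedFDeriv_le_of_bilinear_of_le_one ha hdξ h le_rfl hM).trans ?_
      -- This isolates the Leibniz term in which no derivative falls on `D𝒦 ∘ ξ`, the one to be
      -- absorbed.
      rw [Finset.sum_range_succ']
      refine add_le_add (Finset.sum_le_sum fun i hi => ?_) ?_
      · have hi' : i < n := Finset.mem_range.1 hi
        have e1 : ‖iteratedFDeriv ℝ (i + 1) a h‖ ≤ (i + 1).factorial * (1 / 2) * D ^ (i + 1) := by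
          refine norm_iteratedFDeriv_comp_le hdK hξ' (by exact_mod_cast hi') h ?_ ?_
          · intro j hj
            rw [norm_iteratedFDeriv_fderiv]
            exact hKb _ (by omega) (by omega) _
          · intro j hj hj'
            exact (hlow j hj (by omega) h).trans (le_self_pow₀ hD (by omega))
        have e2 : ‖iteratedFDeriv ℝ (n - (i + 1)) (fderiv ℝ ξ) h‖ ≤ D := by
          rw [norm_iteratedFDeriv_fderiv]
          exact hlow _ (by omega) (by omega) h
        gcongr
      · have e1 : ‖iteratedFDeriv ℝ 0 a h‖ ≤ 1 / 2 := by
          rw [norm_iteratedFDeriv_zero]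
          have := hKb 1 le_rfl (by omega) (ξ h)
          rwa [norm_iteratedFDeriv_one] at this
        simp only [Nat.choose_zero_right, Nat.cast_one, one_mul, Nat.sub_zero]
        rw [norm_iteratedFDeriv_fderiv]
        gcongr
    have h3 : ‖iteratedFDeriv ℝ (n + 1) ξ h‖ ≤ 1 + (S + 1 / 2 * ‖iteratedFDeriv ℝ (n + 1) ξ h‖) := by
      conv_lhs => rw [← norm_iteratedFDeriv_fderiv, key]
      rw [iteratedFDeriv_add contDiff_const hMc]
      exact (norm_add_le _ _).trans (add_le_add h1 h2)
    linarith

end FixedPoint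

/-! ### Integrals of the time weights. -/

section Weights

theorem integral_one_add_rpow_le {r : ℝ} (hr : 1 < r) {σ t : ℝ} (hσ : 0 ≤ σ) (hσt : σ ≤ t) :
    ∫ τ in σ..t, (1 + τ) ^ (-r) ≤ (1 + σ) ^ (1 - r) / (r - 1) := by
  rw [intervalIntegral.integral_comp_add_left (fun x : ℝ => x ^ (-r)),
    integral_rpow (Or.inr ⟨by linarith, by
      rw [uIcc_of_le (by linarith)]
      rintro ⟨h, -⟩
      linarith⟩)]
  have h1 : 0 ≤ (1 + t) ^ (-r + 1) := Real.rpow_nonneg (by linarith) _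
  rw [show (1 - r) = -r + 1 by ring, show -r + 1 = -(r - 1) by ring] at *
  rw [div_neg, ← neg_div]
  have : 0 < r - 1 := by linarith
  gcongr
  linarith

theorem continuous_one_add_rpow {t : ℝ} (r : ℝ) :
    Continuous fun τ : Icc (0 : ℝ) t => (1 + (τ : ℝ)) ^ r :=
  Continuous.rpow_const (by fun_prop) fun τ => Or.inl (by have := τ.2.1; positivity)

theorem intervalIntegrable_one_add_rpow (r : ℝ) {σ t : ℝ} (hσ : 0 ≤ σ) (hσt : σ ≤ t) :
    IntervalIntegrable (fun τ : ℝ => (1 + τ) ^ r) volume σ t := by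
  refine ContinuousOn.intervalIntegrable ?_
  rw [uIcc_of_le hσt]
  exact ContinuousOn.rpow_const (by fun_prop) fun τ hτ => Or.inl (by have := hτ.1; linarith)

/-- The growth `τ - σ ≤ 1 + τ` costs one power, and the prefactor `(1 + σ)⁻¹` restores it; the
rescaled position thus decays at the same rate `7/4` as the velocity. -/
theorem integral_sub_mul_one_add_rpow_le {σ t : ℝ} (hσ : 0 ≤ σ) (hσt : σ ≤ t) :
    ∫ τ in σ..t, (1 + σ)⁻¹ * (τ - σ) * (1 + τ) ^ (-(11 / 4) : ℝ) ≤ 2 * (1 + σ) ^ (-(7 / 4) : ℝ) := by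
  have h1 : ∫ τ in σ..t, (1 + σ)⁻¹ * (τ - σ) * (1 + τ) ^ (-(11 / 4) : ℝ) ≤
      ∫ τ in σ..t, (1 + σ)⁻¹ * (1 + τ) ^ (-(7 / 4) : ℝ) := by
    refine intervalIntegral.integral_mono_on hσt ?_ ?_ fun τ hτ => ?_
    · have := (intervalIntegrable_one_add_rpow (-(11 / 4)) hσ hσt).continuousOn_mul
        (g := fun τ => (1 + σ)⁻¹ * (τ - σ)) (by fun_prop)
      exact this
    · exact (intervalIntegrable_one_add_rpow _ hσ hσt).const_mul _
    · have hτ0 : 0 < 1 + τ := by linarith [hτ.1]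
      rw [show (-(7 / 4) : ℝ) = 1 + (-(11 / 4)) by norm_num, Real.rpow_add hτ0, Real.rpow_one,
        ← mul_assoc]
      have : 0 ≤ (1 + τ) ^ (-(11 / 4) : ℝ) := Real.rpow_nonneg hτ0.le _
      gcongr
      linarith
  refine h1.trans ?_
  rw [intervalIntegral.integral_const_mul]
  have h2 := integral_one_add_rpow_le (r := 7 / 4) (by norm_num) hσ hσt
  have hσ0 : 0 < 1 + σ := by linarith
  calc (1 + σ)⁻¹ * ∫ τ in σ..t, (1 + τ) ^ (-(7 / 4) : ℝ)
      ≤ (1 + σ)⁻¹ * ((1 + σ) ^ (1 - 7 / 4 : ℝ) / (7 / 4 - 1)) := by gcongr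
    _ = (4 / 3) * (1 + σ) ^ (-(7 / 4) : ℝ) := by
      rw [show (-(7 / 4) : ℝ) = (-1) + (1 - 7 / 4) by norm_num, Real.rpow_add hσ0, Real.rpow_neg_one]
      ring
    _ ≤ _ := by gcongr; norm_num

theorem integral_one_add_rpow_eleven_le {σ t : ℝ} (hσ : 0 ≤ σ) (hσt : σ ≤ t) :
    ∫ τ in σ..t, (1 + τ) ^ (-(11 / 4) : ℝ) ≤ 2 * (1 + σ) ^ (-(7 / 4) : ℝ) := by
  refine (integral_one_add_rpow_le (by norm_num) hσ hσt).trans ?_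
  have : 0 ≤ (1 + σ) ^ (-(7 / 4) : ℝ) := by positivity
  norm_num
  norm_num at this
  linarith

end Weights

/-! ### Backward Volterra operators on curves. -/

section Volterra

variable {F : Type} [NormedAddCommGroup F] [NormedSpace ℝ F] {t : ℝ} (ht : 0 ≤ t)

/-- The Volterra operator `g ↦ (σ ↦ ∫_σ^t k (σ, τ) g (τ) dτ)` on `[0, t]`. -/
def volterra (k : C(Icc (0 : ℝ) t × Icc (0 : ℝ) t, ℝ)) :
    C(Icc (0 : ℝ) t, F) →L[ℝ] C(Icc (0 : ℝ) t, F) :=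
  LinearMap.mkContinuous
    { toFun := fun g => ⟨fun σ => ∫ τ in (σ : ℝ)..t, k (σ, projIcc 0 t ht τ) • g (projIcc 0 t ht τ), by
        -- Continuity is obtained for the integral from `t` to the moving endpoint `σ`, and a sign
        -- restores the orientation. `projIcc` only extends the integrand off `[0,t]` and is the
        -- identity on the range of integration.
        have h := intervalIntegral.continuous_parametric_intervalIntegral_of_continuous
          (μ := volume) (a₀ := t)
          (f := fun (σ : Icc (0 : ℝ) t) τ => k (σ, projIcc 0 t ht τ) • g (projIcc 0 t ht τ))
          (by
            have : Continuous (projIcc 0 t ht) := continuous_projIcc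
            simp only [Function.uncurry_def]
            fun_prop) (s := fun σ : Icc (0 : ℝ) t => (σ : ℝ)) (by fun_prop)
        have h2 := h.neg
        simp only [Pi.neg_def, ← intervalIntegral.integral_symm] at h2
        exact h2⟩
      map_add' := fun f g => by
        ext σ
        simp only [ContinuousMap.add_apply, ContinuousMap.coe_mk, smul_add]
        have : Continuous (projIcc 0 t ht) := continuous_projIcc
        exact intervalIntegral.integral_add (Continuous.intervalIntegrable (by fun_prop) _ _)
          (Continuous.intervalIntegrable (by fun_prop) _ _)
      map_smul' := fun c g => by
        ext σ
        simp only [ContinuousMap.smul_apply, ContinuousMap.coe_mk, RingHom.id_apply]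
        rw [← intervalIntegral.integral_smul]
        simp only [smul_comm c] } (‖k‖ * t)
    (fun g => by
      refine (ContinuousMap.norm_le _ (by positivity)).2 fun σ => ?_
      have := intervalIntegral.norm_integral_le_of_norm_le_const (a := (σ : ℝ)) (b := t)
        (C := ‖k‖ * ‖g‖)
        (f := fun τ => k (σ, projIcc 0 t ht τ) • g (projIcc 0 t ht τ)) (fun τ _ => by
          rw [norm_smul]
          gcongr
          · exact k.norm_coe_le_norm _
          · exact g.norm_coe_le_norm _)
      refine this.trans ?_
      rw [abs_of_nonneg (by linarith [σ.2.2])]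
      have h1 : t - σ ≤ t := by linarith [σ.2.1]
      calc ‖k‖ * ‖g‖ * (t - σ) ≤ ‖k‖ * ‖g‖ * t := by gcongr
        _ = _ := by ring)

theorem volterra_apply (k : C(Icc (0 : ℝ) t × Icc (0 : ℝ) t, ℝ)) (g : C(Icc (0 : ℝ) t, F))
    (σ : Icc (0 : ℝ) t) : volterra ht k g σ =
      ∫ τ in (σ : ℝ)..t, k (σ, projIcc 0 t ht τ) • g (projIcc 0 t ht τ) := rfl

theorem norm_volterra_apply_le (k : C(Icc (0 : ℝ) t × Icc (0 : ℝ) t, ℝ)) (g : C(Icc (0 : ℝ) t, F))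
    (σ : Icc (0 : ℝ) t) : ‖volterra ht k g σ‖ ≤
      (∫ τ in (σ : ℝ)..t, |k (σ, projIcc 0 t ht τ)|) * ‖g‖ := by
  have : Continuous (projIcc 0 t ht) := continuous_projIcc
  rw [volterra_apply, ← intervalIntegral.integral_mul_const]
  refine intervalIntegral.norm_integral_le_of_norm_le σ.2.2 (Filter.Eventually.of_forall fun τ _ => ?_)
    (Continuous.intervalIntegrable (by fun_prop) _ _)
  rw [norm_smul, Real.norm_eq_abs]
  gcongr
  exact g.norm_coe_le_norm _

/-- The kernel `(1 + σ)⁻¹ (τ - σ) (1 + τ) ^ (-11/4)` of the rescaled position. -/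
def posKernel (t : ℝ) : C(Icc (0 : ℝ) t × Icc (0 : ℝ) t, ℝ) :=
  ⟨fun p => (1 + (p.1 : ℝ))⁻¹ * ((p.2 : ℝ) - p.1) * (1 + (p.2 : ℝ)) ^ (-(11 / 4) : ℝ), by
    have h1 : Continuous fun p : Icc (0 : ℝ) t × Icc (0 : ℝ) t => (1 + (p.1 : ℝ))⁻¹ :=
      Continuous.inv₀ (by fun_prop) fun p => by have := p.1.2.1; positivity
    have h2 := (continuous_one_add_rpow (t := t) (-(11 / 4))).comp
      (continuous_snd : Continuous fun p : Icc (0 : ℝ) t × Icc (0 : ℝ) t => p.2)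
    exact (h1.mul (by fun_prop)).mul h2⟩

/-- The kernel `(1 + τ) ^ (-11/4)` of the velocity. -/
def velKernel (t : ℝ) : C(Icc (0 : ℝ) t × Icc (0 : ℝ) t, ℝ) :=
  ⟨fun p => (1 + (p.2 : ℝ)) ^ (-(11 / 4) : ℝ), (continuous_one_add_rpow (t := t) (-(11 / 4))).comp
      (continuous_snd : Continuous fun p : Icc (0 : ℝ) t × Icc (0 : ℝ) t => p.2)⟩

theorem norm_volterra_posKernel_apply_le (g : C(Icc (0 : ℝ) t, F)) (σ : Icc (0 : ℝ) t) :
    ‖volterra ht (posKernel t) g σ‖ ≤ 2 * (1 + (σ : ℝ)) ^ (-(7 / 4) : ℝ) * ‖g‖ := by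
  refine (norm_volterra_apply_le ht _ g σ).trans ?_
  gcongr
  refine le_trans (le_of_eq ?_) (integral_sub_mul_one_add_rpow_le σ.2.1 σ.2.2)
  refine intervalIntegral.integral_congr fun τ hτ => ?_
  rw [uIcc_of_le σ.2.2] at hτ
  have hτ' : τ ∈ Icc 0 t := ⟨σ.2.1.trans hτ.1, hτ.2⟩
  have h1 : 0 ≤ τ - σ := by linarith [hτ.1]
  have h2 : 0 ≤ 1 + τ := by linarith [hτ'.1]
  have h3 : 0 ≤ 1 + (σ : ℝ) := by linarith [σ.2.1]
  simp only [projIcc_of_mem ht hτ', posKernel, ContinuousMap.coe_mk]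
  exact abs_of_nonneg (by positivity)

theorem norm_volterra_velKernel_apply_le (g : C(Icc (0 : ℝ) t, F)) (σ : Icc (0 : ℝ) t) :
    ‖volterra ht (velKernel t) g σ‖ ≤ 2 * (1 + (σ : ℝ)) ^ (-(7 / 4) : ℝ) * ‖g‖ := by
  refine (norm_volterra_apply_le ht _ g σ).trans ?_
  gcongr
  refine le_trans (le_of_eq ?_) (integral_one_add_rpow_eleven_le σ.2.1 σ.2.2)
  refine intervalIntegral.integral_congr fun τ hτ => ?_
  rw [uIcc_of_le σ.2.2] at hτ
  have hτ' : τ ∈ Icc 0 t := ⟨σ.2.1.trans hτ.1, hτ.2⟩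
  have h2 : 0 ≤ 1 + τ := by linarith [hτ'.1]
  simp only [projIcc_of_mem ht hτ', velKernel, ContinuousMap.coe_mk]
  exact abs_of_nonneg (by positivity)

end Volterra

/-! ### Derivatives under rescaling. -/

section Scaling

theorem iteratedFDeriv_const_smul_comp_smul {F G : Type} [NormedAddCommGroup F] [NormedSpace ℝ F]
    [NormedAddCommGroup G] [NormedSpace ℝ G] {n : ℕ} {f : F → G} (hf : ContDiff ℝ n f) (c l : ℝ)
    (z : F) : iteratedFDeriv ℝ n (fun z => c • f (l • z)) z =
      (c * l ^ n) • iteratedFDeriv ℝ n f (l • z) := by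
  have h1 : ContDiff ℝ n (fun z => f (l • z)) := hf.comp (contDiff_const_smul l)
  have h2 := (l • ContinuousLinearMap.id ℝ F).iteratedFDeriv_comp_right hf z (le_refl _)
  have h3 : (f ∘ ⇑(l • ContinuousLinearMap.id ℝ F)) = fun z => f (l • z) := rfl
  rw [h3] at h2
  have h4 : iteratedFDeriv ℝ n (c • fun z => f (l • z)) z = c • iteratedFDeriv ℝ n (fun z => f (l • z)) z :=
    iteratedFDeriv_const_smul_apply h1.contDiffAt
  have h5 : (fun z => c • f (l • z)) = c • fun z => f (l • z) := rfl
  rw [h5, h4, h2]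
  ext m
  simp only [smul_apply, ContinuousMultilinearMap.compContinuousLinearMap_apply,
    ContinuousLinearMap.id_apply]
  rw [ContinuousMultilinearMap.map_smul_univ]
  simp [mul_smul]

end Scaling

/-! ### The characteristics as a fixed point in `C([0,t])`, and their slanted derivatives. -/

section Characteristics

variable {d : ℕ}

/-- The rescaled derivatives `(1 + τ) ^ k ∇^k E (τ)` are bounded by `η (1 + τ) ^ (-11/4)`. -/
def WeightedField (N : ℕ) (η : ℝ) (E : ℝ → Rd d → Rd d) : Prop :=
  ∀ k ≤ N, ∀ τ : ℝ, 0 ≤ τ → ∀ x : Rd d,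
    (1 + τ) ^ k * ‖iteratedFDeriv ℝ k (E τ) x‖ ≤ η * (1 + τ) ^ (-(11 / 4) : ℝ)

theorem IsClassicalField.continuousOn {N : ℕ} {E : ℝ → Rd d → Rd d} (hE : IsClassicalField N E) :
    ContinuousOn (fun p : ℝ × Rd d => E p.1 p.2) (Ici 0 ×ˢ univ) := by
  have h := hE.2 0 (Nat.zero_le _)
  have h2 := (continuousMultilinearCurryFin0 ℝ (Rd d) (Rd d)).continuous.comp_continuousOn h
  simpa [iteratedFDeriv_zero_eq_comp, Function.comp_def] using h2

theorem IsCharacteristics.continuousOn_pos {E : ℝ → Rd d → Rd d}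
    {X V : ℝ → ℝ → Rd d → Rd d → Rd d} (h : IsCharacteristics E X V) {t : ℝ} (ht : 0 ≤ t)
    (x v : Rd d) : ContinuousOn (fun σ => X σ t x v) (Icc 0 t) :=
  fun s hs => ((h t ht x v).2.2 s hs).1.continuousWithinAt

theorem IsCharacteristics.continuousOn_vel {E : ℝ → Rd d → Rd d}
    {X V : ℝ → ℝ → Rd d → Rd d → Rd d} (h : IsCharacteristics E X V) {t : ℝ} (ht : 0 ≤ t)
    (x v : Rd d) : ContinuousOn (fun σ => V σ t x v) (Icc 0 t) :=
  fun s hs => ((h t ht x v).2.2 s hs).2.continuousWithinAt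

theorem IsCharacteristics.continuousOn_force {N : ℕ} {E : ℝ → Rd d → Rd d}
    {X V : ℝ → ℝ → Rd d → Rd d → Rd d} (h : IsCharacteristics E X V) (hE : IsClassicalField N E)
    {t : ℝ} (ht : 0 ≤ t) (x v : Rd d) : ContinuousOn (fun σ => E σ (X σ t x v)) (Icc 0 t) :=
  hE.continuousOn.comp (f := fun σ => (σ, X σ t x v))
    (continuousOn_id.prodMk (h.continuousOn_pos ht x v)) fun _ hσ => ⟨hσ.1, mem_univ _⟩

theorem IsCharacteristics.vel_eq {N : ℕ} {E : ℝ → Rd d → Rd d}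
    {X V : ℝ → ℝ → Rd d → Rd d → Rd d} (h : IsCharacteristics E X V) (hE : IsClassicalField N E)
    {σ t : ℝ} (hσ : 0 ≤ σ) (hσt : σ ≤ t) (x v : Rd d) :
    V σ t x v = v - ∫ τ in σ..t, E τ (X τ t x v) := by
  have ht := hσ.trans hσt
  have hsub : Icc σ t ⊆ Icc 0 t := Icc_subset_Icc_left hσ
  rw [intervalIntegral.integral_eq_sub_of_hasDerivAt_of_le hσt
    ((h.continuousOn_vel ht x v).mono hsub) (fun τ hτ =>
      ((h t ht x v).2.2 τ (hsub (Ioo_subset_Icc_self hτ))).2.hasDerivAt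
        (Icc_mem_nhds (hσ.trans_lt hτ.1) hτ.2))
    (ContinuousOn.intervalIntegrable
      (by rw [uIcc_of_le hσt]; exact (h.continuousOn_force hE ht x v).mono hsub)),
    (h t ht x v).2.1]
  abel

/-- The function `(τ - σ) V - X` has derivative `(τ - σ) E`, since the two `V` terms cancel;
integrating it once replaces a double integration of the force. -/
theorem IsCharacteristics.pos_eq {N : ℕ} {E : ℝ → Rd d → Rd d}
    {X V : ℝ → ℝ → Rd d → Rd d → Rd d} (h : IsCharacteristics E X V) (hE : IsClassicalField N E)
    {σ t : ℝ} (hσ : 0 ≤ σ) (hσt : σ ≤ t) (x v : Rd d) :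
    X σ t x v = x - (t - σ) • v + ∫ τ in σ..t, (τ - σ) • E τ (X τ t x v) := by
  have ht := hσ.trans hσt
  have hsub : Icc σ t ⊆ Icc 0 t := Icc_subset_Icc_left hσ
  have hlin : ContinuousOn (fun τ : ℝ => τ - σ) (Icc σ t) := by fun_prop
  have hc : ContinuousOn (fun τ => (τ - σ) • V τ t x v - X τ t x v) (Icc σ t) :=
    (hlin.smul ((h.continuousOn_vel ht x v).mono hsub)).sub ((h.continuousOn_pos ht x v).mono hsub)
  have hi : IntervalIntegrable (fun τ => (τ - σ) • E τ (X τ t x v)) volume σ t :=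
    ContinuousOn.intervalIntegrable (by
      rw [uIcc_of_le hσt]
      exact hlin.smul ((h.continuousOn_force hE ht x v).mono hsub))
  have hderiv : ∀ τ ∈ Ioo σ t, HasDerivAt (fun τ => (τ - σ) • V τ t x v - X τ t x v)
      ((τ - σ) • E τ (X τ t x v)) τ := fun τ hτ => by
    have hd := (h t ht x v).2.2 τ (hsub (Ioo_subset_Icc_self hτ))
    have hn : Icc 0 t ∈ nhds τ := Icc_mem_nhds (hσ.trans_lt hτ.1) hτ.2
    have h0 : HasDerivAt (fun τ : ℝ => τ - σ) 1 τ := (hasDerivAt_id τ).sub_const σ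
    have h1 := (h0.smul (hd.2.hasDerivAt hn)).sub (hd.1.hasDerivAt hn)
    rw [one_smul, add_sub_cancel_right] at h1
    exact h1
  have key := intervalIntegral.integral_eq_sub_of_hasDerivAt_of_le hσt hc hderiv hi
  rw [key, (h t ht x v).2.1, (h t ht x v).1, sub_self, zero_smul]
  abel

/-- Scaling space by `1 + τ` and amplitude by `(1 + τ) ^ (11/4)` turns the decay of all derivatives
into one uniform bound. The weights removed here are those of `posKernel` and `velKernel`. -/
theorem WeightedField.exists_scaledField {N : ℕ} {η : ℝ} {E : ℝ → Rd d → Rd d}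
    (hW : WeightedField N η E) (hE : IsClassicalField N E) (t : ℝ) :
    ∃ f : C(Icc (0 : ℝ) t × Rd d, Rd d),
      (∀ τ z, f (τ, z) = (1 + (τ : ℝ)) ^ (11 / 4 : ℝ) • E τ ((1 + (τ : ℝ)) • z)) ∧
      JointlyContDiff N f ∧
      ∀ k ≤ N, ∀ τ z, ‖iteratedFDeriv ℝ k (fun z => f (τ, z)) z‖ ≤ η := by
  have hpre : Continuous fun p : Icc (0 : ℝ) t × Rd d => ((p.1 : ℝ), (1 + (p.1 : ℝ)) • p.2) := by
    fun_prop
  have hmem : ∀ p : Icc (0 : ℝ) t × Rd d,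
      ((p.1 : ℝ), (1 + (p.1 : ℝ)) • p.2) ∈ (Ici 0 ×ˢ univ : Set (ℝ × Rd d)) :=
    fun p => ⟨p.1.2.1, mem_univ _⟩
  have hw : Continuous fun p : Icc (0 : ℝ) t × Rd d => (1 + (p.1 : ℝ)) ^ (11 / 4 : ℝ) :=
    (continuous_one_add_rpow (t := t) (11 / 4)).comp continuous_fst
  have hf : Continuous fun p : Icc (0 : ℝ) t × Rd d =>
      (1 + (p.1 : ℝ)) ^ (11 / 4 : ℝ) • E p.1 ((1 + (p.1 : ℝ)) • p.2) :=
    hw.smul (hE.continuousOn.comp_continuous hpre hmem)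
  have hD : ∀ k ≤ N, ∀ (τ : Icc (0 : ℝ) t) (z : Rd d),
      iteratedFDeriv ℝ k (fun z => (1 + (τ : ℝ)) ^ (11 / 4 : ℝ) • E τ ((1 + (τ : ℝ)) • z)) z =
        ((1 + (τ : ℝ)) ^ (11 / 4 : ℝ) * (1 + (τ : ℝ)) ^ k) •
          iteratedFDeriv ℝ k (E τ) ((1 + (τ : ℝ)) • z) := fun k hk τ z =>
    iteratedFDeriv_const_smul_comp_smul ((hE.1 τ τ.2.1).of_le (by exact_mod_cast hk)) _ _ _
  refine ⟨⟨_, hf⟩, fun τ z => rfl, ⟨fun τ => ?_, fun k hk => ?_⟩, fun k hk τ z => ?_⟩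
  · have h1 : ContDiff ℝ N fun z => E τ ((1 + (τ : ℝ)) • z) :=
      (hE.1 τ τ.2.1).comp (contDiff_const_smul (1 + (τ : ℝ)))
    exact h1.const_smul ((1 + (τ : ℝ)) ^ (11 / 4 : ℝ))
  · simp only [ContinuousMap.coe_mk]
    simp only [hD k hk]
    exact (hw.mul (by fun_prop)).smul ((hE.2 k hk).comp_continuous hpre hmem)
  · simp only [ContinuousMap.coe_mk]
    rw [hD k hk, norm_smul]
    have hτ : 0 < 1 + (τ : ℝ) := by linarith [τ.2.1]
    have h1 := hW k hk τ τ.2.1 ((1 + (τ : ℝ)) • z)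
    rw [Real.norm_of_nonneg (by positivity), mul_assoc]
    calc _ ≤ (1 + (τ : ℝ)) ^ (11 / 4 : ℝ) * (η * (1 + (τ : ℝ)) ^ (-(11 / 4) : ℝ)) := by gcongr
      _ = η := by
        rw [mul_left_comm, ← Real.rpow_add hτ]
        norm_num

/-- The rescaled free trajectories `(1 + σ)⁻¹ (x - (t - σ) v)`. -/
def freePos (d : ℕ) (t : ℝ) : Rd d × Rd d →L[ℝ] C(Icc (0 : ℝ) t, Rd d) :=
  LinearMap.toContinuousLinearMap
    { toFun := fun p => ⟨fun σ : Icc (0 : ℝ) t => (1 + (σ : ℝ))⁻¹ • (p.1 - (t - (σ : ℝ)) • p.2),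
        (Continuous.inv₀ (f := fun σ : Icc (0 : ℝ) t => 1 + (σ : ℝ)) (by fun_prop)
          fun σ => by have := σ.2.1; positivity).smul (by fun_prop)⟩
      map_add' := fun p q => by ext1 σ; simp; module
      map_smul' := fun c p => by ext1 σ; simp; module }

theorem freePos_apply (t : ℝ) (p : Rd d × Rd d) (σ : Icc (0 : ℝ) t) :
    freePos d t p σ = (1 + (σ : ℝ))⁻¹ • (p.1 - (t - (σ : ℝ)) • p.2) := rfl

/-- The constant velocity of the free trajectories. -/
def freeVel (d : ℕ) (t : ℝ) : Rd d × Rd d →L[ℝ] C(Icc (0 : ℝ) t, Rd d) :=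
  LinearMap.toContinuousLinearMap
    { toFun := fun p => ContinuousMap.const _ p.2
      map_add' := fun p q => by ext1 σ; simp
      map_smul' := fun c p => by ext1 σ; simp }

theorem freeVel_apply (t : ℝ) (p : Rd d × Rd d) (σ : Icc (0 : ℝ) t) :
    freeVel d t p σ = p.2 := rfl

/-- The embedding `h ↦ (T h, h)`. -/
def slantedShift (d : ℕ) (T : ℝ) : Rd d →L[ℝ] Rd d × Rd d :=
  (T • ContinuousLinearMap.id ℝ (Rd d)).prod (ContinuousLinearMap.id ℝ (Rd d))

theorem slantedShift_apply (T : ℝ) (h : Rd d) : slantedShift d T h = (T • h, h) := rfl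

/-- In the direction `(T h, h)` the free position at time `σ` moves by `(T - (t - σ)) h`, and `0 ≤ T
- (t - σ) ≤ 1 + σ`. This is why the slope is `max 1 t`; it is also positive at `t = 0`, so that one
can divide by it. -/
theorem norm_freePos_comp_slantedShift_le {t : ℝ} (ht : 0 ≤ t) :
    ‖(freePos d t).comp (slantedShift d (max 1 t))‖ ≤ 1 := by
  refine ContinuousLinearMap.opNorm_le_bound _ zero_le_one fun h => ?_
  refine (ContinuousMap.norm_le _ (by positivity)).2 fun σ => ?_
  have hσ := σ.2
  rw [ContinuousLinearMap.comp_apply, freePos_apply, slantedShift_apply, ← sub_smul, smul_smul,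
    norm_smul]
  gcongr
  have h0 : 0 < 1 + (σ : ℝ) := by linarith [hσ.1]
  have h1 : max 1 t - (t - σ) ≤ 1 + σ := by
    have : max 1 t ≤ 1 + t := max_le (by linarith) (by linarith)
    linarith
  have h2 : 0 ≤ max 1 t - (t - σ) := by linarith [le_max_right 1 t, hσ.1]
  rw [Real.norm_of_nonneg (by positivity), inv_mul_le_iff₀ h0]
  linarith

theorem norm_freeVel_comp_slantedShift_le (t T : ℝ) :
    ‖(freeVel d t).comp (slantedShift d T)‖ ≤ 1 := by
  refine ContinuousLinearMap.opNorm_le_bound _ zero_le_one fun h => ?_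
  refine (ContinuousMap.norm_le _ (by positivity)).2 fun σ => ?_
  rw [ContinuousLinearMap.comp_apply, freeVel_apply, slantedShift_apply, one_mul]

/-- The given characteristics satisfy a fixed-point equation whose free part is affine in `h` with
slope of norm at most one along slanted directions, so the general derivative bound applies
uniformly in `t`. The perturbation is a Volterra operator applied to the force along the curve;
evaluation at `σ` recovers the decay of the kernel integral. -/
theorem exists_flow_curves (d N : ℕ) (hN : N ≠ 0) : ∃ D : ℝ, 1 ≤ D ∧
    ∀ (t η : ℝ) (E : ℝ → Rd d → Rd d) (X V : ℝ → ℝ → Rd d → Rd d → Rd d), 0 ≤ t → 0 ≤ η → η ≤ 1 / 4 →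
      IsClassicalField N E → IsCharacteristics E X V → WeightedField N η E →
      ∃ ξ ν : Rd d × Rd d → C(Icc (0 : ℝ) t, Rd d),
        (∀ p σ, ξ p σ = (1 + (σ : ℝ))⁻¹ • X σ t p.1 p.2) ∧ (∀ p σ, ν p σ = V σ t p.1 p.2) ∧
        ContDiff ℝ N ξ ∧ ContDiff ℝ N ν ∧
        ∀ p σ j, 1 ≤ j → j ≤ N → ∀ h,
          ‖iteratedFDeriv ℝ j (fun h => ξ (p + slantedShift d (max 1 t) h) σ -
            freePos d t (p + slantedShift d (max 1 t) h) σ) h‖ ≤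
              D * η * (1 + (σ : ℝ)) ^ (-(7 / 4) : ℝ) ∧
          ‖iteratedFDeriv ℝ j (fun h => ν (p + slantedShift d (max 1 t) h) σ -
            freeVel d t (p + slantedShift d (max 1 t) h) σ) h‖ ≤
              D * η * (1 + (σ : ℝ)) ^ (-(7 / 4) : ℝ) := by
  obtain ⟨D, hD, hDb⟩ := exists_norm_iteratedFDeriv_fixedPoint_le N
  -- The factor `2` bounds the kernel integrals and `N! D ^ N` is the Faà di Bruno constant for the
  -- force along the curve.
  refine ⟨2 * (N.factorial * D ^ N), ?_, ?_⟩
  · have h1 : (1 : ℝ) ≤ N.factorial := by exact_mod_cast N.factorial_pos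
    have h2 : 1 ≤ D ^ N := one_le_pow₀ hD
    nlinarith
  intro t η E X V ht hη hη4 hE hX hW
  obtain ⟨f, hf, hfj, hfb⟩ := hW.exists_scaledField hE t
  have hfc : ContDiff ℝ N (nemytskii f) := contDiff_nemytskii N f hfj
  have hfn : ∀ j ≤ N, ∀ γ, ‖iteratedFDeriv ℝ j (nemytskii f) γ‖ ≤ η := fun j hj γ =>
    norm_iteratedFDeriv_nemytskii_le j f
      ⟨fun τ => (hfj.1 τ).of_le (by exact_mod_cast hj), fun k hk => hfj.2 k (hk.trans hj)⟩ hη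
      (fun τ z => hfb j hj τ z) γ
  let KX := volterra (F := Rd d) ht (posKernel t)
  let KV := volterra (F := Rd d) ht (velKernel t)
  have hβ : ∀ σ : Icc (0 : ℝ) t, (1 + (σ : ℝ)) ^ (-(7 / 4) : ℝ) ≤ 1 := fun σ =>
    Real.rpow_le_one_of_one_le_of_nonpos (by linarith [σ.2.1]) (by norm_num)
  have hKX : ‖KX‖ ≤ 2 := by
    refine ContinuousLinearMap.opNorm_le_bound _ (by norm_num) fun g => ?_
    refine (ContinuousMap.norm_le _ (by positivity)).2 fun σ => ?_
    refine (norm_volterra_posKernel_apply_le ht g σ).trans ?_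
    have := hβ σ
    gcongr
    linarith
  let 𝒦 := KX ∘ nemytskii f
  have h𝒦 : ContDiff ℝ N 𝒦 := KX.contDiff.comp hfc
  -- The restriction `η ≤ 1/4` is used here: the Volterra norm is at most `2`.
  have h𝒦b : ∀ j, 1 ≤ j → j ≤ N → ∀ γ, ‖iteratedFDeriv ℝ j 𝒦 γ‖ ≤ 1 / 2 := fun j _ hj γ => by
    refine (KX.norm_iteratedFDeriv_comp_left hfc.contDiffAt (by exact_mod_cast hj)).trans ?_
    have h1 := hfn j hj γ
    calc ‖KX‖ * ‖iteratedFDeriv ℝ j (nemytskii f) γ‖ ≤ 2 * (1 / 4) := by gcongr; linarith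
      _ = 1 / 2 := by norm_num
  let ξ : Rd d × Rd d → C(Icc (0 : ℝ) t, Rd d) := fun p =>
    ⟨fun σ : Icc (0 : ℝ) t => (1 + (σ : ℝ))⁻¹ • X σ t p.1 p.2,
      (Continuous.inv₀ (f := fun σ : Icc (0 : ℝ) t => 1 + (σ : ℝ)) (by fun_prop) fun σ => by have := σ.2.1; positivity).smul
        (continuousOn_iff_continuous_domRestrict.1 (hX.continuousOn_pos ht p.1 p.2))⟩
  let ν : Rd d × Rd d → C(Icc (0 : ℝ) t, Rd d) := fun p =>
    ⟨fun σ => V σ t p.1 p.2,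
      continuousOn_iff_continuous_domRestrict.1 (hX.continuousOn_vel ht p.1 p.2)⟩
  have hforce : ∀ (p : Rd d × Rd d) (τ : Icc (0 : ℝ) t), nemytskii f (ξ p) τ =
      (1 + (τ : ℝ)) ^ (11 / 4 : ℝ) • E τ (X τ t p.1 p.2) := fun p τ => by
    have hτ : 1 + (τ : ℝ) ≠ 0 := by linarith [τ.2.1]
    rw [nemytskii_apply, hf]
    simp only [ξ, ContinuousMap.coe_mk, smul_smul, mul_inv_cancel₀ hτ, one_smul]
  have hweight : ∀ τ : ℝ, 0 ≤ τ → (1 + τ) ^ (-(11 / 4) : ℝ) * (1 + τ) ^ (11 / 4 : ℝ) = 1 := by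
    intro τ hτ
    rw [← Real.rpow_add (by linarith)]
    norm_num
  have hξeq : ∀ p, ξ p = freePos d t p + 𝒦 (ξ p) := by
    intro p
    ext1 σ
    rw [ContinuousMap.add_apply, freePos_apply]
    simp only [𝒦, KX, Function.comp, volterra_apply]
    have e : ∫ τ in (σ : ℝ)..t, posKernel t (σ, projIcc 0 t ht τ) •
        nemytskii f (ξ p) (projIcc 0 t ht τ) =
        ∫ τ in (σ : ℝ)..t, (1 + (σ : ℝ))⁻¹ • ((τ - σ) • E τ (X τ t p.1 p.2)) := by
      refine intervalIntegral.integral_congr fun τ hτ => ?_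
      rw [uIcc_of_le σ.2.2] at hτ
      have hτ' : τ ∈ Icc 0 t := ⟨σ.2.1.trans hτ.1, hτ.2⟩
      simp only [projIcc_of_mem ht hτ', hforce, posKernel, ContinuousMap.coe_mk, smul_smul]
      rw [mul_assoc, hweight τ hτ'.1, mul_one]
    rw [e, intervalIntegral.integral_smul, ← smul_add, ← hX.pos_eq hE σ.2.1 σ.2.2]
    rfl
  have hνeq : ∀ p, ν p = freeVel d t p - KV (nemytskii f (ξ p)) := by
    intro p
    ext1 σ
    rw [ContinuousMap.sub_apply, freeVel_apply]
    simp only [KV, volterra_apply]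
    have e : ∫ τ in (σ : ℝ)..t, velKernel t (σ, projIcc 0 t ht τ) •
        nemytskii f (ξ p) (projIcc 0 t ht τ) =
        ∫ τ in (σ : ℝ)..t, E τ (X τ t p.1 p.2) := by
      refine intervalIntegral.integral_congr fun τ hτ => ?_
      rw [uIcc_of_le σ.2.2] at hτ
      have hτ' : τ ∈ Icc 0 t := ⟨σ.2.1.trans hτ.1, hτ.2⟩
      simp only [projIcc_of_mem ht hτ', hforce, velKernel, ContinuousMap.coe_mk, smul_smul]
      rw [hweight τ hτ'.1, one_smul]
    rw [e, ← hX.vel_eq hE σ.2.1 σ.2.2]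
    rfl
  have hξc : ContDiff ℝ N ξ := contDiff_of_fixedPoint hN h𝒦 (fun γ => by
    rw [← norm_iteratedFDeriv_one]
    exact h𝒦b 1 le_rfl (by omega) γ) (freePos d t).contDiff hξeq
  have hνc : ContDiff ℝ N ν := by
    rw [funext hνeq]
    exact (freeVel d t).contDiff.sub (KV.contDiff.comp (hfc.comp hξc))
  refine ⟨ξ, ν, fun _ _ => rfl, fun _ _ => rfl, hξc, hνc, ?_⟩
  intro p σ j hj hjN h
  let S := slantedShift d (max 1 t)
  let ζ : Rd d → C(Icc (0 : ℝ) t, Rd d) := fun h => ξ (p + S h)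
  have hζc : ContDiff ℝ N ζ := hξc.comp (contDiff_const.add S.contDiff)
  -- Along the slanted line through `p`, the equation has the form `ζ h = c + L h + 𝒦 (ζ h)`.
  have hζb := hDb (Rd d) _ 𝒦 (freePos d t p) ((freePos d t).comp S) ζ h𝒦 hζc
    (norm_freePos_comp_slantedShift_le ht) h𝒦b (fun h => by
      simp only [ζ]
      conv_lhs => rw [hξeq]
      rw [map_add]
      rfl)
  have hcomp : ‖iteratedFDeriv ℝ j (nemytskii f ∘ ζ) h‖ ≤ N.factorial * D ^ N * η := by
    refine (norm_iteratedFDeriv_comp_le hfc hζc (by exact_mod_cast hjN) h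
      (fun i hi => hfn i (hi.trans hjN) _)
      (fun i hi hij => (hζb i hi (hij.trans hjN) h).trans (le_self_pow₀ hD (by omega)))).trans ?_
    have h1 : (j.factorial : ℝ) ≤ N.factorial := by exact_mod_cast Nat.factorial_le hjN
    have h2 : D ^ j ≤ D ^ N := pow_le_pow_right₀ hD hjN
    calc (j.factorial : ℝ) * η * D ^ j ≤ N.factorial * η * D ^ N := by gcongr
      _ = _ := by ring
  have hfζ : ContDiff ℝ N (nemytskii f ∘ ζ) := hfc.comp hζc
  have fin : ∀ K : C(Icc (0 : ℝ) t, Rd d) →L[ℝ] C(Icc (0 : ℝ) t, Rd d),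
      (∀ g, ‖K g σ‖ ≤ 2 * (1 + (σ : ℝ)) ^ (-(7 / 4) : ℝ) * ‖g‖) →
      ‖iteratedFDeriv ℝ j (fun h => K (nemytskii f (ζ h)) σ) h‖ ≤
        2 * (N.factorial * D ^ N) * η * (1 + (σ : ℝ)) ^ (-(7 / 4) : ℝ) := by
    intro K hK
    have hσ : 0 ≤ (1 + (σ : ℝ)) ^ (-(7 / 4) : ℝ) := Real.rpow_nonneg (by linarith [σ.2.1]) _
    have h1 : ‖(ContinuousMap.evalCLM ℝ σ).comp K‖ ≤ 2 * (1 + (σ : ℝ)) ^ (-(7 / 4) : ℝ) :=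
      ContinuousLinearMap.opNorm_le_bound _ (by positivity) hK
    have h2 := ((ContinuousMap.evalCLM ℝ σ).comp K).norm_iteratedFDeriv_comp_left
      (x := h) hfζ.contDiffAt (n := j) (by exact_mod_cast hjN)
    refine h2.trans ?_
    calc _ ≤ 2 * (1 + (σ : ℝ)) ^ (-(7 / 4) : ℝ) * (N.factorial * D ^ N * η) := by gcongr
      _ = _ := by ring
  constructor
  · have e : (fun h => ξ (p + S h) σ - freePos d t (p + S h) σ) =
        fun h => KX (nemytskii f (ζ h)) σ := by
      ext1 h
      conv_lhs => rw [hξeq]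
      simp [𝒦, ζ]
    rw [e]
    exact fin KX fun g => norm_volterra_posKernel_apply_le ht g σ
  · have e : (fun h => ν (p + S h) σ - freeVel d t (p + S h) σ) =
        -fun h => KV (nemytskii f (ζ h)) σ := by
      ext1 h
      conv_lhs => rw [hνeq]
      simp [ζ]
    rw [e, iteratedFDeriv_neg, Pi.neg_apply, norm_neg]
    exact fin KV fun g => norm_volterra_velKernel_apply_le ht g σ

end Characteristics

/-! ### The mean velocity as a small Lipschitz perturbation of the velocity. -/

section Straightening

variable {d : ℕ}

theorem norm_integral_le_of_norm_le_rpow {F : Type} [NormedAddCommGroup F] [NormedSpace ℝ F]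
    {f : ℝ → F} {c σ t : ℝ} (hc : 0 ≤ c) (hσ : 0 ≤ σ) (hσt : σ ≤ t)
    (hf : ∀ τ ∈ Icc σ t, ‖f τ‖ ≤ c * (1 + τ) ^ (-(11 / 4) : ℝ)) :
    ‖∫ τ in σ..t, f τ‖ ≤ 2 * c * (1 + σ) ^ (-(7 / 4) : ℝ) := by
  refine (intervalIntegral.norm_integral_le_of_norm_le hσt
    (Filter.Eventually.of_forall fun τ hτ => hf τ (Ioc_subset_Icc_self hτ))
    ((intervalIntegrable_one_add_rpow _ hσ hσt).const_mul _)).trans ?_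
  rw [intervalIntegral.integral_const_mul]
  have := integral_one_add_rpow_eleven_le hσ hσt
  calc c * ∫ τ in σ..t, (1 + τ) ^ (-(11 / 4) : ℝ) ≤ c * (2 * (1 + σ) ^ (-(7 / 4) : ℝ)) := by gcongr
    _ = _ := by ring

theorem WeightedField.norm_le {N : ℕ} {η : ℝ} {E : ℝ → Rd d → Rd d} (hW : WeightedField N η E)
    {τ : ℝ} (hτ : 0 ≤ τ) (x : Rd d) : ‖E τ x‖ ≤ η * (1 + τ) ^ (-(11 / 4) : ℝ) := by
  have := hW 0 (Nat.zero_le _) τ hτ x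
  simpa using this

theorem WeightedField.norm_sub_le {N : ℕ} (hN : N ≠ 0) {η : ℝ} {E : ℝ → Rd d → Rd d}
    (hW : WeightedField N η E) (hE : IsClassicalField N E)
    {τ : ℝ} (hτ : 0 ≤ τ) (x y : Rd d) :
    (1 + τ) * ‖E τ x - E τ y‖ ≤ η * (1 + τ) ^ (-(11 / 4) : ℝ) * ‖x - y‖ := by
  have hτ' : 0 < 1 + τ := by linarith
  have h1 : ∀ z ∈ (univ : Set (Rd d)), ‖fderiv ℝ (E τ) z‖ ≤ η * (1 + τ) ^ (-(11 / 4) : ℝ) / (1 + τ) := by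
    intro z _
    have := hW 1 (by omega) τ hτ z
    rw [norm_iteratedFDeriv_one, pow_one] at this
    rw [le_div_iff₀ hτ']
    linarith
  have h2 := convex_univ.norm_image_sub_le_of_norm_fderiv_le (f := E τ)
    (fun z _ => (hE.1 τ hτ).differentiable (by exact_mod_cast hN) z) h1 (mem_univ y) (mem_univ x)
  calc (1 + τ) * ‖E τ x - E τ y‖
      ≤ (1 + τ) * (η * (1 + τ) ^ (-(11 / 4) : ℝ) / (1 + τ) * ‖x - y‖) := by gcongr
    _ = _ := by field_simp

variable {N : ℕ} {η : ℝ} {E : ℝ → Rd d → Rd d} {X V : ℝ → ℝ → Rd d → Rd d → Rd d}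

theorem WeightedField.norm_vel_sub_le (hW : WeightedField N η E) (hE : IsClassicalField N E)
    (hX : IsCharacteristics E X V) (hη : 0 ≤ η) {s t : ℝ} (hs : 0 ≤ s) (hst : s ≤ t) (x v : Rd d) :
    ‖V s t x v - v‖ ≤ 2 * η * (1 + s) ^ (-(7 / 4) : ℝ) := by
  rw [hX.vel_eq hE hs hst, sub_sub_cancel_left, norm_neg]
  exact norm_integral_le_of_norm_le_rpow hη hs hst fun τ hτ => hW.norm_le (hs.trans hτ.1) _

/-- The velocity of the straight line joining `X s t x v` at time `s` to `x` at time `t`. -/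
def meanVel (X : ℝ → ℝ → Rd d → Rd d → Rd d) (s t : ℝ) (x v : Rd d) : Rd d :=
  (t - s)⁻¹ • (x - X s t x v)

theorem sub_smul_meanVel {s t : ℝ} (hst : s < t) (x v : Rd d) :
    x - (t - s) • meanVel X s t x v = X s t x v := by
  rw [meanVel, smul_smul, mul_inv_cancel₀ (by linarith), one_smul, sub_sub_cancel]

theorem IsCharacteristics.meanVel_eq (hE : IsClassicalField N E)
    (hX : IsCharacteristics E X V) {s t : ℝ} (hs : 0 ≤ s) (hst : s < t) (x v : Rd d) :
    meanVel X s t x v = v - (t - s)⁻¹ • ∫ τ in s..t, (τ - s) • E τ (X τ t x v) := by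
  have h : t - s ≠ 0 := by linarith
  rw [meanVel, hX.pos_eq hE hs hst.le,
    show ∀ a b : Rd d, x - (x - a + b) = a - b from fun a b => by abel, smul_sub, smul_smul,
    inv_mul_cancel₀ h, one_smul]

/-- The bound `τ - s ≤ t - s` cancels the division by `t - s`, so nothing degenerates as `s`
approaches `t`. -/
theorem WeightedField.norm_meanVel_sub_le (hW : WeightedField N η E) (hE : IsClassicalField N E)
    (hX : IsCharacteristics E X V) (hη : 0 ≤ η) {s t : ℝ} (hs : 0 ≤ s) (hst : s < t) (x v : Rd d) :
    ‖meanVel X s t x v - v‖ ≤ 2 * η * (1 + s) ^ (-(7 / 4) : ℝ) := by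
  have h : 0 < t - s := by linarith
  rw [hX.meanVel_eq hE hs hst, sub_sub_cancel_left, norm_neg, norm_smul, norm_inv,
    Real.norm_of_nonneg h.le, inv_mul_le_iff₀ h]
  refine (norm_integral_le_of_norm_le_rpow (c := (t - s) * η) (by positivity) hs hst.le
    fun τ hτ => ?_).trans (le_of_eq (by ring))
  have h1 := hW.norm_le (hs.trans hτ.1) (X τ t x v)
  have h2 : 0 ≤ τ - s := by linarith [hτ.1]
  rw [norm_smul, Real.norm_of_nonneg h2, mul_assoc]
  gcongr
  exact hτ.2

/-- The factor `t - σ` must survive, because the difference will be divided by it in the mean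
velocity. It comes from iterating the integral equation: a bound `(t - σ) S` improves to `(t - σ)(‖v
- v'‖ + S / 2)`, and the limit of the iteration is `S = 2‖v - v'‖`. -/
theorem WeightedField.norm_pos_sub_le (hN : N ≠ 0) (hW : WeightedField N η E)
    (hE : IsClassicalField N E) (hX : IsCharacteristics E X V) (hη : 0 ≤ η) (hη4 : η ≤ 1 / 4)
    {t : ℝ} (ht : 0 ≤ t) (x v v' : Rd d) {σ : ℝ} (hσ : σ ∈ Icc 0 t) :
    ‖X σ t x v - X σ t x v'‖ ≤ (t - σ) * (2 * ‖v - v'‖) := by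
  have hβ : ∀ σ : ℝ, 0 ≤ σ → (1 + σ) ^ (-(7 / 4) : ℝ) ≤ 1 := fun σ hσ =>
    Real.rpow_le_one_of_one_le_of_nonpos (by linarith) (by norm_num)
  have hint : ∀ (w : Rd d), ∀ σ ∈ Icc 0 t,
      IntervalIntegrable (fun τ => (τ - σ) • E τ (X τ t x w)) volume σ t := fun w σ hσ => by
    have hlin : ContinuousOn (fun τ : ℝ => τ - σ) (Icc σ t) := by fun_prop
    refine ContinuousOn.intervalIntegrable ?_
    rw [uIcc_of_le hσ.2]
    exact hlin.smul ((hX.continuousOn_force hE ht x w).mono (Icc_subset_Icc_left hσ.1))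
  have step : ∀ σ ∈ Icc 0 t, ∀ S : ℝ, 0 ≤ S →
      (∀ τ ∈ Icc σ t, (τ - σ) * ‖X τ t x v - X τ t x v'‖ ≤ (1 + τ) * ((t - σ) * S)) →
      ‖X σ t x v - X σ t x v'‖ ≤ (t - σ) * (‖v - v'‖ + 1 / 2 * S) := by
    intro σ hσ S hS hm
    have hts : 0 ≤ t - σ := by linarith [hσ.2]
    have e : X σ t x v - X σ t x v' = -((t - σ) • (v - v')) +
        ∫ τ in σ..t, ((τ - σ) • E τ (X τ t x v) - (τ - σ) • E τ (X τ t x v')) := by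
      rw [intervalIntegral.integral_sub (hint v σ hσ) (hint v' σ hσ)]
      conv_lhs => rw [hX.pos_eq hE hσ.1 hσ.2, hX.pos_eq hE hσ.1 hσ.2]
      rw [smul_sub]
      abel
    rw [e]
    refine (norm_add_le _ _).trans ?_
    have h1 : ‖∫ τ in σ..t, ((τ - σ) • E τ (X τ t x v) - (τ - σ) • E τ (X τ t x v'))‖ ≤
        2 * ((t - σ) * S * η) * (1 + σ) ^ (-(7 / 4) : ℝ) := by
      refine norm_integral_le_of_norm_le_rpow (by positivity) hσ.1 hσ.2 fun τ hτ => ?_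
      have hτ0 : 0 ≤ τ := hσ.1.trans hτ.1
      have hτ1 : 0 < 1 + τ := by linarith
      have h2 : 0 ≤ τ - σ := by linarith [hτ.1]
      have h3 := hW.norm_sub_le hN hE hτ0 (X τ t x v) (X τ t x v')
      rw [← smul_sub, norm_smul, Real.norm_of_nonneg h2, ← mul_le_mul_iff_right₀ hτ1]
      have h4 := Real.rpow_nonneg hτ1.le (-(11 / 4))
      calc (1 + τ) * ((τ - σ) * ‖E τ (X τ t x v) - E τ (X τ t x v')‖)
          = (τ - σ) * ((1 + τ) * ‖E τ (X τ t x v) - E τ (X τ t x v')‖) := by ring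
        _ ≤ (τ - σ) * (η * (1 + τ) ^ (-(11 / 4) : ℝ) * ‖X τ t x v - X τ t x v'‖) := by gcongr
        _ = η * (1 + τ) ^ (-(11 / 4) : ℝ) * ((τ - σ) * ‖X τ t x v - X τ t x v'‖) := by ring
        _ ≤ η * (1 + τ) ^ (-(11 / 4) : ℝ) * ((1 + τ) * ((t - σ) * S)) := by
            refine mul_le_mul_of_nonneg_left (hm τ hτ) (by positivity)
        _ = _ := by ring
    rw [norm_neg, norm_smul, Real.norm_of_nonneg hts]
    have h5 : 2 * ((t - σ) * S * η) * (1 + σ) ^ (-(7 / 4) : ℝ) ≤ 2 * ((t - σ) * S * (1 / 4)) * 1 := by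
      have := hβ σ hσ.1
      have h6 : 0 ≤ (1 + σ) ^ (-(7 / 4) : ℝ) := Real.rpow_nonneg (by linarith [hσ.1]) _
      gcongr
    calc _ ≤ (t - σ) * ‖v - v'‖ + 2 * ((t - σ) * S * (1 / 4)) * 1 := by gcongr; exact h1.trans h5
      _ = _ := by ring
  obtain ⟨M, hM⟩ := isCompact_Icc.exists_bound_of_continuousOn
    ((hX.continuousOn_pos ht x v).sub (hX.continuousOn_pos ht x v'))
  have hM0 : 0 ≤ M := (norm_nonneg _).trans (hM σ hσ)
  have iter : ∀ n : ℕ, ∀ σ ∈ Icc 0 t, ‖X σ t x v - X σ t x v'‖ ≤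
      (t - σ) * (2 * ‖v - v'‖ + (1 / 2) ^ n * M) := by
    intro n
    induction n with
    | zero =>
      intro σ hσ
      have hts : 0 ≤ t - σ := by linarith [hσ.2]
      -- The compactness bound `M` has no factor `t - σ`; the factor comes from `τ - σ ≤ t - σ`.
      -- This is why the hypothesis of `step` keeps `τ - σ` on its left side.
      refine (step σ hσ M hM0 fun τ hτ => ?_).trans ?_
      · have h1 := hM τ ⟨hσ.1.trans hτ.1, hτ.2⟩
        have h2 : 0 ≤ τ - σ := by linarith [hτ.1]
        have h3 : 0 ≤ τ := hσ.1.trans hτ.1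
        calc (τ - σ) * ‖X τ t x v - X τ t x v'‖ ≤ (t - σ) * M := by
              gcongr
              · exact hτ.2
              · exact h1
          _ ≤ (1 + τ) * ((t - σ) * M) := le_mul_of_one_le_left (by positivity) (by linarith)
      · rw [pow_zero, one_mul]
        gcongr
        · linarith [norm_nonneg (v - v')]
        · linarith
    | succ n ih =>
      intro σ hσ
      refine (step σ hσ (2 * ‖v - v'‖ + (1 / 2) ^ n * M) (by positivity) fun τ hτ => ?_).trans ?_
      · have hτ' : τ ∈ Icc 0 t := ⟨hσ.1.trans hτ.1, hτ.2⟩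
        have h2 : 0 ≤ τ - σ := by linarith [hτ.1]
        have h3 : τ - σ ≤ 1 + τ := by linarith [hσ.1]
        have h4 : 0 ≤ 1 + τ := by linarith [hτ'.1]
        gcongr
        refine (ih τ hτ').trans ?_
        gcongr
        exact hτ.1
      · refine le_of_eq ?_
        ring
  have hlim : Filter.Tendsto (fun n : ℕ => (t - σ) * (2 * ‖v - v'‖ + (1 / 2 : ℝ) ^ n * M))
      Filter.atTop (nhds ((t - σ) * (2 * ‖v - v'‖ + 0 * M))) :=
    (((tendsto_pow_atTop_nhds_zero_of_lt_one (by norm_num) (by norm_num)).mul_const M).const_add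
      _).const_mul _
  have := ge_of_tendsto' hlim fun n => iter n σ hσ
  simpa using this

/-- The extra decay of `∇E` absorbs the factor `τ - s` of the integral equation, and the Lipschitz
bound for the positions supplies the `t - s` that cancels the division. -/
theorem WeightedField.norm_meanVel_sub_sub_le (hN : N ≠ 0) (hW : WeightedField N η E)
    (hE : IsClassicalField N E) (hX : IsCharacteristics E X V) (hη : 0 ≤ η) (hη4 : η ≤ 1 / 4)
    {s t : ℝ} (hs : 0 ≤ s) (hst : s < t) (x v v' : Rd d) :
    ‖(meanVel X s t x v - meanVel X s t x v') - (v - v')‖ ≤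
      4 * η * (1 + s) ^ (-(7 / 4) : ℝ) * ‖v - v'‖ := by
  have ht : 0 ≤ t := hs.trans hst.le
  have h : 0 < t - s := by linarith
  have hlin : ContinuousOn (fun τ : ℝ => τ - s) (Icc s t) := by fun_prop
  have hint : ∀ (w : Rd d), IntervalIntegrable (fun τ => (τ - s) • E τ (X τ t x w)) volume s t :=
    fun w => by
      refine ContinuousOn.intervalIntegrable ?_
      rw [uIcc_of_le hst.le]
      exact hlin.smul ((hX.continuousOn_force hE ht x w).mono (Icc_subset_Icc_left hs))
  have e : (meanVel X s t x v - meanVel X s t x v') - (v - v') =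
      -((t - s)⁻¹ • ∫ τ in s..t, ((τ - s) • E τ (X τ t x v) - (τ - s) • E τ (X τ t x v'))) := by
    rw [intervalIntegral.integral_sub (hint v) (hint v'), hX.meanVel_eq hE hs hst,
      hX.meanVel_eq hE hs hst, smul_sub]
    abel
  rw [e, norm_neg, norm_smul, norm_inv, Real.norm_of_nonneg h.le, inv_mul_le_iff₀ h]
  refine (norm_integral_le_of_norm_le_rpow (c := (t - s) * (2 * ‖v - v'‖) * η) (by positivity) hs
    hst.le fun τ hτ => ?_).trans (le_of_eq (by ring))
  have hτ0 : 0 ≤ τ := hs.trans hτ.1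
  have hτ1 : 0 < 1 + τ := by linarith
  have h2 : 0 ≤ τ - s := by linarith [hτ.1]
  have h3 := hW.norm_sub_le hN hE hτ0 (X τ t x v) (X τ t x v')
  have h4 := hW.norm_pos_sub_le hN hE hX hη hη4 ht x v v' (σ := τ) ⟨hτ0, hτ.2⟩
  have h5 := Real.rpow_nonneg hτ1.le (-(11 / 4))
  rw [← smul_sub, norm_smul, Real.norm_of_nonneg h2]
  calc (τ - s) * ‖E τ (X τ t x v) - E τ (X τ t x v')‖
      ≤ (1 + τ) * ‖E τ (X τ t x v) - E τ (X τ t x v')‖ := by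
        gcongr
        linarith
    _ ≤ η * (1 + τ) ^ (-(11 / 4) : ℝ) * ‖X τ t x v - X τ t x v'‖ := h3
    _ ≤ η * (1 + τ) ^ (-(11 / 4) : ℝ) * ((t - s) * (2 * ‖v - v'‖)) := by
        gcongr
        refine h4.trans ?_
        gcongr
        exact hτ.1
    _ = _ := by ring

end Straightening

/-! ### Change of variables by near-identity maps. -/

section NearIdentity

variable {F : Type} [NormedAddCommGroup F] [NormedSpace ℝ F] [FiniteDimensional ℝ F]

/-- A differentiable map whose difference with the identity is `c`-Lipschitz, `c ≤ 1/2`. -/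
structure NearIdentity (θ : F → F) (c : ℝ) : Prop where
  differentiable : Differentiable ℝ θ
  norm_sub_sub_le : ∀ v v', ‖(θ v - θ v') - (v - v')‖ ≤ c * ‖v - v'‖
  nonneg : 0 ≤ c
  le_half : c ≤ 1 / 2

namespace NearIdentity

variable {θ : F → F} {c : ℝ}

theorem injective (h : NearIdentity θ c) : Function.Injective θ := by
  intro v v' hv
  have h1 := h.norm_sub_sub_le v v'
  rw [hv, sub_self, zero_sub, norm_neg] at h1
  have h2 : ‖v - v'‖ = 0 := by nlinarith [norm_nonneg (v - v'), h.le_half]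
  rwa [norm_eq_zero, sub_eq_zero] at h2

/-- Quantitative inverse function theorem: a perturbation of the identity with Lipschitz constant
below one is onto. Together with injectivity this makes the substitution global. -/
theorem surjective (h : NearIdentity θ c) : Function.Surjective θ := by
  have ha : ApproximatesLinearOn θ ((ContinuousLinearEquiv.refl ℝ F : F ≃L[ℝ] F) : F →L[ℝ] F) univ
      c.toNNReal := by
    intro v _ v' _
    rw [Real.coe_toNNReal _ h.nonneg]
    exact h.norm_sub_sub_le v v'
  refine ha.surjective ?_
  rcases subsingleton_or_nontrivial F with hF | hF
  · exact Or.inl hF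
  · refine Or.inr ?_
    have h1 : ‖((ContinuousLinearEquiv.refl ℝ F).symm : F →L[ℝ] F)‖₊ = 1 := by
      have : ((ContinuousLinearEquiv.refl ℝ F).symm : F →L[ℝ] F) = ContinuousLinearMap.id ℝ F := rfl
      rw [this]
      exact ContinuousLinearMap.nnnorm_id
    rw [h1, inv_one, ← NNReal.coe_lt_coe, Real.coe_toNNReal _ h.nonneg]
    exact h.le_half.trans_lt (by norm_num)

theorem norm_fderiv_sub_id_le (h : NearIdentity θ c) (v : F) :
    ‖fderiv ℝ θ v - ContinuousLinearMap.id ℝ F‖ ≤ c := by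
  have h1 : HasFDerivAt (fun v => θ v - v) (fderiv ℝ θ v - ContinuousLinearMap.id ℝ F) v :=
    (h.differentiable v).hasFDerivAt.sub (hasFDerivAt_id v)
  refine h1.le_of_lip' h.nonneg (Filter.Eventually.of_forall fun v' => ?_)
  have := h.norm_sub_sub_le v' v
  rwa [show θ v' - v' - (θ v - v) = θ v' - θ v - (v' - v) by abel]

variable [MeasurableSpace F] [BorelSpace F] (ν : Measure F) [ν.IsAddHaarMeasure]

theorem integral_comp (h : NearIdentity θ c) {G : Type} [NormedAddCommGroup G] [NormedSpace ℝ G]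
    (g : F → G) : ∫ v, |(fderiv ℝ θ v).det| • g (θ v) ∂ν = ∫ w, g w ∂ν := by
  have := integral_image_eq_integral_abs_det_fderiv_smul ν MeasurableSet.univ
    (fun v _ => (h.differentiable v).hasFDerivAt.hasFDerivWithinAt) h.injective.injOn g
  rw [image_univ, h.surjective.range_eq] at this
  simpa using this.symm

theorem integrable_comp (h : NearIdentity θ c) {G : Type} [NormedAddCommGroup G] [NormedSpace ℝ G]
    {g : F → G} (hg : Integrable g ν) :
    Integrable (fun v => |(fderiv ℝ θ v).det| • g (θ v)) ν := by
  have := integrableOn_image_iff_integrableOn_abs_det_fderiv_smul ν MeasurableSet.univ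
    (fun v _ => (h.differentiable v).hasFDerivAt.hasFDerivWithinAt) h.injective.injOn g
  rw [image_univ, h.surjective.range_eq, integrableOn_univ, integrableOn_univ] at this
  exact this.1 hg

theorem lintegral_comp_le (h : NearIdentity θ c) (hdet : ∀ v, 1 / 2 ≤ |(fderiv ℝ θ v).det|)
    (g : F → ℝ≥0∞) : ∫⁻ v, g (θ v) ∂ν ≤ 2 * ∫⁻ w, g w ∂ν := by
  have := lintegral_image_eq_lintegral_abs_det_fderiv_mul ν MeasurableSet.univ
    (fun v _ => (h.differentiable v).hasFDerivAt.hasFDerivWithinAt) h.injective.injOn g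
  rw [image_univ, h.surjective.range_eq] at this
  simp only [Measure.restrict_univ] at this
  rw [this, ← lintegral_const_mul' _ _ (by simp)]
  refine lintegral_mono fun v => ?_
  rw [← mul_assoc]
  refine le_mul_of_one_le_left zero_le ?_
  have h2 : (2 : ℝ≥0∞) = ENNReal.ofReal 2 := by simp
  rw [h2, ← ENNReal.ofReal_mul (by norm_num), ← ENNReal.ofReal_one]
  exact ENNReal.ofReal_le_ofReal (by linarith [hdet v])

end NearIdentity

end NearIdentity

/-! ### Polynomial velocity weights and the decay of `∇μ`. -/

section DecayWeight

variable {F : Type} [NormedAddCommGroup F]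

/-- The weight `(1 + |v|) ^ (-n)`. -/
def decayWeight (n : ℕ) (v : F) : ℝ := ((1 + ‖v‖) ^ n)⁻¹

theorem decayWeight_pos (n : ℕ) (v : F) : 0 < decayWeight n v := by
  unfold decayWeight
  positivity

theorem continuous_decayWeight (n : ℕ) : Continuous (decayWeight n : F → ℝ) :=
  Continuous.inv₀ (by fun_prop) fun v => by positivity

/-- Peetre's inequality `1 + ‖v‖ ≤ (1 + ‖a‖)(1 + ‖a - v‖)`. It makes weights at velocities a bounded
distance apart comparable. -/
theorem decayWeight_le_mul (n : ℕ) (a v : F) :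
    decayWeight n a ≤ (1 + ‖a - v‖) ^ n * decayWeight n v := by
  unfold decayWeight
  rw [← div_eq_mul_inv, le_div_iff₀ (by positivity), inv_mul_le_iff₀ (by positivity), ← mul_pow]
  gcongr
  have h1 : ‖v‖ ≤ ‖a‖ + ‖a - v‖ := by
    calc ‖v‖ = ‖a - (a - v)‖ := by rw [sub_sub_cancel]
      _ ≤ _ := norm_sub_le _ _
  nlinarith [norm_nonneg a, norm_nonneg (a - v)]

theorem integrable_decayWeight (d : ℕ) : Integrable (decayWeight (d + 1) : Rd d → ℝ) := by
  have h := integrable_one_add_norm (E := Rd d) (μ := volume) (r := (d + 1 : ℕ)) (by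
    simp)
  refine h.congr (Filter.Eventually.of_forall fun v => ?_)
  simp only [decayWeight]
  rw [Real.rpow_neg (by positivity), Real.rpow_natCast]

theorem one_add_le_two_mul_japanese (r : ℝ) : 1 + r ≤ 2 * japanese r := by
  unfold japanese
  have h1 : 1 ≤ √(1 + r ^ 2) := Real.one_le_sqrt.2 (by nlinarith)
  have h2 : r ≤ √(1 + r ^ 2) := Real.le_sqrt_of_sq_le (by linarith)
  linarith

theorem japanese_rpow_neg_le (n : ℕ) (v : F) :
    japanese ‖v‖ ^ (-(n : ℝ)) ≤ 2 ^ n * decayWeight n v := by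
  have h0 := one_add_le_two_mul_japanese ‖v‖
  have hj : 0 < japanese ‖v‖ := by
    have := norm_nonneg v
    linarith
  unfold decayWeight
  rw [Real.rpow_neg hj.le, Real.rpow_natCast, ← div_eq_mul_inv, le_div_iff₀ (by positivity),
    inv_mul_le_iff₀ (by positivity), mul_comm, ← mul_pow]
  gcongr

theorem contDiff_gradient {d : ℕ} {μ : Rd d → ℝ} (hμ : ContDiff ℝ ∞ μ) :
    ContDiff ℝ ∞ (gradient μ) := by
  have h : ContDiff ℝ ∞ (fderiv ℝ μ) := hμ.fderiv_right (by simp)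
  exact (InnerProductSpace.toDual ℝ (Rd d)).symm.contDiff.comp h

/-- The gradient is the derivative read through the Riesz isometry, so its order `j` is order `j +
1` of `μ`. With `n = d` the weight is integrable. -/
theorem RapidDecay.exists_gradient_bound {d : ℕ} {μ : Rd d → ℝ} (hd : RapidDecay μ) (N n : ℕ) :
    ∃ C : ℝ, 0 ≤ C ∧ ∀ j ≤ N, ∀ v,
      ‖iteratedFDeriv ℝ j (gradient μ) v‖ ≤ C * decayWeight (n + 1) v := by
  choose C hC using fun j : ℕ => hd (j + 1) ((n + 1 : ℕ) : ℝ) (by positivity)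
  refine ⟨∑ j ∈ Finset.range (N + 1), |C j| * 2 ^ (n + 1), by positivity, fun j hj v => ?_⟩
  have h1 : ‖iteratedFDeriv ℝ j (gradient μ) v‖ = ‖iteratedFDeriv ℝ (j + 1) μ v‖ := by
    have := LinearIsometryEquiv.norm_iteratedFDeriv_comp_left
      (InnerProductSpace.toDual ℝ (Rd d)).symm (fderiv ℝ μ) v j
    rw [← norm_iteratedFDeriv_fderiv, ← this]
    rfl
  rw [h1]
  have h2 := decayWeight_pos (n + 1) v
  have hj0 : 0 ≤ japanese ‖v‖ ^ (-((n + 1 : ℕ) : ℝ)) := Real.rpow_nonneg (Real.sqrt_nonneg _) _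
  calc _ ≤ C j * japanese ‖v‖ ^ (-((n + 1 : ℕ) : ℝ)) := hC j v
    _ ≤ |C j| * japanese ‖v‖ ^ (-((n + 1 : ℕ) : ℝ)) := by
        gcongr
        exact le_abs_self _
    _ ≤ |C j| * (2 ^ (n + 1) * decayWeight (n + 1) v) := by
        gcongr
        exact japanese_rpow_neg_le _ _
    _ = (|C j| * 2 ^ (n + 1)) * decayWeight (n + 1) v := by ring
    _ ≤ _ := by
        gcongr
        exact Finset.single_le_sum (f := fun j => |C j| * 2 ^ (n + 1)) (fun i _ => by positivity)
          (Finset.mem_range.2 (by omega))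

end DecayWeight

/-! ### Comparison of the integrand along two nearby germs. -/

section Germs

theorem norm_iteratedFDeriv_bilinear_le {H E F G : Type} [NormedAddCommGroup H] [NormedSpace ℝ H]
    [NormedAddCommGroup E] [NormedSpace ℝ E] [NormedAddCommGroup F] [NormedSpace ℝ F]
    [NormedAddCommGroup G] [NormedSpace ℝ G] (B : E →L[ℝ] F →L[ℝ] G) (hB : ‖B‖ ≤ 1) {n : ℕ}
    {a : H → E} {b : H → F} (ha : ContDiff ℝ n a) (hb : ContDiff ℝ n b) {x : H} {α β : ℝ}
    (hα : ∀ i ≤ n, ‖iteratedFDeriv ℝ i a x‖ ≤ α) (hβ : ∀ i ≤ n, ‖iteratedFDeriv ℝ i b x‖ ≤ β) :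
    ‖iteratedFDeriv ℝ n (fun y => B (a y) (b y)) x‖ ≤ 2 ^ n * (α * β) := by
  have hα0 : 0 ≤ α := (norm_nonneg _).trans (hα 0 (Nat.zero_le _))
  refine (B.norm_iteratedFDeriv_le_of_bilinear_of_le_one ha hb x le_rfl hB).trans ?_
  calc _ ≤ ∑ i ∈ Finset.range (n + 1), (n.choose i : ℝ) * α * β := by
        refine Finset.sum_le_sum fun i hi => ?_
        have h1 := hα i (by simpa [Nat.lt_succ_iff] using hi)
        have h2 := hβ (n - i) (Nat.sub_le _ _)
        gcongr
    _ = _ := by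
        rw [← Finset.sum_mul, ← Finset.sum_mul]
        have : (∑ i ∈ Finset.range (n + 1), (n.choose i : ℝ)) = 2 ^ n := by
          exact_mod_cast Nat.sum_range_choose n
        rw [this]
        ring

/-- The inner product of `ℝ^d` as a continuous bilinear map. -/
def innerBilin (d : ℕ) : Rd d →L[ℝ] Rd d →L[ℝ] ℝ :=
  (isBoundedBilinearMap_inner (𝕜 := ℝ) (E := Rd d)).toContinuousLinearMap

theorem innerBilin_apply {d : ℕ} (x y : Rd d) : innerBilin d x y = inner ℝ x y := rfl

theorem norm_innerBilin_le (d : ℕ) : ‖innerBilin d‖ ≤ 1 :=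
  ContinuousLinearMap.opNorm_le_bound₂ _ zero_le_one fun x y => by
    rw [one_mul, innerBilin_apply]
    exact norm_inner_le_norm x y

/-- The germs `ξ₁, ξ₀` at the origin have derivatives of order `1, …, N` bounded by `D`, and the
derivatives of their difference are bounded by `δ`. -/
structure CloseGerms {F : Type} [NormedAddCommGroup F] [NormedSpace ℝ F] (N : ℕ) (D δ : ℝ)
    (ξ₁ ξ₀ : F → F) : Prop where
  contDiff_left : ContDiff ℝ N ξ₁
  contDiff_right : ContDiff ℝ N ξ₀
  norm_left : ∀ i, 1 ≤ i → i ≤ N → ‖iteratedFDeriv ℝ i ξ₁ 0‖ ≤ D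
  norm_right : ∀ i, 1 ≤ i → i ≤ N → ‖iteratedFDeriv ℝ i ξ₀ 0‖ ≤ D
  norm_sub : ∀ i, 1 ≤ i → i ≤ N → ‖iteratedFDeriv ℝ i (ξ₁ - ξ₀) 0‖ ≤ δ

/-- The position germs agree at the origin, so the derivatives of `e` are taken at a single point
and order `N` suffices. The velocity germs may differ there by `δ`; the mean value inequality then
costs one more derivative of the smooth profile `g`, on a unit ball where the weight is comparable
to its value at `v`. -/
theorem exists_inner_germs_bound (d N : ℕ) (D C : ℝ) (hD : 1 ≤ D) (hC : 0 ≤ C) :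
    ∃ K : ℝ, 0 ≤ K ∧ ∀ (g e : Rd d → Rd d) (ξ₁ ξ₀ ν₁ ν₀ : Rd d → Rd d) (v : Rd d) (δ S : ℝ),
      ContDiff ℝ (N + 1 : ℕ) g →
      (∀ j ≤ N + 1, ∀ v, ‖iteratedFDeriv ℝ j g v‖ ≤ C * decayWeight (d + 1) v) →
      ContDiff ℝ N e → 0 ≤ δ → CloseGerms N D δ ξ₁ ξ₀ → CloseGerms N D δ ν₁ ν₀ →
      ξ₁ 0 = ξ₀ 0 → (∀ j ≤ N, ‖iteratedFDeriv ℝ j e (ξ₀ 0)‖ ≤ S) →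
      ‖ν₁ 0 - v‖ ≤ 1 → ‖ν₀ 0 - v‖ ≤ 1 → ‖ν₁ 0 - ν₀ 0‖ ≤ δ →
      ∀ k ≤ N,
        ‖iteratedFDeriv ℝ k (fun h => inner ℝ (e (ξ₁ h)) (g (ν₁ h)) : Rd d → ℝ) 0‖ ≤
          K * (S * decayWeight (d + 1) v) ∧
        ‖iteratedFDeriv ℝ k (fun h => inner ℝ (e (ξ₁ h)) (g (ν₁ h)) : Rd d → ℝ) 0 -
          iteratedFDeriv ℝ k (fun h => inner ℝ (e (ξ₀ h)) (g (ν₀ h)) : Rd d → ℝ) 0‖ ≤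
          K * (S * decayWeight (d + 1) v) * δ := by
  choose Kc hKc0 hKc using exists_norm_iteratedFDeriv_comp_sub_comp_le (Rd d) (Rd d) D hD
  set Km := ∑ i ∈ Finset.range (N + 1), Kc i with hKm
  have hKm0 : 0 ≤ Km := Finset.sum_nonneg fun i _ => hKc0 i
  have hKmi : ∀ i ≤ N, Kc i ≤ Km := fun i hi =>
    Finset.single_le_sum (fun i _ => hKc0 i) (Finset.mem_range.2 (by omega))
  set Q : ℝ := N.factorial * D ^ N with hQ
  have hQ0 : 0 ≤ Q := by positivity
  have hQi : ∀ i ≤ N, (i.factorial : ℝ) * D ^ i ≤ Q := fun i hi => by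
    have h1 : (i.factorial : ℝ) ≤ N.factorial := by exact_mod_cast Nat.factorial_le hi
    have h2 : D ^ i ≤ D ^ N := pow_le_pow_right₀ hD hi
    exact mul_le_mul h1 h2 (by positivity) (by positivity)
  set C' := C * 2 ^ (d + 1) with hC'
  have hC'0 : 0 ≤ C' := by positivity
  -- `2 ^ N` is the Leibniz constant, `Q` bounds one composition, `Km` a difference of compositions,
  -- and `C'` is the local bound for `g`. The term `Q * Q` serves the size estimate, and `2 * Km *
  -- Q` the two halves of the difference.
  refine ⟨2 ^ N * (Q * Q + 2 * Km * Q) * C', by positivity, ?_⟩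
  intro g e ξ₁ ξ₀ ν₁ ν₀ v δ S hg hgb he hδ hξ hν hξ0 hS hv1 hv0 hv10 k hk
  have hw : 0 < decayWeight (d + 1) v := decayWeight_pos _ _
  set ω' := decayWeight (d + 1) v
  have hS0 : 0 ≤ S := (norm_nonneg _).trans (hS 0 (Nat.zero_le _))
  have hkN : (k : WithTop ℕ∞) ≤ N := by exact_mod_cast hk
  have hgloc : ∀ j ≤ N + 1, ∀ a, ‖a - v‖ ≤ 1 → ‖iteratedFDeriv ℝ j g a‖ ≤ C' * ω' := by
    intro j hj a ha
    refine (hgb j hj a).trans ?_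
    have h1 := decayWeight_le_mul (d + 1) a v
    calc C * decayWeight (d + 1) a ≤ C * ((1 + ‖a - v‖) ^ (d + 1) * ω') := by gcongr
      _ ≤ C * ((1 + 1) ^ (d + 1) * ω') := by gcongr
      _ = C' * ω' := by rw [hC']; norm_num; ring
  have hgsub : ∀ j ≤ N, ‖iteratedFDeriv ℝ j g (ν₁ 0) - iteratedFDeriv ℝ j g (ν₀ 0)‖ ≤ C' * ω' * δ := by
    intro j hj
    have hmem : ∀ a, ‖a - v‖ ≤ 1 ↔ a ∈ Metric.closedBall v 1 := fun a => by
      rw [mem_closedBall_iff_norm]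
    have h1 := (convex_closedBall v 1).norm_image_sub_le_of_norm_fderiv_le
      (f := iteratedFDeriv ℝ j g) (C := C' * ω')
      (fun a _ => (hg.differentiable_iteratedFDeriv (m := j) (by exact_mod_cast Nat.lt_succ_of_le hj)) a)
      (fun a ha => by
        rw [norm_fderiv_iteratedFDeriv]
        exact hgloc (j + 1) (by omega) a ((hmem a).2 ha))
      ((hmem _).1 hv0) ((hmem _).1 hv1)
    refine h1.trans ?_
    gcongr
  have hgN : ContDiff ℝ N g := hg.of_le (by norm_cast; omega)
  have comp_le : ∀ (f : Rd d → Rd d) (ζ : Rd d → Rd d) (A : ℝ), ContDiff ℝ N f → ContDiff ℝ N ζ →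
      (∀ j ≤ N, ‖iteratedFDeriv ℝ j f (ζ 0)‖ ≤ A) →
      (∀ i, 1 ≤ i → i ≤ N → ‖iteratedFDeriv ℝ i ζ 0‖ ≤ D) →
      ∀ i ≤ k, ‖iteratedFDeriv ℝ i (f ∘ ζ) 0‖ ≤ Q * A := by
    intro f ζ A hf hζ hA hζb i hi
    have hiN : i ≤ N := hi.trans hk
    have hA0 : 0 ≤ A := (norm_nonneg _).trans (hA 0 (Nat.zero_le _))
    refine (norm_iteratedFDeriv_comp_le hf hζ (by exact_mod_cast hiN) 0
      (fun j hj => hA j (hj.trans hiN))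
      (fun j hj hj' => (hζb j hj (hj'.trans hiN)).trans (le_self_pow₀ hD (by omega)))).trans ?_
    calc (i.factorial : ℝ) * A * D ^ i = (i.factorial * D ^ i) * A := by ring
      _ ≤ _ := by gcongr; exact hQi i hiN
  have comp_sub : ∀ (f ζ₁ ζ₀ : Rd d → Rd d) (A : ℝ), ContDiff ℝ N f → CloseGerms N D δ ζ₁ ζ₀ →
      (∀ j ≤ N, ‖iteratedFDeriv ℝ j f (ζ₁ 0)‖ ≤ A) → (∀ j ≤ N, ‖iteratedFDeriv ℝ j f (ζ₀ 0)‖ ≤ A) →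
      (∀ j ≤ N, ‖iteratedFDeriv ℝ j f (ζ₁ 0) - iteratedFDeriv ℝ j f (ζ₀ 0)‖ ≤ A * δ) →
      ∀ i ≤ k, ‖iteratedFDeriv ℝ i (f ∘ ζ₁ - f ∘ ζ₀) 0‖ ≤ Km * (A * δ) := by
    intro f ζ₁ ζ₀ A hf hζ h1 h0 h10 i hi
    have hiN : i ≤ N := hi.trans hk
    have hA0 : 0 ≤ A := (norm_nonneg _).trans (h1 0 (Nat.zero_le _))
    have hiN' : (i : WithTop ℕ∞) ≤ N := by exact_mod_cast hiN
    refine (hKc i (Rd d) f ζ₁ ζ₀ 0 A δ hA0 hδ (hf.of_le hiN') (hζ.contDiff_left.of_le hiN')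
      (hζ.contDiff_right.of_le hiN') (fun j hj => h1 j (hj.trans hiN))
      (fun j hj => h0 j (hj.trans hiN)) (fun j hj => h10 j (hj.trans hiN))
      (fun j hj hj' => hζ.norm_left j hj (hj'.trans hiN))
      (fun j hj hj' => hζ.norm_right j hj (hj'.trans hiN))
      (fun j hj hj' => hζ.norm_sub j hj (hj'.trans hiN))).trans ?_
    gcongr
    exact hKmi i hiN
  have hS1 : ∀ j ≤ N, ‖iteratedFDeriv ℝ j e (ξ₁ 0)‖ ≤ S := fun j hj => hξ0 ▸ hS j hj
  have hg1 : ∀ j ≤ N, ‖iteratedFDeriv ℝ j g (ν₁ 0)‖ ≤ C' * ω' := fun j hj =>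
    hgloc j (by omega) _ hv1
  have hg0 : ∀ j ≤ N, ‖iteratedFDeriv ℝ j g (ν₀ 0)‖ ≤ C' * ω' := fun j hj =>
    hgloc j (by omega) _ hv0
  have a1 := comp_le e ξ₁ S he hξ.contDiff_left hS1 hξ.norm_left
  have a0 := comp_le e ξ₀ S he hξ.contDiff_right hS hξ.norm_right
  have b1 := comp_le g ν₁ (C' * ω') hgN hν.contDiff_left hg1 hν.norm_left
  have a10 := comp_sub e ξ₁ ξ₀ S he hξ hS1 hS (fun j _ => by
    rw [hξ0, sub_self, norm_zero]
    positivity)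
  have b10 := comp_sub g ν₁ ν₀ (C' * ω') hgN hν hg1 hg0 hgsub
  have ce1 : ContDiff ℝ k (e ∘ ξ₁) := (he.comp hξ.contDiff_left).of_le hkN
  have ce0 : ContDiff ℝ k (e ∘ ξ₀) := (he.comp hξ.contDiff_right).of_le hkN
  have cg1 : ContDiff ℝ k (g ∘ ν₁) := (hgN.comp hν.contDiff_left).of_le hkN
  have cg0 : ContDiff ℝ k (g ∘ ν₀) := (hgN.comp hν.contDiff_right).of_le hkN
  have h2k : (2 : ℝ) ^ k ≤ 2 ^ N := pow_le_pow_right₀ (by norm_num) hk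
  constructor
  · refine (norm_iteratedFDeriv_bilinear_le (innerBilin d) (norm_innerBilin_le d) ce1 cg1 a1 b1).trans ?_
    calc (2 : ℝ) ^ k * (Q * S * (Q * (C' * ω'))) ≤ 2 ^ N * (Q * S * (Q * (C' * ω'))) := by gcongr
      _ = 2 ^ N * (Q * Q + 0) * C' * (S * ω') := by ring
      _ ≤ _ := by
          gcongr
          positivity
  · have c1 : ContDiff ℝ k (fun h => innerBilin d (e (ξ₁ h)) (g (ν₁ h))) :=
      (innerBilin d).isBoundedBilinearMap.contDiff.comp₂ ce1 cg1
    have c0 : ContDiff ℝ k (fun h => innerBilin d (e (ξ₀ h)) (g (ν₀ h))) :=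
      (innerBilin d).isBoundedBilinearMap.contDiff.comp₂ ce0 cg0
    have d1 : ContDiff ℝ k (fun h => innerBilin d ((e ∘ ξ₁ - e ∘ ξ₀) h) ((g ∘ ν₁) h)) :=
      (innerBilin d).isBoundedBilinearMap.contDiff.comp₂ (ce1.sub ce0) cg1
    have d2 : ContDiff ℝ k (fun h => innerBilin d ((e ∘ ξ₀) h) ((g ∘ ν₁ - g ∘ ν₀) h)) :=
      (innerBilin d).isBoundedBilinearMap.contDiff.comp₂ ce0 (cg1.sub cg0)
    have key : (fun h => innerBilin d (e (ξ₁ h)) (g (ν₁ h))) -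
        (fun h => innerBilin d (e (ξ₀ h)) (g (ν₀ h))) =
        (fun h => innerBilin d ((e ∘ ξ₁ - e ∘ ξ₀) h) ((g ∘ ν₁) h)) +
        (fun h => innerBilin d ((e ∘ ξ₀) h) ((g ∘ ν₁ - g ∘ ν₀) h)) := by
      ext h
      simp
    have e1 := norm_iteratedFDeriv_bilinear_le (innerBilin d) (norm_innerBilin_le d)
      (ce1.sub ce0) cg1 a10 b1
    have e2 := norm_iteratedFDeriv_bilinear_le (innerBilin d) (norm_innerBilin_le d)
      ce0 (cg1.sub cg0) a0 b10
    simp only [← innerBilin_apply]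
    rw [← iteratedFDeriv_sub_apply c1.contDiffAt c0.contDiffAt, key,
      iteratedFDeriv_add_apply d1.contDiffAt d2.contDiffAt]
    refine (norm_add_le _ _).trans ((add_le_add e1 e2).trans ?_)
    calc (2 : ℝ) ^ k * (Km * (S * δ) * (Q * (C' * ω'))) + 2 ^ k * (Q * S * (Km * (C' * ω' * δ)))
        = 2 ^ k * (0 + 2 * Km * Q) * C' * (S * ω') * δ := by ring
      _ ≤ _ := by
          gcongr
          positivity

end Germs

/-! ### Derivatives in `x` traded for slanted derivatives under the velocity integral. -/

section ShiftedIntegral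

variable {d : ℕ}

/-- The `k`-th derivative of `f` at `p` in the directions `(T h, h)`. -/
def slantedDeriv (T : ℝ) (k : ℕ) (f : Rd d × Rd d → ℝ) (p : Rd d × Rd d) :
    ContinuousMultilinearMap ℝ (fun _ : Fin k => Rd d) ℝ :=
  iteratedFDeriv ℝ k (fun h => f (p + slantedShift d T h)) 0

theorem iteratedFDeriv_comp_slantedShift (T : ℝ) (k : ℕ) (f : Rd d × Rd d → ℝ) (p : Rd d × Rd d)
    (h : Rd d) : iteratedFDeriv ℝ k (fun h => f (p + slantedShift d T h)) h =
      slantedDeriv T k f (p + slantedShift d T h) := by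
  have h1 := iteratedFDeriv_comp_add_left (𝕜 := ℝ) (f := fun h => f (p + slantedShift d T h)) k h 0
  rw [add_zero] at h1
  rw [← h1, slantedDeriv]
  congr 1
  ext z
  rw [map_add, add_assoc]

theorem slantedDeriv_eq {T : ℝ} {k : ℕ} {f : Rd d × Rd d → ℝ} (hf : ContDiff ℝ k f)
    (p : Rd d × Rd d) : slantedDeriv T k f p =
      (iteratedFDeriv ℝ k f p).compContinuousLinearMap fun _ => slantedShift d T := by
  have hf' : ContDiff ℝ k (fun q => f (p + q)) := hf.comp (contDiff_const.add contDiff_id)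
  have h1 := (slantedShift d T).iteratedFDeriv_comp_right hf' 0 (le_refl _)
  rw [map_zero, iteratedFDeriv_comp_add_left, add_zero] at h1
  exact h1

theorem continuous_slantedDeriv {t : ℝ} {N : ℕ} {q : Rd d × Rd d → C(Icc (0 : ℝ) t, ℝ)}
    (hq : ContDiff ℝ N q) (T : ℝ) {k : ℕ} (hk : k ≤ N) :
    Continuous fun z : Icc (0 : ℝ) t × (Rd d × Rd d) =>
      slantedDeriv T k (fun p => q p z.1) z.2 := by
  have hq' : ContDiff ℝ k q := hq.of_le (by exact_mod_cast hk)
  have h1 := continuous_iteratedFDeriv_eval k q hq'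
  have h2 : ∀ σ, ContDiff ℝ k fun p => q p σ := fun σ =>
    (ContinuousMap.evalCLM ℝ σ : C(Icc (0 : ℝ) t, ℝ) →L[ℝ] ℝ).contDiff.comp hq'
  simp only [slantedDeriv_eq (h2 _)]
  exact (ContinuousMultilinearMap.compContinuousLinearMapL
    (fun _ : Fin k => slantedShift d T)).continuous.comp h1

theorem integral_prod_add_right {Z : Type} [NormedAddCommGroup Z] [NormedSpace ℝ Z]
    (ν : Measure ℝ) [SFinite ν] (G : ℝ × Rd d → Z) (h : Rd d) :
    ∫ z, G (z.1, z.2 + h) ∂(ν.prod volume) = ∫ z, G z ∂(ν.prod volume) := by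
  let e : ℝ × Rd d ≃ᵐ ℝ × Rd d :=
    (MeasurableEquiv.refl ℝ).prodCongr (MeasurableEquiv.addRight h)
  have he : MeasurePreserving e (ν.prod volume) (ν.prod volume) :=
    (MeasurePreserving.id ν).prod (measurePreserving_add_right volume h)
  exact he.integral_comp' G

variable {t : ℝ} (ht : 0 ≤ t) {N : ℕ} {q : Rd d × Rd d → C(Icc (0 : ℝ) t, ℝ)} {C T : ℝ}

theorem integrable_slantedDeriv (hq : ContDiff ℝ N q)
    (hb : ∀ k ≤ N, ∀ p σ, ‖slantedDeriv T k (fun p => q p σ) p‖ ≤ C * decayWeight (d + 1) p.2)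
    {k : ℕ} (hk : k ≤ N) (x : Rd d) :
    Integrable (fun z : ℝ × Rd d => slantedDeriv T k (fun p => q p (projIcc 0 t ht z.1)) (x, z.2))
      ((volume.restrict (Ioc 0 t)).prod volume) := by
  have hp : Continuous (projIcc 0 t ht) := continuous_projIcc
  refine Integrable.mono' (g := fun z => C * decayWeight (d + 1) z.2)
    (((integrable_decayWeight d).comp_snd _).const_mul C) ?_
    (Filter.Eventually.of_forall fun z => hb k hk _ _)
  exact ((continuous_slantedDeriv hq T hk).comp
    (f := fun z : ℝ × Rd d => (projIcc 0 t ht z.1, (x, z.2))) (by fun_prop)).aestronglyMeasurable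

/-- Translation invariance in `v` gives `r (T h) = ∫ q (T h, v + h)`. Differentiating in `h`
produces `T ^ k ∇^k r` on the left and only slanted derivatives on the right. -/
theorem contDiff_shifted_integral (hT : 0 < T) (hq : ContDiff ℝ N q) (hC : 0 ≤ C)
    (hb : ∀ k ≤ N, ∀ p σ, ‖slantedDeriv T k (fun p => q p σ) p‖ ≤ C * decayWeight (d + 1) p.2)
    {r : Rd d → ℝ} (hr : ∀ x, r x = ∫ s in (0 : ℝ)..t, ∫ v, q (x, v) (projIcc 0 t ht s)) :
    ContDiff ℝ N r ∧ ∀ k ≤ N, ∀ x, T ^ k • iteratedFDeriv ℝ k r x =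
      ∫ z, slantedDeriv T k (fun p => q p (projIcc 0 t ht z.1)) (x, z.2)
        ∂((volume.restrict (Ioc 0 t)).prod volume) := by
  have hp : Continuous (projIcc 0 t ht) := continuous_projIcc
  have hqc := hq.continuous
  let S := slantedShift d T
  let f : ℝ × Rd d → Rd d → ℝ := fun z h => q ((0, z.2) + S h) (projIcc 0 t ht z.1)
  have hfk : ∀ (z : ℝ × Rd d) (k : ℕ) (h : Rd d), iteratedFDeriv ℝ k (f z) h =
      slantedDeriv T k (fun p => q p (projIcc 0 t ht z.1)) ((0, z.2) + S h) := fun z k h =>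
    iteratedFDeriv_comp_slantedShift T k (fun p => q p (projIcc 0 t ht z.1)) _ h
  have hS : ∀ (v h : Rd d), ((0, v) : Rd d × Rd d) + S h = (T • h, v + h) := fun v h => by
    simp [S, slantedShift_apply]
  have hint0 : ∀ x, Integrable (fun z : ℝ × Rd d => q (x, z.2) (projIcc 0 t ht z.1))
      ((volume.restrict (Ioc 0 t)).prod volume) := by
    intro x
    refine Integrable.mono' (g := fun z => C * decayWeight (d + 1) z.2)
      (((integrable_decayWeight d).comp_snd _).const_mul C) ?_
      (Filter.Eventually.of_forall fun z => ?_)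
    · have : Continuous (fun z : ℝ × Rd d => q (x, z.2) (projIcc 0 t ht z.1)) := by fun_prop
      exact this.aestronglyMeasurable
    · have := hb 0 (Nat.zero_le _) (x, z.2) (projIcc 0 t ht z.1)
      rw [slantedDeriv, norm_iteratedFDeriv_zero, map_zero, add_zero] at this
      exact this
  have hr' : ∀ x, r x = ∫ z, q (x, z.2) (projIcc 0 t ht z.1)
      ∂((volume.restrict (Ioc 0 t)).prod volume) := fun x => by
    rw [hr, intervalIntegral.integral_of_le ht, integral_prod _ (hint0 x)]
  have hrf : ∀ h, r (T • h) = ∫ z, f z h ∂((volume.restrict (Ioc 0 t)).prod volume) := fun h => by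
    rw [hr', ← integral_prod_add_right (volume.restrict (Ioc 0 t))
      (fun z : ℝ × Rd d => q (T • h, z.2) (projIcc 0 t ht z.1)) h]
    simp only [f, hS]
  have taylor := hasFTaylorSeriesUpTo_integral (N := N) (f := f)
    (ν := (volume.restrict (Ioc 0 t)).prod volume)
    (Filter.Eventually.of_forall fun z => by
      have h1 : ContDiff ℝ N fun p => q p (projIcc 0 t ht z.1) :=
        (ContinuousMap.evalCLM ℝ (projIcc 0 t ht z.1) : C(Icc (0 : ℝ) t, ℝ) →L[ℝ] ℝ).contDiff.comp hq
      exact h1.comp (contDiff_const.add S.contDiff))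
    (fun k hk h => by
      simp only [hfk]
      exact ((continuous_slantedDeriv hq T hk).comp
        (f := fun z : ℝ × Rd d => (projIcc 0 t ht z.1, ((0, z.2) + S h)))
        (by fun_prop)).aestronglyMeasurable)
    (fun k hk h₀ => by
      -- Peetre's inequality with `‖h‖ ≤ ‖h₀‖ + 1` dominates the shifted weight by the unshifted
      -- one.
      refine ⟨fun z => C * (2 + ‖h₀‖) ^ (d + 1) * decayWeight (d + 1) z.2,
        ((integrable_decayWeight d).comp_snd _).const_mul _,
        Filter.Eventually.of_forall fun z h hh => ?_⟩
      rw [hfk]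
      refine (hb k hk _ _).trans ?_
      rw [hS]
      change C * decayWeight (d + 1) (z.2 + h) ≤ C * (2 + ‖h₀‖) ^ (d + 1) * decayWeight (d + 1) z.2
      rw [mul_assoc]
      have h1 := decayWeight_le_mul (d + 1) (z.2 + h) z.2
      rw [add_sub_cancel_left] at h1
      have h2 : ‖h‖ ≤ ‖h₀‖ + 1 := by
        rw [mem_ball_iff_norm] at hh
        have := norm_le_norm_add_norm_sub h₀ h
        rw [norm_sub_rev] at this
        linarith
      have h3 := (decayWeight_pos (d + 1) z.2).le
      have h4 : 1 + ‖h‖ ≤ 2 + ‖h₀‖ := by linarith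
      gcongr
      exact h1.trans (mul_le_mul_of_nonneg_right (pow_le_pow_left₀ (by positivity) h4 _) h3))
  have hTne : T ≠ 0 := hT.ne'
  have hR : (fun h => r (T • h)) = fun h => ∫ z, f z h ∂((volume.restrict (Ioc 0 t)).prod volume) :=
    funext hrf
  rw [← hR] at taylor
  have hRc : ContDiff ℝ N fun h => r (T • h) := taylor.contDiff
  have hrc : ContDiff ℝ N r := by
    have h1 : ContDiff ℝ N fun x => (fun h => r (T • h)) (T⁻¹ • x) :=
      hRc.comp (contDiff_const_smul T⁻¹)
    simpa [smul_smul, hTne] using h1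
  refine ⟨hrc, fun k hk x => ?_⟩
  have hkN : (k : WithTop ℕ∞) ≤ N := by exact_mod_cast hk
  have h1 := iteratedFDeriv_const_smul_comp_smul (hrc.of_le hkN) 1 T (T⁻¹ • x)
  simp only [one_smul, one_mul, smul_smul, mul_inv_cancel₀ hTne] at h1
  rw [← h1, ← taylor.eq_iteratedFDeriv hkN]
  simp only [hfk, hS, smul_smul, mul_inv_cancel₀ hTne, one_smul]
  exact integral_prod_add_right (volume.restrict (Ioc 0 t)) (fun z : ℝ × Rd d =>
    slantedDeriv T k (fun p => q p (projIcc 0 t ht z.1)) (x, z.2)) (T⁻¹ • x)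

end ShiftedIntegral

/-! ### The pointwise bound for the derivatives of the reaction term. -/

section ReactionDensity

variable {d : ℕ}

/-- The sum of the rescaled derivatives `(1 + s) ^ j |∇^j E (s, x)|`, frozen for negative times. -/
def fieldSum (N : ℕ) (E : ℝ → Rd d → Rd d) (s : ℝ) (x : Rd d) : ℝ :=
  ∑ j ∈ Finset.range (N + 1), (1 + max s 0) ^ j * ‖iteratedFDeriv ℝ j (E (max s 0)) x‖

theorem fieldSum_nonneg (N : ℕ) (E : ℝ → Rd d → Rd d) (s : ℝ) (x : Rd d) : 0 ≤ fieldSum N E s x := by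
  have : 0 ≤ max s 0 := le_max_right _ _
  unfold fieldSum
  positivity

theorem IsClassicalField.continuous_fieldSum {N : ℕ} {E : ℝ → Rd d → Rd d}
    (hE : IsClassicalField N E) : Continuous fun p : ℝ × Rd d => fieldSum N E p.1 p.2 := by
  unfold fieldSum
  refine continuous_finsetSum _ fun j hj => ?_
  have hj' : j ≤ N := by simpa [Nat.lt_succ_iff] using hj
  have h1 := (hE.2 j hj').comp_continuous
    (f := fun p : ℝ × Rd d => (max p.1 0, p.2)) (by fun_prop)
    (fun p => ⟨mem_Ici.2 (le_max_right p.1 0), mem_univ _⟩)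
  exact Continuous.mul (by fun_prop) h1.norm

theorem WeightedField.fieldSum_le {N : ℕ} {η : ℝ} {E : ℝ → Rd d → Rd d} (hW : WeightedField N η E)
    (hη : 0 ≤ η) (s : ℝ) (x : Rd d) : fieldSum N E s x ≤ (N + 1) * η := by
  have hs : 0 ≤ max s 0 := le_max_right _ _
  have h1 : ∀ j ∈ Finset.range (N + 1),
      (1 + max s 0) ^ j * ‖iteratedFDeriv ℝ j (E (max s 0)) x‖ ≤ η := fun j hj => by
    refine (hW j (by simpa [Nat.lt_succ_iff] using hj) _ hs x).trans ?_
    have := Real.rpow_le_one_of_one_le_of_nonpos (x := 1 + max s 0) (z := -(11 / 4)) (by linarith)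
      (by norm_num)
    exact mul_le_of_le_one_right hη this
  refine (Finset.sum_le_card_nsmul _ _ _ h1).trans (le_of_eq ?_)
  simp

theorem norm_iteratedFDeriv_scaled_le_fieldSum {N : ℕ} {E : ℝ → Rd d → Rd d}
    (hE : IsClassicalField N E) {s : ℝ} (hs : 0 ≤ s) {j : ℕ} (hj : j ≤ N) (z : Rd d) :
    ‖iteratedFDeriv ℝ j (fun z => E s ((1 + s) • z)) z‖ ≤ fieldSum N E s ((1 + s) • z) := by
  have h1 := iteratedFDeriv_const_smul_comp_smul
    ((hE.1 s hs).of_le (show (j : WithTop ℕ∞) ≤ N by exact_mod_cast hj)) 1 (1 + s) z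
  simp only [one_smul, one_mul] at h1
  rw [h1, norm_smul, Real.norm_of_nonneg (by positivity)]
  unfold fieldSum
  rw [max_eq_left hs]
  exact Finset.single_le_sum
    (f := fun j => (1 + s) ^ j * ‖iteratedFDeriv ℝ j (E s) ((1 + s) • z)‖)
    (fun i _ => by positivity) (Finset.mem_range.2 (by omega))

/-- The integrand is packaged as a smooth map from phase space into curves. It serves for both
terms, with the true or the free trajectories; the weight `w` undoes the amplitude scaling of the
field. -/
theorem WeightedField.exists_reactionDensity {N : ℕ} {η : ℝ} {E : ℝ → Rd d → Rd d}
    (hW : WeightedField N η E) (hE : IsClassicalField N E) {μ : Rd d → ℝ} (hμ : ContDiff ℝ ∞ μ)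
    {t : ℝ} {ξ ν : Rd d × Rd d → C(Icc (0 : ℝ) t, Rd d)} (hξ : ContDiff ℝ N ξ)
    (hν : ContDiff ℝ N ν) :
    ∃ q : Rd d × Rd d → C(Icc (0 : ℝ) t, ℝ), ContDiff ℝ N q ∧ ∀ p σ,
      q p σ = inner ℝ (E σ ((1 + (σ : ℝ)) • ξ p σ)) (gradient μ (ν p σ)) := by
  obtain ⟨f, hf, hfj, -⟩ := hW.exists_scaledField hE t
  have hgm := contDiff_gradient hμ
  have hgc : Continuous (gradient μ) := hgm.continuous
  let g : C(Icc (0 : ℝ) t × Rd d, Rd d) := ⟨fun p => gradient μ p.2, by fun_prop⟩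
  have hgN : ContDiff ℝ N (gradient μ) := hgm.of_le (by exact_mod_cast le_top)
  have hgj : JointlyContDiff N g := ⟨fun _ => hgN, fun k hk =>
    (hgN.continuous_iteratedFDeriv (by exact_mod_cast hk)).comp continuous_snd⟩
  let w : C(Icc (0 : ℝ) t, ℝ) := ⟨_, continuous_one_add_rpow (-(11 / 4))⟩
  refine ⟨fun p => pointwiseBilinear (ContinuousLinearMap.mul ℝ ℝ) w
    (pointwiseBilinear (innerBilin d) (nemytskii f (ξ p)) (nemytskii g (ν p))), ?_, fun p σ => ?_⟩
  · refine (ContinuousLinearMap.contDiff _).comp ?_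
    exact (pointwiseBilinear (K := Icc (0 : ℝ) t) (innerBilin d)).isBoundedBilinearMap.contDiff.comp₂
      ((contDiff_nemytskii N f hfj).comp hξ) ((contDiff_nemytskii N g hgj).comp hν)
  · simp only [pointwiseBilinear_apply, nemytskii_apply, hf, innerBilin_apply,
      ContinuousLinearMap.mul_apply', w, g, ContinuousMap.coe_mk]
    rw [real_inner_smul_left, ← mul_assoc, ← Real.rpow_add (by linarith [σ.2.1])]
    norm_num

/-- Only derivatives of positive order are compared, so the base points `c` and `c'` need not agree.
This permits comparing the true germ at velocity `v` with the free germ at the mean velocity. -/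
theorem closeGerms_of_sub_affine {N : ℕ} {D δ : ℝ} {ξ : Rd d → Rd d}
    (L : Rd d →L[ℝ] Rd d) (c c' : Rd d) (hL : ‖L‖ ≤ 1) (hδ : δ ≤ D) (hξ : ContDiff ℝ N ξ)
    (h : ∀ i, 1 ≤ i → i ≤ N → ‖iteratedFDeriv ℝ i (fun h => ξ h - (c + L h)) 0‖ ≤ δ) :
    CloseGerms N (D + 1) δ ξ (fun h => c' + L h) := by
  have hδ0 : ∀ i, 1 ≤ i → i ≤ N → 0 ≤ D := fun i hi hi' => ((norm_nonneg _).trans (h i hi hi')).trans hδ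
  have hLc : ∀ c : Rd d, ContDiff ℝ N fun h => c + L h := fun c => contDiff_const.add L.contDiff
  have haff : ∀ (c : Rd d) (i : ℕ), 1 ≤ i → ‖iteratedFDeriv ℝ i (fun h => c + L h) 0‖ ≤ 1 := by
    intro c i hi
    obtain ⟨i, rfl⟩ : ∃ k, i = k + 1 := ⟨i - 1, by omega⟩
    have h1 : fderiv ℝ (fun h => c + L h) = fun _ => L := by
      ext1 y
      exact (L.hasFDerivAt.const_add c).fderiv
    rw [← norm_iteratedFDeriv_fderiv, h1]
    rcases i with _ | i
    · simpa using hL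
    · rw [iteratedFDeriv_const_of_ne (by omega)]
      simp
  have hsub : ∀ i, 1 ≤ i → i ≤ N → ‖iteratedFDeriv ℝ i (ξ - fun h => c' + L h) 0‖ ≤ δ := by
    intro i hi hi'
    have hi'' : (i : WithTop ℕ∞) ≤ N := by exact_mod_cast hi'
    have e : (ξ - fun h => c' + L h) = (fun h => ξ h - (c + L h)) + fun _ => c - c' := by
      ext1 h
      simp only [Pi.sub_apply, Pi.add_apply]
      abel
    rw [e, iteratedFDeriv_add_apply ((hξ.sub (hLc c)).of_le hi'').contDiffAt contDiff_const.contDiffAt,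
      iteratedFDeriv_const_of_ne (by omega)]
    simpa using h i hi hi'
  refine ⟨hξ, hLc c', fun i hi hi' => ?_, fun i hi hi' => (haff c' i hi).trans ?_, hsub⟩
  · have hi'' : (i : WithTop ℕ∞) ≤ N := by exact_mod_cast hi'
    have e : ξ = (ξ - fun h => c' + L h) + fun h => c' + L h := by simp
    have hc : ContDiff ℝ N (ξ - fun h => c' + L h) := hξ.sub (hLc c')
    rw [e, iteratedFDeriv_add_apply (hc.of_le hi'').contDiffAt ((hLc c').of_le hi'').contDiffAt]
    exact (norm_add_le _ _).trans (add_le_add ((hsub i hi hi').trans hδ) (haff c' i hi))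
  · linarith [hδ0 i hi hi']

theorem norm_iteratedFDeriv_sub_self_le (ξ : Rd d → Rd d) (i : ℕ) (x : Rd d) :
    ‖iteratedFDeriv ℝ i (ξ - ξ) x‖ ≤ 0 := by
  have : ξ - ξ = fun _ => 0 := sub_self ξ
  rw [this, iteratedFDeriv_fun_zero]
  simp

theorem CloseGerms.self_left {N : ℕ} {D δ : ℝ} {ξ₁ ξ₀ : Rd d → Rd d} (h : CloseGerms N D δ ξ₁ ξ₀) :
    CloseGerms N D 0 ξ₁ ξ₁ :=
  ⟨h.contDiff_left, h.contDiff_left, h.norm_left, h.norm_left,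
    fun _ _ _ => norm_iteratedFDeriv_sub_self_le _ _ _⟩

theorem CloseGerms.self_right {N : ℕ} {D δ : ℝ} {ξ₁ ξ₀ : Rd d → Rd d} (h : CloseGerms N D δ ξ₁ ξ₀) :
    CloseGerms N D 0 ξ₀ ξ₀ :=
  ⟨h.contDiff_right, h.contDiff_right, h.norm_right, h.norm_right,
    fun _ _ _ => norm_iteratedFDeriv_sub_self_le _ _ _⟩

theorem integrable_slantedDeriv_right {t : ℝ} {N : ℕ} {q : Rd d × Rd d → C(Icc (0 : ℝ) t, ℝ)}
    {C T : ℝ} (hq : ContDiff ℝ N q)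
    (hb : ∀ k ≤ N, ∀ p σ, ‖slantedDeriv T k (fun p => q p σ) p‖ ≤ C * decayWeight (d + 1) p.2)
    {k : ℕ} (hk : k ≤ N) (x : Rd d) (σ : Icc (0 : ℝ) t) :
    Integrable (fun v : Rd d => slantedDeriv T k (fun p => q p σ) (x, v)) := by
  refine Integrable.mono' (g := fun v => C * decayWeight (d + 1) v)
    ((integrable_decayWeight d).const_mul C) ?_ (Filter.Eventually.of_forall fun v => hb k hk _ _)
  exact ((continuous_slantedDeriv hq T hk).comp
    (f := fun v : Rd d => (σ, (x, v))) (by fun_prop)).aestronglyMeasurable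

/-- At each `s < t` the linear integrand is pulled back by the mean velocity, so that both
integrands see the field at the same point. The difference is then a Jacobian error plus a germ
error, each of relative size `η (1 + s) ^ (-7/4)`; changing variables back leaves an integral over
free transport. -/
theorem exists_reaction_bound (d N : ℕ) (hN : N ≠ 0) {μ : Rd d → ℝ} (hμ : ContDiff ℝ ∞ μ)
    (hμd : RapidDecay μ) : ∃ η₀ : ℝ, 0 < η₀ ∧ ∃ K : ℝ, 0 ≤ K ∧
      ∀ (t η : ℝ) (E : ℝ → Rd d → Rd d) (X V : ℝ → ℝ → Rd d → Rd d → Rd d), 0 ≤ t → 0 ≤ η → η ≤ η₀ →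
      IsClassicalField N E → IsCharacteristics E X V → WeightedField N η E →
      ContDiff ℝ N (reaction E μ X V t) ∧
      ∀ k ≤ N, ∀ x, ENNReal.ofReal (max 1 t ^ k) * ‖iteratedFDeriv ℝ k (reaction E μ X V t) x‖ₑ ≤
        ∫⁻ s in Ioc 0 t, ENNReal.ofReal (K * η * (1 + s) ^ (-(7 / 4) : ℝ)) *
          ∫⁻ w : Rd d, ENNReal.ofReal (decayWeight (d + 1) w * fieldSum N E s (x - (t - s) • w)) := by
  obtain ⟨D, hD, hflow⟩ := exists_flow_curves d N hN
  obtain ⟨Kd, hKd0, hKd⟩ := exists_abs_abs_det_sub_one_le (Rd d)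
  obtain ⟨Cμ, hCμ0, hCμ⟩ := hμd.exists_gradient_bound (N + 1) d
  obtain ⟨K, hK0, hK⟩ := exists_inner_germs_bound d N (D + 4 + 1) Cμ (by linarith) hCμ0
  -- The first threshold gives the mean velocity Lipschitz distance at most `1/2` from the identity,
  -- the second keeps its Jacobian within `1/2` of `1`. In the constant, the outer `2` is the cost
  -- of changing variables back, `2 * K * (D + 4)` the germ error times a Jacobian at most `2`, and
  -- `4 * Kd * K` the Jacobian error.
  refine ⟨min (1 / 8) (1 / (8 * (Kd + 1))), by positivity, 2 * (2 * K * (D + 4) + 4 * Kd * K),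
    by positivity, ?_⟩
  intro t η E X V ht hη hη0 hE hX hW
  have hη8 : η ≤ 1 / 8 := hη0.trans (min_le_left _ _)
  have hηd : η * (8 * (Kd + 1)) ≤ 1 := by
    have := hη0.trans (min_le_right _ _)
    rwa [le_div_iff₀ (by positivity)] at this
  obtain ⟨ξ, ν, hξX, hνV, hξ, hν, hdiff⟩ := hflow t η E X V ht hη (by linarith) hE hX hW
  obtain ⟨qN, hqN, hqNe⟩ := hW.exists_reactionDensity hE hμ hξ hν
  obtain ⟨qL, hqL, hqLe⟩ := hW.exists_reactionDensity hE hμ (freePos d t).contDiff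
    (freeVel d t).contDiff
  set T := max 1 t with hT
  have hT0 : 0 < T := lt_max_of_lt_left one_pos
  set S := slantedShift d T with hS
  have hgm : ContDiff ℝ (N + 1 : ℕ) (gradient μ) :=
    (contDiff_gradient hμ).of_le (by exact_mod_cast le_top)
  have hβ : ∀ s : ℝ, 0 ≤ s → (1 + s) ^ (-(7 / 4) : ℝ) ≤ 1 := fun s hs =>
    Real.rpow_le_one_of_one_le_of_nonpos (by linarith) (by norm_num)
  have hβ0 : ∀ s : ℝ, 0 ≤ s → 0 ≤ (1 + s) ^ (-(7 / 4) : ℝ) := fun s hs =>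
    Real.rpow_nonneg (by linarith) _
  have hec : ∀ s : ℝ, 0 ≤ s → ContDiff ℝ N fun z => E s ((1 + s) • z) := fun s hs =>
    (hE.1 s hs).comp (contDiff_const_smul (1 + s))
  have hδle : ∀ s : ℝ, 0 ≤ s → (D + 4) * η * (1 + s) ^ (-(7 / 4) : ℝ) ≤ D + 4 := fun s hs => by
    calc (D + 4) * η * (1 + s) ^ (-(7 / 4) : ℝ) ≤ (D + 4) * (1 / 8) * 1 := by
          have := hβ s hs
          have := hβ0 s hs
          gcongr
      _ ≤ D + 4 := by linarith
  have hfreePos : ∀ (p : Rd d × Rd d) (σ : Icc (0 : ℝ) t) (h : Rd d), freePos d t (p + S h) σ =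
      freePos d t p σ + (ContinuousMap.evalCLM ℝ σ).comp ((freePos d t).comp S) h := fun p σ h => by
    rw [map_add]
    rfl
  have hfreeVel : ∀ (p : Rd d × Rd d) (σ : Icc (0 : ℝ) t) (h : Rd d), freeVel d t (p + S h) σ =
      freeVel d t p σ + (ContinuousMap.evalCLM ℝ σ).comp ((freeVel d t).comp S) h := fun p σ h => by
    rw [map_add]
    rfl
  have heval : ∀ (σ : Icc (0 : ℝ) t) (L : Rd d →L[ℝ] C(Icc (0 : ℝ) t, Rd d)), ‖L‖ ≤ 1 →
      ‖(ContinuousMap.evalCLM ℝ σ).comp L‖ ≤ 1 := fun σ L hL =>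
    ContinuousLinearMap.opNorm_le_bound _ zero_le_one fun h =>
      ((L h).norm_coe_le_norm σ).trans (L.le_of_opNorm_le hL h)
  have hξ1 : ∀ (p : Rd d × Rd d) (σ : Icc (0 : ℝ) t), ContDiff ℝ N fun h => ξ (p + S h) σ :=
    fun p σ => (ContinuousMap.evalCLM ℝ σ : C(Icc (0 : ℝ) t, Rd d) →L[ℝ] Rd d).contDiff.comp
      (hξ.comp (contDiff_const.add S.contDiff))
  have hν1 : ∀ (p : Rd d × Rd d) (σ : Icc (0 : ℝ) t), ContDiff ℝ N fun h => ν (p + S h) σ :=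
    fun p σ => (ContinuousMap.evalCLM ℝ σ : C(Icc (0 : ℝ) t, Rd d) →L[ℝ] Rd d).contDiff.comp
      (hν.comp (contDiff_const.add S.contDiff))
  have hDη : ∀ s : ℝ, 0 ≤ s →
      D * η * (1 + s) ^ (-(7 / 4) : ℝ) ≤ (D + 4) * η * (1 + s) ^ (-(7 / 4) : ℝ) := fun s hs => by
    have := hβ0 s hs
    gcongr
    linarith
  have germX : ∀ (p p' : Rd d × Rd d) (σ : Icc (0 : ℝ) t),
      CloseGerms N (D + 4 + 1) ((D + 4) * η * (1 + (σ : ℝ)) ^ (-(7 / 4) : ℝ))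
        (fun h => ξ (p + S h) σ) (fun h => freePos d t (p' + S h) σ) := by
    intro p p' σ
    simp only [hfreePos]
    refine closeGerms_of_sub_affine _ (freePos d t p σ) _
      (heval σ _ (norm_freePos_comp_slantedShift_le ht)) (hδle σ σ.2.1) (hξ1 p σ) fun i hi hi' => ?_
    simp only [← hfreePos]
    exact ((hdiff p σ i hi hi' 0).1).trans (hDη σ σ.2.1)
  have germV : ∀ (p p' : Rd d × Rd d) (σ : Icc (0 : ℝ) t),
      CloseGerms N (D + 4 + 1) ((D + 4) * η * (1 + (σ : ℝ)) ^ (-(7 / 4) : ℝ))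
        (fun h => ν (p + S h) σ) (fun h => freeVel d t (p' + S h) σ) := by
    intro p p' σ
    simp only [hfreeVel]
    refine closeGerms_of_sub_affine _ (freeVel d t p σ) _
      (heval σ _ (norm_freeVel_comp_slantedShift_le t T)) (hδle σ σ.2.1) (hν1 p σ) fun i hi hi' => ?_
    simp only [← hfreeVel]
    exact ((hdiff p σ i hi hi' 0).2).trans (hDη σ σ.2.1)
  have hsum : ∀ (σ : Icc (0 : ℝ) t) (z : Rd d), ∀ j ≤ N,
      ‖iteratedFDeriv ℝ j (fun z => E σ ((1 + (σ : ℝ)) • z)) z‖ ≤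
        fieldSum N E σ ((1 + (σ : ℝ)) • z) := fun σ z j hj =>
    norm_iteratedFDeriv_scaled_le_fieldSum hE σ.2.1 hj z
  have hsum' : ∀ (σ : Icc (0 : ℝ) t) (z : Rd d), ∀ j ≤ N,
      ‖iteratedFDeriv ℝ j (fun z => E σ ((1 + (σ : ℝ)) • z)) z‖ ≤ (N + 1) * η := fun σ z j hj =>
    (hsum σ z j hj).trans (hW.fieldSum_le hη _ _)
  have slN : ∀ (k : ℕ) (σ : Icc (0 : ℝ) t) (p : Rd d × Rd d), slantedDeriv T k (fun p => qN p σ) p =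
      iteratedFDeriv ℝ k (fun h => inner ℝ ((fun z => E σ ((1 + (σ : ℝ)) • z)) (ξ (p + S h) σ))
        (gradient μ (ν (p + S h) σ))) 0 := fun k σ p => by
    simp only [slantedDeriv, hqNe, ← hS]
  have slL : ∀ (k : ℕ) (σ : Icc (0 : ℝ) t) (p : Rd d × Rd d), slantedDeriv T k (fun p => qL p σ) p =
      iteratedFDeriv ℝ k (fun h => inner ℝ
        ((fun z => E σ ((1 + (σ : ℝ)) • z)) (freePos d t (p + S h) σ))
        (gradient μ (freeVel d t (p + S h) σ))) 0 := fun k σ p => by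
    simp only [slantedDeriv, hqLe, ← hS]
  have hνv : ∀ (p : Rd d × Rd d) (σ : Icc (0 : ℝ) t),
      ‖ν p σ - p.2‖ ≤ 2 * η * (1 + (σ : ℝ)) ^ (-(7 / 4) : ℝ) := fun p σ => by
    rw [hνV]
    exact hW.norm_vel_sub_le hE hX hη σ.2.1 σ.2.2 p.1 p.2
  have small : ∀ s : ℝ, 0 ≤ s → η * (1 + s) ^ (-(7 / 4) : ℝ) ≤ 1 / 8 := fun s hs =>
    (mul_le_of_le_one_right hη (hβ s hs)).trans hη8
  have hbN : ∀ k ≤ N, ∀ p σ, ‖slantedDeriv T k (fun p => qN p σ) p‖ ≤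
      K * ((N + 1) * η) * decayWeight (d + 1) p.2 := by
    intro k hk p σ
    have h1 : ‖ν (p + S 0) σ - p.2‖ ≤ 1 := by
      rw [map_zero, add_zero]
      have := small σ σ.2.1
      linarith [hνv p σ]
    -- Comparing a germ with itself, with `δ = 0`, leaves the size estimate.
    have := (hK (gradient μ) (fun z => E σ ((1 + (σ : ℝ)) • z)) _ _ _ _ p.2 0 ((N + 1) * η) hgm hCμ
      (hec σ σ.2.1) le_rfl (germX p p σ).self_left (germV p p σ).self_left rfl (fun j hj => hsum' σ _ j hj) h1 h1 (by simp) k hk).1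
    rw [slN, mul_assoc]
    exact this
  have hbL : ∀ k ≤ N, ∀ p σ, ‖slantedDeriv T k (fun p => qL p σ) p‖ ≤
      K * ((N + 1) * η) * decayWeight (d + 1) p.2 := by
    intro k hk p σ
    have h1 : ‖freeVel d t (p + S 0) σ - p.2‖ ≤ 1 := by
      rw [map_zero, add_zero, freeVel_apply, sub_self, norm_zero]
      exact zero_le_one
    have := (hK (gradient μ) (fun z => E σ ((1 + (σ : ℝ)) • z)) _ _ _ _ p.2 0 ((N + 1) * η) hgm hCμ
      (hec σ σ.2.1) le_rfl (germX p p σ).self_right (germV p p σ).self_right rfl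
      (fun j hj => hsum' σ _ j hj) h1 h1 (by simp) k hk).1
    rw [slL, mul_assoc]
    exact this
  have hC0 : 0 ≤ K * ((N + 1) * η) := by positivity
  have hrL : ∀ x, reactionL E μ t x = ∫ s in (0 : ℝ)..t, ∫ v, qL (x, v) (projIcc 0 t ht s) := by
    intro x
    refine intervalIntegral.integral_congr fun s hs => ?_
    rw [uIcc_of_le ht] at hs
    have hs0 : 1 + s ≠ 0 := by linarith [hs.1]
    simp only [projIcc_of_mem ht hs, hqLe, freePos_apply, freeVel_apply, smul_smul,
      mul_inv_cancel₀ hs0, one_smul]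
  have hrN : ∀ x, reactionNL E μ X V t x =
      ∫ s in (0 : ℝ)..t, ∫ v, qN (x, v) (projIcc 0 t ht s) := by
    intro x
    refine intervalIntegral.integral_congr fun s hs => ?_
    rw [uIcc_of_le ht] at hs
    have hs0 : 1 + s ≠ 0 := by linarith [hs.1]
    simp only [projIcc_of_mem ht hs, hqNe, hξX, hνV, smul_smul, mul_inv_cancel₀ hs0, one_smul]
  obtain ⟨cL, dL⟩ := contDiff_shifted_integral ht hT0 hqL hC0 hbL hrL
  obtain ⟨cN, dN⟩ := contDiff_shifted_integral ht hT0 hqN hC0 hbN hrN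
  have hre : reaction E μ X V t = reactionL E μ t - reactionNL E μ X V t := rfl
  refine ⟨hre ▸ cL.sub cN, fun k hk x => ?_⟩
  have hkN : (k : WithTop ℕ∞) ≤ N := by exact_mod_cast hk
  have iL := integrable_slantedDeriv ht hqL hbL hk x
  have iN := integrable_slantedDeriv ht hqN hbN hk x
  have e1 : T ^ k • iteratedFDeriv ℝ k (reaction E μ X V t) x = ∫ s in Ioc 0 t,
      ((∫ v, slantedDeriv T k (fun p => qL p (projIcc 0 t ht s)) (x, v)) -
        ∫ v, slantedDeriv T k (fun p => qN p (projIcc 0 t ht s)) (x, v)) := by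
    rw [hre, iteratedFDeriv_sub_apply (cL.of_le hkN).contDiffAt (cN.of_le hkN).contDiffAt, smul_sub,
      dL k hk x, dN k hk x, integral_prod _ iL, integral_prod _ iN,
      ← integral_sub iL.integral_prod_left iN.integral_prod_left]
  have e2 : ENNReal.ofReal (T ^ k) * ‖iteratedFDeriv ℝ k (reaction E μ X V t) x‖ₑ =
      ‖T ^ k • iteratedFDeriv ℝ k (reaction E μ X V t) x‖ₑ := by
    rw [enorm_smul, Real.enorm_of_nonneg (by positivity)]
  rw [e2, e1]
  refine (enorm_integral_le_lintegral_enorm _).trans ?_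
  refine lintegral_mono_ae ?_
  -- At `s = t` the mean velocity loses its meaning; a null set of times is discarded.
  have hae : ∀ᵐ s ∂(volume.restrict (Ioc 0 t)), s ≠ t :=
    ae_restrict_of_ae (Measure.ae_ne volume t)
  filter_upwards [hae, ae_restrict_mem measurableSet_Ioc] with s hst hs
  have hs' : s ∈ Icc 0 t := Ioc_subset_Icc_self hs
  have hst' : s < t := lt_of_le_of_ne hs.2 hst
  have hs0 : 0 ≤ s := hs.1.le
  rw [projIcc_of_mem ht hs']
  have hs1 : 1 + s ≠ 0 := by linarith
  set σ : Icc (0 : ℝ) t := ⟨s, hs'⟩ with hσ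
  set β := (1 + s) ^ (-(7 / 4) : ℝ) with hβs
  have hβs0 : 0 ≤ β := hβ0 s hs0
  have hsm : η * β ≤ 1 / 8 := small s hs0
  have hnear : NearIdentity (meanVel X s t x) (4 * η * β) := by
    refine ⟨?_, fun v v' => hW.norm_meanVel_sub_sub_le hN hE hX hη (by linarith) hs0 hst' x v v',
      by positivity, by linarith⟩
    have e : meanVel X s t x = fun v => (t - s)⁻¹ • (x - (1 + s) • ξ (x, v) σ) := by
      ext1 v
      rw [hξX, smul_smul, mul_inv_cancel₀ hs1, one_smul, meanVel]
    have h1 : ContDiff ℝ N fun v => ξ (x, v) σ :=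
      (ContinuousMap.evalCLM ℝ σ : C(Icc (0 : ℝ) t, Rd d) →L[ℝ] Rd d).contDiff.comp
        (hξ.comp (contDiff_prodMk_right x))
    have h2 : Differentiable ℝ fun v => ξ (x, v) σ := h1.differentiable (by exact_mod_cast hN)
    rw [e]
    exact ((h2.const_smul (1 + s)).const_sub x).const_smul (t - s)⁻¹
  set θ := meanVel X s t x with hθ
  have hdet : ∀ v, |(|(fderiv ℝ θ v).det| - 1)| ≤ Kd * (4 * η * β) := fun v => by
    have h1 := hnear.norm_fderiv_sub_id_le v
    refine (hKd _ (h1.trans (by linarith))).trans ?_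
    gcongr
  have hdet2 : Kd * (4 * η * β) ≤ 1 / 2 := by
    have : η * β ≤ η := mul_le_of_le_one_right hη (hβ s hs0)
    nlinarith
  have hdetlow : ∀ v, 1 / 2 ≤ |(fderiv ℝ θ v).det| := fun v => by
    have := (abs_le.1 (hdet v)).1
    linarith
  have hdetup : ∀ v, |(fderiv ℝ θ v).det| ≤ 2 := fun v => by
    have := (abs_le.1 (hdet v)).2
    linarith
  have jL := integrable_slantedDeriv_right hqL hbL hk x σ
  have jN := integrable_slantedDeriv_right hqN hbN hk x σ
  have jL' := hnear.integrable_comp volume jL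
  rw [← hnear.integral_comp volume (fun v => slantedDeriv T k (fun p => qL p σ) (x, v)),
    ← integral_sub jL' jN]
  refine (enorm_integral_le_lintegral_enorm _).trans ?_
  have pointwise : ∀ v, ‖|(fderiv ℝ θ v).det| • slantedDeriv T k (fun p => qL p σ) (x, θ v) -
      slantedDeriv T k (fun p => qN p σ) (x, v)‖ ≤ (2 * K * (D + 4) + 4 * Kd * K) * η * β *
        (decayWeight (d + 1) (θ v) * fieldSum N E s (x - (t - s) • θ v)) := by
    intro v
    have hw := (decayWeight_pos (d + 1) (θ v)).le
    have hf := fieldSum_nonneg N E s (x - (t - s) • θ v)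
    have h0 : ‖θ v - v‖ ≤ 2 * η * β := hW.norm_meanVel_sub_le hE hX hη hs0 hst' x v
    -- The true and the mean velocity are each within `2ηβ` of `v`; this is the `4` in `D + 4`.
    have h1 : ‖ν ((x, v) + S 0) σ - θ v‖ ≤ 4 * (η * β) := by
      rw [map_zero, add_zero]
      have h2 := hνv (x, v) σ
      have h3 : ν (x, v) σ - θ v = (ν (x, v) σ - v) - (θ v - v) := by abel
      rw [h3]
      refine (norm_sub_le _ _).trans ?_
      simp only at h2
      linarith
    have h2 : freeVel d t ((x, θ v) + S 0) σ = θ v := by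
      rw [map_zero, add_zero, freeVel_apply]
    -- This coincidence of positions is the purpose of the straightening.
    have hpos : ξ ((x, v) + S 0) σ = freePos d t ((x, θ v) + S 0) σ := by
      rw [map_zero, add_zero, add_zero, hξX, freePos_apply]
      simp only [hσ, hθ]
      rw [sub_smul_meanVel hst']
    have hpos' : (1 + s) • freePos d t ((x, θ v) + S 0) σ = x - (t - s) • θ v := by
      rw [map_zero, add_zero, freePos_apply, smul_smul,
        mul_inv_cancel₀ hs1, one_smul]
    have key := hK (gradient μ) (fun z => E σ ((1 + (σ : ℝ)) • z)) _ _ _ _ (θ v)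
      ((D + 4) * η * β) (fieldSum N E s (x - (t - s) • θ v)) hgm hCμ (hec σ σ.2.1)
      (by positivity) (germX (x, v) (x, θ v) σ) (germV (x, v) (x, θ v) σ) hpos
      (fun j hj => (hsum σ _ j hj).trans (le_of_eq (by simp only [hσ, ← hpos'])))
      (h1.trans (by linarith)) (by
        rw [h2, sub_self, norm_zero]
        exact zero_le_one) (by
        simp only [h2]
        refine h1.trans ?_
        have : 0 ≤ D * (η * β) := by positivity
        linarith) k hk
    rw [← slN, ← slL] at key
    set a := slantedDeriv T k (fun p => qL p σ) (x, θ v)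
    set b := slantedDeriv T k (fun p => qN p σ) (x, v)
    set J := |(fderiv ℝ θ v).det|
    set G := fieldSum N E s (x - (t - s) • θ v)
    set ω' := decayWeight (d + 1) (θ v)
    have e : J • a - b = (J - 1) • b - J • (b - a) := by
      rw [sub_smul, one_smul, smul_sub]
      abel
    rw [e]
    refine (norm_sub_le _ _).trans ?_
    rw [norm_smul, norm_smul, Real.norm_eq_abs, Real.norm_of_nonneg (abs_nonneg _)]
    have h4 := hdet v
    have h5 := hdetup v
    calc |J - 1| * ‖b‖ + J * ‖b - a‖
        ≤ Kd * (4 * η * β) * (K * (G * ω')) + 2 * (K * (G * ω') * ((D + 4) * η * β)) := by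
          refine add_le_add ?_ ?_
          · exact mul_le_mul h4 key.1 (norm_nonneg _) (by positivity)
          · exact mul_le_mul h5 key.2 (norm_nonneg _) (by norm_num)
      _ = _ := by ring
  calc _ ≤ ∫⁻ v, ENNReal.ofReal ((2 * K * (D + 4) + 4 * Kd * K) * η * β) *
        ENNReal.ofReal (decayWeight (d + 1) (θ v) * fieldSum N E s (x - (t - s) • θ v)) := by
        refine lintegral_mono fun v => ?_
        rw [← ENNReal.ofReal_mul (by positivity), ← ofReal_norm]
        exact ENNReal.ofReal_le_ofReal (pointwise v)
    _ = ENNReal.ofReal ((2 * K * (D + 4) + 4 * Kd * K) * η * β) * ∫⁻ v,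
        ENNReal.ofReal (decayWeight (d + 1) (θ v) * fieldSum N E s (x - (t - s) • θ v)) :=
      lintegral_const_mul' _ _ ENNReal.ofReal_ne_top
    _ ≤ ENNReal.ofReal ((2 * K * (D + 4) + 4 * Kd * K) * η * β) * (2 * ∫⁻ w : Rd d,
        ENNReal.ofReal (decayWeight (d + 1) w * fieldSum N E s (x - (t - s) • w))) := by
        gcongr
        exact hnear.lintegral_comp_le volume hdetlow
          fun w => ENNReal.ofReal (decayWeight (d + 1) w * fieldSum N E s (x - (t - s) • w))
    _ = _ := by
        rw [← mul_assoc]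
        congr 1
        have h2 : (2 : ℝ≥0∞) = ENNReal.ofReal 2 := by simp
        rw [h2, mul_comm, ← ENNReal.ofReal_mul (by norm_num)]
        congr 1
        ring

end ReactionDensity

/-! ### From the decay of the field to the decay of the free-transport integrals. -/

section DecayEstimates

variable {d : ℕ}

/-- The logarithm is traded for a quarter power, which is the origin of `11/4 = 3 - 1/4` and leaves
room in all later time integrals. -/
theorem log_two_add_le {s : ℝ} (hs : 0 ≤ s) : Real.log (2 + s) ≤ 8 * (1 + s) ^ (1 / 4 : ℝ) := by
  have h1 := Real.log_le_rpow_div (x := 2 + s) (ε := 1 / 4) (by linarith) (by norm_num)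
  have h2 : (2 + s) ^ (1 / 4 : ℝ) ≤ (2 * (1 + s)) ^ (1 / 4 : ℝ) :=
    Real.rpow_le_rpow (by linarith) (by linarith) (by norm_num)
  rw [Real.mul_rpow (by norm_num) (by linarith)] at h2
  have h3 : (2 : ℝ) ^ (1 / 4 : ℝ) ≤ 2 := by
    have := Real.rpow_le_rpow_of_exponent_le (x := 2) (by norm_num) (show (1 / 4 : ℝ) ≤ 1 by norm_num)
    rwa [Real.rpow_one] at this
  have h4 : 0 ≤ (1 + s) ^ (1 / 4 : ℝ) := Real.rpow_nonneg (by linarith) _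
  have h5 : (2 : ℝ) ^ (1 / 4 : ℝ) * (1 + s) ^ (1 / 4 : ℝ) ≤ 2 * (1 + s) ^ (1 / 4 : ℝ) := by gcongr
  linarith

theorem log_two_add_nonneg {s : ℝ} (hs : 0 ≤ s) : 0 ≤ Real.log (2 + s) :=
  Real.log_nonneg (by linarith)

theorem FieldDecay.one_add_pow_mul_le {N : ℕ} {A ε : ℝ} (hA : 0 ≤ A * ε) {E : ℝ → Rd d → Rd d}
    (h : FieldDecay N A ε E) {j : ℕ} (hj : j ≤ N) {s : ℝ} (hs : 0 ≤ s) (x : Rd d) :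
    (1 + s) ^ (d + j) * ‖iteratedFDeriv ℝ j (E s) x‖ ≤ 2 ^ (d + N) * (A * ε * Real.log (2 + s)) := by
  have h1 := (h j hj s hs).1 x
  have h2 := one_add_le_two_mul_japanese s
  have h3 : (2 : ℝ) ^ (d + j) ≤ 2 ^ (d + N) := pow_le_pow_right₀ (by norm_num) (by omega)
  have h4 := log_two_add_nonneg hs
  calc (1 + s) ^ (d + j) * ‖iteratedFDeriv ℝ j (E s) x‖
      ≤ (2 * japanese s) ^ (d + j) * ‖iteratedFDeriv ℝ j (E s) x‖ := by gcongr
    _ = 2 ^ (d + j) * (japanese s ^ (d + j) * ‖iteratedFDeriv ℝ j (E s) x‖) := by rw [mul_pow]; ring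
    _ ≤ 2 ^ (d + j) * (A * ε * Real.log (2 + s)) := by gcongr
    _ ≤ _ := by gcongr

/-- Dimension at least three supplies the cubic decay, of which the logarithm consumes a quarter
power. -/
theorem FieldDecay.weightedField (hd : 3 ≤ d) {N : ℕ} {A ε : ℝ} (hA : 0 ≤ A * ε)
    {E : ℝ → Rd d → Rd d} (h : FieldDecay N A ε E) :
    WeightedField N (2 ^ (d + N) * 8 * A * ε) E := by
  intro k hk τ hτ x
  have hτ0 : 0 < 1 + τ := by linarith
  have h1 := h.one_add_pow_mul_le hA hk hτ x
  have h2 : (1 + τ) ^ (3 + k) ≤ (1 + τ) ^ (d + k) := pow_le_pow_right₀ (by linarith) (by omega)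
  have h3 := log_two_add_le hτ
  have h4 : (1 + τ) ^ 3 * ((1 + τ) ^ k * ‖iteratedFDeriv ℝ k (E τ) x‖) ≤
      (1 + τ) ^ 3 * (2 ^ (d + N) * 8 * A * ε * (1 + τ) ^ (-(11 / 4) : ℝ)) := by
    calc (1 + τ) ^ 3 * ((1 + τ) ^ k * ‖iteratedFDeriv ℝ k (E τ) x‖)
        = (1 + τ) ^ (3 + k) * ‖iteratedFDeriv ℝ k (E τ) x‖ := by rw [pow_add]; ring
      _ ≤ (1 + τ) ^ (d + k) * ‖iteratedFDeriv ℝ k (E τ) x‖ := by gcongr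
      _ ≤ 2 ^ (d + N) * (A * ε * Real.log (2 + τ)) := h1
      _ ≤ 2 ^ (d + N) * (A * ε * (8 * (1 + τ) ^ (1 / 4 : ℝ))) := by gcongr
      _ = _ := by
        have : (1 + τ) ^ (1 / 4 : ℝ) = (1 + τ) ^ 3 * (1 + τ) ^ (-(11 / 4) : ℝ) := by
          rw [← Real.rpow_natCast, ← Real.rpow_add hτ0]
          norm_num
        rw [this]
        ring
  exact le_of_mul_le_mul_left h4 (by positivity)

theorem FieldDecay.fieldSum_le {N : ℕ} {A ε : ℝ} (hA : 0 ≤ A * ε) {E : ℝ → Rd d → Rd d}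
    (h : FieldDecay N A ε E) {s : ℝ} (hs : 0 ≤ s) (x : Rd d) :
    (1 + s) ^ d * fieldSum N E s x ≤ (N + 1) * 2 ^ (d + N) * (A * ε) * Real.log (2 + s) := by
  unfold fieldSum
  rw [max_eq_left hs, Finset.mul_sum]
  have h1 : ∀ j ∈ Finset.range (N + 1), (1 + s) ^ d * ((1 + s) ^ j * ‖iteratedFDeriv ℝ j (E s) x‖) ≤
      2 ^ (d + N) * (A * ε * Real.log (2 + s)) := fun j hj => by
    rw [← mul_assoc, ← pow_add]
    exact h.one_add_pow_mul_le hA (by simpa [Nat.lt_succ_iff] using hj) hs x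
  refine (Finset.sum_le_card_nsmul _ _ _ h1).trans (le_of_eq ?_)
  rw [Finset.card_range, nsmul_eq_mul]
  push_cast
  ring

theorem FieldDecay.lintegral_fieldSum_le {N : ℕ} {A ε : ℝ} {E : ℝ → Rd d → Rd d}
    (hE : IsClassicalField N E) (h : FieldDecay N A ε E) {s : ℝ} (hs : 0 ≤ s) :
    ∫⁻ x, ENNReal.ofReal (fieldSum N E s x) ≤
      ENNReal.ofReal ((N + 1) * 2 ^ (d + N) * (A * ε) * Real.log (2 + s)) := by
  have hl := log_two_add_nonneg hs
  unfold fieldSum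
  rw [max_eq_left hs]
  have hc : ∀ j ∈ Finset.range (N + 1), Continuous (iteratedFDeriv ℝ j (E s)) := fun j hj =>
    (hE.1 s hs).continuous_iteratedFDeriv (by
      have : j ≤ N := by simpa [Nat.lt_succ_iff] using hj
      exact_mod_cast this)
  have e : ∀ x : Rd d, ENNReal.ofReal (∑ j ∈ Finset.range (N + 1),
      (1 + s) ^ j * ‖iteratedFDeriv ℝ j (E s) x‖) = ∑ j ∈ Finset.range (N + 1),
      ENNReal.ofReal ((1 + s) ^ j) * ‖iteratedFDeriv ℝ j (E s) x‖ₑ := fun x => by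
    rw [ENNReal.ofReal_sum_of_nonneg fun i _ => by positivity]
    refine Finset.sum_congr rfl fun j _ => ?_
    rw [ENNReal.ofReal_mul (by positivity), ofReal_norm]
  simp only [e]
  rw [lintegral_finsetSum' _ fun j hj => ((hc j hj).enorm.measurable.const_mul _).aemeasurable]
  have h1 : ∀ j ∈ Finset.range (N + 1),
      ∫⁻ x, ENNReal.ofReal ((1 + s) ^ j) * ‖iteratedFDeriv ℝ j (E s) x‖ₑ ≤
        ENNReal.ofReal (2 ^ (d + N) * (A * ε * Real.log (2 + s))) := fun j hj => by
    have hj' : j ≤ N := by simpa [Nat.lt_succ_iff] using hj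
    rw [lintegral_const_mul' _ _ ENNReal.ofReal_ne_top]
    have h2 := (h j hj' s hs).2
    rw [eLpNorm_one_eq_lintegral_enorm] at h2
    have h3 : (1 + s) ^ j ≤ 2 ^ (d + N) * japanese s ^ j := by
      calc (1 + s) ^ j ≤ (2 * japanese s) ^ j := by
            gcongr
            exact one_add_le_two_mul_japanese s
        _ = 2 ^ j * japanese s ^ j := mul_pow _ _ _
        _ ≤ _ := by
            have : 0 ≤ japanese s := Real.sqrt_nonneg _
            gcongr
            · norm_num
            · omega
    calc _ ≤ ENNReal.ofReal (2 ^ (d + N) * japanese s ^ j) * ∫⁻ x, ‖iteratedFDeriv ℝ j (E s) x‖ₑ := by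
          gcongr
      _ = ENNReal.ofReal (2 ^ (d + N)) *
          (ENNReal.ofReal (japanese s ^ j) * ∫⁻ x, ‖iteratedFDeriv ℝ j (E s) x‖ₑ) := by
          rw [ENNReal.ofReal_mul (by positivity), mul_assoc]
      _ ≤ ENNReal.ofReal (2 ^ (d + N)) * ENNReal.ofReal (A * ε * Real.log (2 + s)) := by gcongr
      _ = _ := (ENNReal.ofReal_mul (by positivity)).symm
  refine (Finset.sum_le_card_nsmul _ _ _ h1).trans (le_of_eq ?_)
  rw [Finset.card_range, nsmul_eq_mul, ← ENNReal.ofReal_natCast, ← ENNReal.ofReal_mul (by positivity)]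
  congr 1
  push_cast
  ring

/-- The logarithm lowers the decay from `7/4` to `3/2`, still integrable: `16` is `8` from the
logarithm times `∫ (1 + s) ^ (-3/2) ≤ 2`. -/
theorem lintegral_time_weight_le {t c Q : ℝ} (ht : 0 ≤ t) (hc : 0 ≤ c) (hQ : 0 ≤ Q) {P : ℝ → ℝ≥0∞}
    (hP : ∀ s ∈ Ioc 0 t, P s ≤ ENNReal.ofReal (Q * Real.log (2 + s))) :
    ∫⁻ s in Ioc 0 t, ENNReal.ofReal (c * (1 + s) ^ (-(7 / 4) : ℝ)) * P s ≤
      ENNReal.ofReal (16 * c * Q) := by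
  have hint := intervalIntegrable_one_add_rpow (-(3 / 2)) le_rfl ht
  rw [intervalIntegrable_iff_integrableOn_Ioc_of_le ht] at hint
  calc ∫⁻ s in Ioc 0 t, ENNReal.ofReal (c * (1 + s) ^ (-(7 / 4) : ℝ)) * P s
      ≤ ∫⁻ s in Ioc 0 t, ENNReal.ofReal (8 * c * Q * (1 + s) ^ (-(3 / 2) : ℝ)) := by
        refine setLIntegral_mono' measurableSet_Ioc fun s hs => ?_
        have hs0 : 0 < 1 + s := by linarith [hs.1]
        have h1 : 0 ≤ (1 + s) ^ (-(7 / 4) : ℝ) := Real.rpow_nonneg hs0.le _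
        calc _ ≤ ENNReal.ofReal (c * (1 + s) ^ (-(7 / 4) : ℝ)) *
              ENNReal.ofReal (Q * Real.log (2 + s)) := by
              gcongr
              exact hP s hs
          _ = ENNReal.ofReal (c * (1 + s) ^ (-(7 / 4) : ℝ) * (Q * Real.log (2 + s))) :=
              (ENNReal.ofReal_mul (by positivity)).symm
          _ ≤ ENNReal.ofReal (c * (1 + s) ^ (-(7 / 4) : ℝ) * (Q * (8 * (1 + s) ^ (1 / 4 : ℝ)))) := by
              refine ENNReal.ofReal_le_ofReal ?_
              have := log_two_add_le hs.1.le
              gcongr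
          _ = _ := by
              have : (1 + s) ^ (-(3 / 2) : ℝ) = (1 + s) ^ (-(7 / 4) : ℝ) * (1 + s) ^ (1 / 4 : ℝ) := by
                rw [← Real.rpow_add hs0]
                norm_num
              rw [this]
              congr 1
              ring
    _ = ENNReal.ofReal (∫ s in Ioc 0 t, 8 * c * Q * (1 + s) ^ (-(3 / 2) : ℝ)) := by
        rw [ofReal_integral_eq_lintegral_ofReal (hint.const_mul _)]
        filter_upwards [ae_restrict_mem measurableSet_Ioc] with s hs
        have : 0 ≤ (1 + s) ^ (-(3 / 2) : ℝ) := Real.rpow_nonneg (by linarith [hs.1]) _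
        simp only [Pi.zero_apply]
        positivity
    _ ≤ _ := by
        refine ENNReal.ofReal_le_ofReal ?_
        rw [integral_const_mul, ← intervalIntegral.integral_of_le ht]
        have h1 := integral_one_add_rpow_le (r := 3 / 2) (by norm_num) le_rfl ht
        rw [add_zero, Real.one_rpow] at h1
        calc 8 * c * Q * ∫ s in (0 : ℝ)..t, (1 + s) ^ (-(3 / 2) : ℝ)
            ≤ 8 * c * Q * (1 / (3 / 2 - 1)) := by gcongr
          _ = _ := by ring

theorem lintegral_comp_sub_smul (f : Rd d → ℝ≥0∞) (hf : Measurable f) (x : Rd d) {c : ℝ} (hc : 0 < c) :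
    ∫⁻ w, f (x - c • w) = ENNReal.ofReal ((c ^ d)⁻¹) * ∫⁻ y, f y := by
  have h1 : ∫⁻ w, f (x - c • w) = ∫⁻ u, f (x - u) ∂(Measure.map (c • ·) volume) :=
    (lintegral_map (hf.comp (measurable_const.sub measurable_id)) (measurable_const_smul c)).symm
  have h2 : ∫⁻ u, f (x - u) = ∫⁻ y, f y := lintegral_sub_left_eq_self f x
  rw [h1, Measure.map_addHaar_smul volume hc.ne', lintegral_smul_measure, h2]
  simp only [finrank_euclideanSpace_fin, smul_eq_mul]
  rw [abs_of_nonneg (by positivity)]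

theorem decayWeight_le_one (n : ℕ) (v : Rd d) : decayWeight n v ≤ 1 := by
  unfold decayWeight
  exact inv_le_one_of_one_le₀ (one_le_pow₀ (by linarith [norm_nonneg v]))

theorem lintegral_decayWeight (d : ℕ) : ∫⁻ w : Rd d, ENNReal.ofReal (decayWeight (d + 1) w) =
    ENNReal.ofReal (∫ w : Rd d, decayWeight (d + 1) w) :=
  (ofReal_integral_eq_lintegral_ofReal (integrable_decayWeight d)
    (Filter.Eventually.of_forall fun w => (decayWeight_pos _ w).le)).symm

/-- Dichotomy in time. If `1 + s ≥ T / 2`, the pointwise decay of the field gives `T ^ (-d)` and the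
weight is integrated in `w`. Otherwise `t - s ≥ T / 2`, and the substitution `y = x - (t - s) w` has
Jacobian `(t - s) ^ (-d)`, so the `L^1` norm of the field suffices. The constant `1 + Ω` covers both
cases. -/
theorem FieldDecay.lintegral_weight_mul_fieldSum_le {N : ℕ} {A ε : ℝ} (hA : 0 ≤ A * ε)
    {E : ℝ → Rd d → Rd d} (hE : IsClassicalField N E) (h : FieldDecay N A ε E) {s t : ℝ}
    (hs : 0 ≤ s) (x : Rd d) :
    ∫⁻ w : Rd d, ENNReal.ofReal (decayWeight (d + 1) w * fieldSum N E s (x - (t - s) • w)) ≤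
      ENNReal.ofReal ((2 / max 1 t) ^ d * ((1 + ∫ w : Rd d, decayWeight (d + 1) w) *
        ((N + 1) * 2 ^ (d + N) * (A * ε))) * Real.log (2 + s)) := by
  set T := max 1 t with hT
  have hT0 : 0 < T := lt_max_of_lt_left one_pos
  have hl := log_two_add_nonneg hs
  set Ω := ∫ w : Rd d, decayWeight (d + 1) w with hΩ
  have hΩ0 : 0 ≤ Ω := integral_nonneg fun w => (decayWeight_pos _ w).le
  set B := (N + 1) * 2 ^ (d + N) * (A * ε) with hB
  have hB0 : 0 ≤ B := by positivity
  have hfc : Measurable fun y => ENNReal.ofReal (fieldSum N E s y) :=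
    (ENNReal.continuous_ofReal.comp
      (hE.continuous_fieldSum.comp (Continuous.prodMk_right s))).measurable
  rcases le_total (T / 2) (1 + s) with hcase | hcase
  · have h1 : ∀ y, fieldSum N E s y ≤ (2 / T) ^ d * (B * Real.log (2 + s)) := fun y => by
      have h2 := h.fieldSum_le hA hs y
      have h3 : (T / 2) ^ d * fieldSum N E s y ≤ B * Real.log (2 + s) := by
        have := fieldSum_nonneg N E s y
        refine le_trans ?_ h2
        gcongr
      rw [show (2 / T) ^ d = ((T / 2) ^ d)⁻¹ by rw [← inv_pow, inv_div], inv_mul_eq_div,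
        le_div_iff₀ (by positivity)]
      linarith
    calc _ ≤ ∫⁻ w : Rd d, ENNReal.ofReal (decayWeight (d + 1) w) *
          ENNReal.ofReal ((2 / T) ^ d * (B * Real.log (2 + s))) := by
          refine lintegral_mono fun w => ?_
          rw [← ENNReal.ofReal_mul (decayWeight_pos _ w).le]
          have := (decayWeight_pos (d + 1) w).le
          refine ENNReal.ofReal_le_ofReal ?_
          gcongr
          exact h1 _
      _ = ENNReal.ofReal (Ω * ((2 / T) ^ d * (B * Real.log (2 + s)))) := by
          rw [lintegral_mul_const' _ _ ENNReal.ofReal_ne_top, lintegral_decayWeight,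
            ENNReal.ofReal_mul hΩ0]
      _ ≤ _ := by
          refine ENNReal.ofReal_le_ofReal ?_
          have : 0 ≤ (2 / T) ^ d * B * Real.log (2 + s) := by positivity
          nlinarith
  · have hts : T / 2 ≤ t - s := by
      rcases le_total 1 t with h1 | h1
      · have : T = t := max_eq_right h1
        linarith
      · have : T = 1 := max_eq_left h1
        linarith
    have hts0 : 0 < t - s := by linarith
    calc _ ≤ ∫⁻ w : Rd d, ENNReal.ofReal (fieldSum N E s (x - (t - s) • w)) := by
          refine lintegral_mono fun w => ENNReal.ofReal_le_ofReal ?_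
          exact mul_le_of_le_one_left (fieldSum_nonneg _ _ _ _) (decayWeight_le_one _ _)
      _ = ENNReal.ofReal (((t - s) ^ d)⁻¹) * ∫⁻ y, ENNReal.ofReal (fieldSum N E s y) :=
          lintegral_comp_sub_smul _ hfc x hts0
      _ ≤ ENNReal.ofReal (((T / 2) ^ d)⁻¹) * ENNReal.ofReal (B * Real.log (2 + s)) := by
          gcongr
          exact h.lintegral_fieldSum_le hE hs
      _ = ENNReal.ofReal ((2 / T) ^ d * (B * Real.log (2 + s))) := by
          rw [← ENNReal.ofReal_mul (by positivity), ← inv_pow, inv_div]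
      _ ≤ _ := by
          refine ENNReal.ofReal_le_ofReal ?_
          have : 0 ≤ (2 / T) ^ d * B * Real.log (2 + s) := by positivity
          nlinarith

/-- By Tonelli and translation invariance in `x` the double integral factors into the mass of the
weight and the `L^1` norm of the field. -/
theorem FieldDecay.lintegral_lintegral_weight_mul_fieldSum_le {N : ℕ} {A ε : ℝ}
    {E : ℝ → Rd d → Rd d} (hE : IsClassicalField N E) (h : FieldDecay N A ε E) {s t : ℝ}
    (hs : 0 ≤ s) :
    ∫⁻ x : Rd d, ∫⁻ w : Rd d,
      ENNReal.ofReal (decayWeight (d + 1) w * fieldSum N E s (x - (t - s) • w)) ≤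
      ENNReal.ofReal ((∫ w : Rd d, decayWeight (d + 1) w) *
        ((N + 1) * 2 ^ (d + N) * (A * ε)) * Real.log (2 + s)) := by
  have hΩ0 : 0 ≤ ∫ w : Rd d, decayWeight (d + 1) w := integral_nonneg fun w => (decayWeight_pos _ w).le
  have hfs : Continuous fun y => fieldSum N E s y :=
    hE.continuous_fieldSum.comp (Continuous.prodMk_right s)
  have hw := continuous_decayWeight (F := Rd d) (d + 1)
  have hc : Continuous fun z : Rd d × Rd d =>
      ENNReal.ofReal (decayWeight (d + 1) z.2 * fieldSum N E s (z.1 - (t - s) • z.2)) := by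
    refine ENNReal.continuous_ofReal.comp ?_
    exact (hw.comp continuous_snd).mul (hfs.comp (by fun_prop))
  rw [lintegral_lintegral_swap (f := fun x w : Rd d =>
    ENNReal.ofReal (decayWeight (d + 1) w * fieldSum N E s (x - (t - s) • w))) hc.measurable.aemeasurable]
  have hinner : ∀ w : Rd d, ∫⁻ x : Rd d,
      ENNReal.ofReal (decayWeight (d + 1) w * fieldSum N E s (x - (t - s) • w)) ≤
      ENNReal.ofReal (decayWeight (d + 1) w) *
        ENNReal.ofReal ((N + 1) * 2 ^ (d + N) * (A * ε) * Real.log (2 + s)) := fun w => by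
    simp only [ENNReal.ofReal_mul (decayWeight_pos (d + 1) w).le]
    rw [lintegral_const_mul' _ _ ENNReal.ofReal_ne_top,
      lintegral_sub_right_eq_self (fun x => ENNReal.ofReal (fieldSum N E s x)) ((t - s) • w)]
    gcongr
    exact h.lintegral_fieldSum_le hE hs
  refine (lintegral_mono hinner).trans (le_of_eq ?_)
  rw [lintegral_mul_const' _ _ ENNReal.ofReal_ne_top, lintegral_decayWeight, ← ENNReal.ofReal_mul hΩ0]
  congr 1
  ring

end DecayEstimates

/-! ### Assembly of the two norms. -/

section Main

variable {d : ℕ}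

theorem japanese_nonneg (r : ℝ) : 0 ≤ japanese r := Real.sqrt_nonneg _

theorem japanese_le_two_mul_max {t : ℝ} (ht : 0 ≤ t) : japanese t ≤ 2 * max 1 t := by
  have h : japanese t ≤ 1 + t := Real.sqrt_le_iff.2 ⟨by linarith, by nlinarith⟩
  linarith [le_max_left 1 t, le_max_right 1 t]

theorem lintegral_weighted_fieldSum_le {N : ℕ} {A ε c t : ℝ} (hA : 0 ≤ A * ε) (hc : 0 ≤ c)
    (ht : 0 ≤ t) {E : ℝ → Rd d → Rd d} (hE : IsClassicalField N E) (h : FieldDecay N A ε E) :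
    ∫⁻ x : Rd d, ∫⁻ s in Ioc 0 t, ENNReal.ofReal (c * (1 + s) ^ (-(7 / 4) : ℝ)) *
      ∫⁻ w : Rd d, ENNReal.ofReal (decayWeight (d + 1) w * fieldSum N E s (x - (t - s) • w)) ≤
    ENNReal.ofReal (16 * c * ((∫ w : Rd d, decayWeight (d + 1) w) *
        ((N + 1) * 2 ^ (d + N) * (A * ε)))) := by
  have hΩ0 : 0 ≤ ∫ w : Rd d, decayWeight (d + 1) w := integral_nonneg fun w => (decayWeight_pos _ w).le
  have hw := continuous_decayWeight (F := Rd d) (d + 1)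
  have hfs := hE.continuous_fieldSum
  have hm : Measurable fun p : (Rd d × ℝ) × Rd d => ENNReal.ofReal
      (decayWeight (d + 1) p.2 * fieldSum N E p.1.2 (p.1.1 - (t - p.1.2) • p.2)) := by
    refine (ENNReal.continuous_ofReal.comp ((hw.comp continuous_snd).mul ?_)).measurable
    exact hfs.comp (f := fun p : (Rd d × ℝ) × Rd d => (p.1.2, p.1.1 - (t - p.1.2) • p.2))
      (by fun_prop)
  have hm2 : Measurable fun p : Rd d × ℝ => ∫⁻ w : Rd d, ENNReal.ofReal
      (decayWeight (d + 1) w * fieldSum N E p.2 (p.1 - (t - p.2) • w)) := hm.lintegral_prod_right'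
  have hm3 : Measurable fun p : Rd d × ℝ => ENNReal.ofReal (c * (1 + p.2) ^ (-(7 / 4) : ℝ)) *
      ∫⁻ w : Rd d, ENNReal.ofReal
        (decayWeight (d + 1) w * fieldSum N E p.2 (p.1 - (t - p.2) • w)) :=
    Measurable.mul (by fun_prop) hm2
  rw [lintegral_lintegral_swap (f := fun (x : Rd d) (s : ℝ) =>
    ENNReal.ofReal (c * (1 + s) ^ (-(7 / 4) : ℝ)) * ∫⁻ w : Rd d, ENNReal.ofReal
      (decayWeight (d + 1) w * fieldSum N E s (x - (t - s) • w))) hm3.aemeasurable]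
  simp only [lintegral_const_mul' _ _ ENNReal.ofReal_ne_top]
  exact lintegral_time_weight_le ht hc (by positivity) fun s hs =>
    h.lintegral_lintegral_weight_mul_fieldSum_le hE hs.1.le

end Main

end

theorem theorem5p4 (d N : ℕ) (hd : 3 ≤ d) (hN : 1 < N)
    (μ : Rd d → ℝ) (hμ : ContDiff ℝ ∞ μ) (hμdecay : RapidDecay μ)
    (A : ℝ) (hA : 0 < A) :
    ∃ ε₀ : ℝ, 0 < ε₀ ∧ ∃ C : ℝ, 0 < C ∧
      ∀ ε : ℝ, 0 < ε → ε ≤ ε₀ →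
      ∀ (E : ℝ → Rd d → Rd d) (X V : ℝ → ℝ → Rd d → Rd d → Rd d),
        IsClassicalField N E → IsCharacteristics E X V →
        FieldDecay N A ε E →
        PertDecay N A ε (d - 2) (posPert X) →
        PertDecay N A ε (d - 1) (velPert V) →
        ∀ t : ℝ, 0 ≤ t →
          ContDiff ℝ N (reaction E μ X V t) ∧
          ∀ k : ℕ, k ≤ N →
            ENNReal.ofReal (japanese t ^ k)
                * eLpNorm (iteratedFDeriv ℝ k (reaction E μ X V t)) 1 volume
              + ENNReal.ofReal (japanese t ^ (d + k))
                * eLpNorm (iteratedFDeriv ℝ k (reaction E μ X V t)) ∞ volume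
              ≤ ENNReal.ofReal (C * ε ^ 2) := by
  obtain ⟨η₀, hη₀, K, hK, H⟩ := exists_reaction_bound d N (by omega) hμ hμdecay
  have hΩ : 0 ≤ ∫ w : Rd d, decayWeight (d + 1) w := integral_nonneg fun w => (decayWeight_pos _ w).le
  set Ω := ∫ w : Rd d, decayWeight (d + 1) w with hΩdef
  set A₁ : ℝ := 2 ^ (d + N) * 8 * A with hA₁
  have hA₁0 : 0 < A₁ := by positivity
  set B : ℝ := (N + 1) * 2 ^ (d + N) * A with hB
  have hB0 : 0 < B := by positivity
  -- The threshold makes the weighted field size `A₁ ε` at most `η₀`. The two main summands of the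
  -- constant are the `L^1` and `L^∞` bounds, with `2 ^ N` and `2 ^ (d + N)` from `⟨t⟩ ≤ 2 T`; the
  -- final `1` makes the constant positive.
  refine ⟨η₀ / A₁, by positivity,
    2 ^ N * (16 * (K * A₁) * (Ω * B)) + 2 ^ (d + N) * (16 * (K * A₁) * (2 ^ d * ((1 + Ω) * B))) + 1,
    by positivity, ?_⟩
  intro ε hε hεle E X V hE hXV hdec _ _ t ht
  have hη : A₁ * ε ≤ η₀ := by
    rw [le_div_iff₀ hA₁0] at hεle
    linarith
  have hAε : 0 ≤ A * ε := by positivity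
  have hc : 0 ≤ K * (A₁ * ε) := by positivity
  obtain ⟨hsm, hbd⟩ := H t (A₁ * ε) E X V ht (by positivity) hη hE hXV (hdec.weightedField hd hAε)
  refine ⟨hsm, fun k hk => ?_⟩
  set T := max 1 t with hT
  have hT1 : 1 ≤ T := le_max_left _ _
  have hT0 : 0 < T := by linarith
  have hj := japanese_nonneg t
  have hjT : japanese t ≤ 2 * T := japanese_le_two_mul_max ht
  have hjk : japanese t ^ k ≤ 2 ^ N * T ^ k := by
    calc japanese t ^ k ≤ (2 * T) ^ k := by gcongr
      _ = 2 ^ k * T ^ k := mul_pow _ _ _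
      _ ≤ _ := by
        gcongr
        norm_num
  have hjdk : japanese t ^ (d + k) ≤ 2 ^ (d + N) * T ^ d * T ^ k := by
    calc japanese t ^ (d + k) ≤ (2 * T) ^ (d + k) := by gcongr
      _ = 2 ^ (d + k) * T ^ d * T ^ k := by rw [mul_pow, pow_add T, mul_assoc]
      _ ≤ _ := by
        gcongr
        norm_num
  have hL1 : ENNReal.ofReal (japanese t ^ k)
      * eLpNorm (iteratedFDeriv ℝ k (reaction E μ X V t)) 1 volume ≤
      ENNReal.ofReal (2 ^ N * (16 * (K * A₁) * (Ω * B)) * ε ^ 2) := by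
    rw [eLpNorm_one_eq_lintegral_enorm]
    calc _ ≤ ENNReal.ofReal (2 ^ N * T ^ k) *
          ∫⁻ x, ‖iteratedFDeriv ℝ k (reaction E μ X V t) x‖ₑ := by gcongr
      _ = ENNReal.ofReal (2 ^ N) * ∫⁻ x, ENNReal.ofReal (T ^ k) *
          ‖iteratedFDeriv ℝ k (reaction E μ X V t) x‖ₑ := by
        rw [ENNReal.ofReal_mul (by positivity), mul_assoc,
          lintegral_const_mul' _ _ ENNReal.ofReal_ne_top]
      -- One factor `ε` is the bending of the trajectories, `A₁ ε`; the other is the size of the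
      -- field, `A ε`.
      _ ≤ ENNReal.ofReal (2 ^ N) *
          ENNReal.ofReal (16 * (K * (A₁ * ε)) * (Ω * ((N + 1) * 2 ^ (d + N) * (A * ε)))) := by
        gcongr
        exact (lintegral_mono fun x => hbd k hk x).trans
          (lintegral_weighted_fieldSum_le hAε hc ht hE hdec)
      _ = _ := by
        rw [← ENNReal.ofReal_mul (by positivity), hB]
        congr 1
        ring
  have hLinf : ENNReal.ofReal (japanese t ^ (d + k))
      * eLpNorm (iteratedFDeriv ℝ k (reaction E μ X V t)) ∞ volume ≤
      ENNReal.ofReal (2 ^ (d + N) * (16 * (K * A₁) * (2 ^ d * ((1 + Ω) * B))) * ε ^ 2) := by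
    have hpt : ∀ x, ‖iteratedFDeriv ℝ k (reaction E μ X V t) x‖ₑ ≤
        ENNReal.ofReal ((T ^ k)⁻¹ * (16 * (K * (A₁ * ε)) *
          ((2 / T) ^ d * ((1 + Ω) * ((N + 1) * 2 ^ (d + N) * (A * ε)))))) := fun x => by
      have h1 := (hbd k hk x).trans (lintegral_time_weight_le ht hc (by positivity) fun s hs =>
        hdec.lintegral_weight_mul_fieldSum_le hAε hE hs.1.le x)
      rw [← ofReal_norm, ← ENNReal.ofReal_mul (by positivity),
        ENNReal.ofReal_le_ofReal_iff (by positivity)] at h1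
      rw [← ofReal_norm]
      refine ENNReal.ofReal_le_ofReal ?_
      rwa [inv_mul_eq_div, le_div_iff₀' (by positivity)]
    have hsup : eLpNorm (iteratedFDeriv ℝ k (reaction E μ X V t)) ∞ volume ≤
        ENNReal.ofReal ((T ^ k)⁻¹ * (16 * (K * (A₁ * ε)) *
          ((2 / T) ^ d * ((1 + Ω) * ((N + 1) * 2 ^ (d + N) * (A * ε)))))) := by
      rw [eLpNorm_exponent_top]
      exact essSup_le_of_ae_le _ (Filter.Eventually.of_forall hpt)
    -- `T ^ k` cancels against the slanted derivatives and `T ^ d` against the dispersive factor `(2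
    -- / T) ^ d`.
    calc _ ≤ ENNReal.ofReal (2 ^ (d + N) * T ^ d * T ^ k) *
          ENNReal.ofReal ((T ^ k)⁻¹ * (16 * (K * (A₁ * ε)) *
            ((2 / T) ^ d * ((1 + Ω) * ((N + 1) * 2 ^ (d + N) * (A * ε)))))) := by
          gcongr
      _ = _ := by
        rw [← ENNReal.ofReal_mul (by positivity), hB, div_pow]
        congr 1
        field_simp
  refine (add_le_add hL1 hLinf).trans ?_
  rw [← ENNReal.ofReal_add (by positivity) (by positivity)]
  refine ENNReal.ofReal_le_ofReal ?_
  nlinarith [sq_nonneg ε]
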